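/- **Setting.** Let $d\ge 1$, let $\Gamma\subset\mathbb R^d$ be a lattice with determinant (covolume) $\mathrm d(\Gamma)$, fundamental domain $\mathcal O$ and dual lattice $\Gamma^\dagger=\{\theta:\langle\theta,g\rangle\in 2\pi\mathbb Z\ \ \forall g\in\Gamma\}$. For $t\in\mathbb R^d$ put $\langle t\rangle=\sqrt{1+|t|^2}$. Let $m>0$, $\alpha\in\mathbb R$, $0<\varkappa<\beta\le 1$, $w(\xi)=\langle\xi\rangle^\beta$. A *symbol* is a function $b(x,\xi)$ on $\mathbb R^d\times\mathbb R^d$ that is $\Gamma$-periodic and continuous in $x$, with Fourier coefficients $\hat b(\theta,\xi)=\mathrm d(\Gamma)^{-1/2}\int_{\mathcal O}e^{-i\langle\theta,x\rangle}b(x,\xi)\,dx$, $\theta\in\Gamma^\dagger$, that are $C^\infty$ in $\xi$. It belongs to $\mathbf S_\gamma$, $\gamma\in\mathbb R$, if for all real $l\ge 0$ and integers $s\ge 0$ $$|\!|\!|b|\!|\!|^{(\gamma)}_{l,s}:=\max_{|\mathbf s|\le s}\ \sup_{\xi\in\mathbb R^d,\ \theta\in\Gamma^\dagger}\langle\theta\rangle^{l}\,w(\xi)^{-\gamma+|\mathbf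 s|}\,|D^{\mathbf s}_\xi\hat b(\theta,\xi)|<\infty .$$ It is *symmetric* if $\hat b(\theta,\xi)=\overline{\hat b(-\theta,\xi+\theta)}$ for all $\theta\in\Gamma^\dagger$, $\xi\in\mathbb R^d$. For a function $a(x,\xi)$, $\mathrm{Op}(a)u(x)=(2\pi)^{-d/2}\int a(x,\xi)e^{i\langle\xi,x\rangle}(\mathcal Fu)(\xi)\,d\xi$ on Schwartz functions $u$, where $\mathcal F$ is the unitary Fourier transform; the same notation is used for the closure of this operator in $L^2(\mathbb R^d)$. Let $H_0=\mathrm{Op}(|\xi|^{2m})$ and $H=\mathrm{Op}(|\xi|^{2m}+b)$. Fix $\iota\in C^\infty(\mathbb R)$ with $0\le\iota\le1$, $\iota(z)=1$ for $z\le\frac14$ and $\iota(z)=0$ for $z\ge\frac12$. For $\rho\ge 1$, $1\le r\le\rho^{\varkappa}$ let $\Theta_r=\{\theta\in\Gamma^\dagger:0<|\theta|\le r\}$ and $$e_\theta(\xi)=\iota\Bigl(\Bigl|\tfrac{|\xi+\theta/2|}{\rho}-1\Bigr|\Bigr),\quad \ell^>_\theta(\xi)=1-\iota\Bigl(\tfrac{|\xi+\theta/2|}{\rho}-1\Bigr),\quad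 \ell^<_\theta(\xi)=1-\iota\Bigl(1-\tfrac{|\xi+\theta/2|}{\rho}\Bigr),\quad \zeta_\theta(\xi)=\iota\Bigl(\tfrac{|\theta\cdot(\xi+\theta/2)|}{\rho^\beta|\theta|}\Bigr).$$ For a symbol $x$ with Fourier coefficients $\hat x(\theta,\xi)$, the symbols $x^o$, $x^\flat$, $x^\downarrow$, $x^\sharp$, $x^\uparrow$ are those whose Fourier coefficients are, respectively, $\hat x(0,\xi)$ at $\theta=0$; $\hat x\,\zeta_\theta e_\theta$, $\hat x\,\ell^<_\theta$, $\hat x\,\ell^>_\theta$ at $\theta\in\Theta_r$; $\hat x$ at $\theta\in\Gamma^\dagger\setminus(\Theta_r\cup\{0\})$; and $0$ at all other $\theta$. The operators with these symbols are denoted $X^o$, $X^\flat$, $X^\downarrow$, $X^\sharp$, $X^\uparrow$. Finally $$\sigma=\alpha-(2m-2)\beta^{-1}-1,\qquad \epsilon_j=j(\sigma-1)+(2m-2)\beta^{-1}+2 .$$ **Theorem.** Suppose that $2m-2>\beta(\alpha-2)$. Then $\epsilon_j\to-\infty$ as $j\to\infty$. Moreover, for every integer $M\ge1$, all $\rho\ge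 1$ and $1\le r\le\rho^\varkappa$, and every symmetric $b\in\mathbf S_\alpha$ there are symmetric symbols $\psi$, $x$ with $\psi\in\mathbf S_\gamma$ for all $\gamma\in\mathbb R$ and $x\in\mathbf S_\alpha$, such that $\Psi=\mathrm{Op}(\psi)$ is bounded and self-adjoint, and a bounded self-adjoint operator $R_{M+1}$, such that $$e^{-i\Psi}He^{i\Psi}=H_0+X^o+X^\flat+(X^\downarrow+X^\sharp+X^\uparrow)+R_{M+1}$$ as an equality of unbounded operators, domains included, and, for all $\gamma\in\mathbb R$, $l\ge0$ and integers $s\ge0$, $$|\!|\!|\psi|\!|\!|^{(\gamma)}_{l,s}\le C_1\rho^{\beta(\sigma-\gamma)}|\!|\!|b|\!|\!|^{(\alpha)}_{p_1,n_1},\qquad |\!|\!|x|\!|\!|^{(\alpha)}_{l,s}\le C_2|\!|\!|b|\!|\!|^{(\alpha)}_{p_2,n_2},\qquad \|R_{M+1}\|\le C_3\rho^{\beta\epsilon_{M+1}}\bigl(|\!|\!|b|\!|\!|^{(\alpha)}_{p_3,n_3}\bigr)^{M+1}.$$ Here $C_1,p_1,n_1$ depend on $\gamma,l,s$, and $C_2,p_2,n_2$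 on $l,s$. Apart from this, all the constants $C_i$ and indices $p_i,n_i$ depend only on $d,\Gamma,m,\alpha,\beta,\varkappa,\iota,M$ and on constants $K_{l,s}$ such that $|\!|\!|b|\!|\!|^{(\alpha)}_{l,s}\le K_{l,s}$ for all $l,s$; they do not depend on $\rho$, $r$ or $b$ otherwise. -/

import Mathlib

open MeasureTheory Filter Topology
open scoped NNReal ENNReal SchwartzMap ContDiff ComplexConjugate

namespace PeriodicPDO

noncomputable section

/-- The space `ℝ^d` with its Euclidean structure. -/
abbrev E (d : ℕ) : Type := EuclideanSpace ℝ (Fin d)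

/-- The Hilbert space `L²(ℝ^d)`. -/
abbrev L2 (d : ℕ) : Type := Lp ℂ 2 (volume : Measure (E d))

/-- A symbol `b(x, ξ)`. -/
abbrev Symb (d : ℕ) : Type := E d → E d → ℂ

/-- `⟨t⟩ = √(1 + |t|²)`. -/
def bracket {d : ℕ} (t : E d) : ℝ := √(1 + ‖t‖ ^ 2)

/-- The weight `w(ξ) = ⟨ξ⟩^β`. -/
def weight {d : ℕ} (β : ℝ) (ξ : E d) : ℝ := bracket ξ ^ β

/-- `e^{i⟨ξ, x⟩}`. -/
def expI {d : ℕ} (ξ x : E d) : ℂ := Complex.exp (Complex.I * ((inner ℝ ξ x : ℝ) : ℂ))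

/-! ### Lattices and Fourier coefficients -/

/-- The dual lattice, normalized so that the dual of `(2πℤ)^d` is `ℤ^d`. -/
def dualLattice {d : ℕ} (Γ : Submodule ℤ (E d)) : Set (E d) :=
  {θ | ∀ g ∈ Γ, ∃ n : ℤ, inner ℝ θ g = 2 * Real.pi * n}

/-- A fundamental domain of the lattice: the half-open parallelepiped spanned by a basis. -/
def fundDomain {d : ℕ} (Γ : Submodule ℤ (E d)) [DiscreteTopology Γ] [IsZLattice ℝ Γ] :
    Set (E d) :=
  haveI : Module.Finite ℤ Γ := ZLattice.module_finite ℝ Γ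
  haveI : Module.Free ℤ Γ := ZLattice.module_free ℝ Γ
  ZSpan.fundamentalDomain ((Module.Free.chooseBasis ℤ Γ).ofZLatticeBasis ℝ)

/-- The Fourier coefficient `b̂(θ, ξ)` of the symbol in its first variable,
`b̂(θ, ξ) = d(Γ)^{-1/2} ∫_O e^{-i⟨θ, x⟩} b(x, ξ) dx`. -/
def symbCoeff {d : ℕ} (Γ : Submodule ℤ (E d)) [DiscreteTopology Γ] [IsZLattice ℝ Γ]
    (b : Symb d) (θ ξ : E d) : ℂ :=
  ((1 / √(ZLattice.covolume Γ) : ℝ) : ℂ) * ∫ x in fundDomain Γ, expI θ (-x) * b x ξ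

/-! ### Symbol classes -/

/-- The norm `⦀b⦀^{(α)}_{l,s}`, with values in `[0, ∞]`. The derivatives `D_ξ^𝐬` of order `k` are
the values of the `k`-th derivative on tuples of standard basis vectors. -/
def symbNorm {d : ℕ} (Γ : Submodule ℤ (E d)) [DiscreteTopology Γ] [IsZLattice ℝ Γ]
    (w : E d → ℝ) (α : ℝ) (l : ℝ≥0) (s : ℕ) (b : Symb d) : ℝ≥0∞ :=
  ⨆ (k : ℕ) (_ : k ≤ s) (j : Fin k → Fin d) (ξ : E d) (θ : dualLattice Γ),
    ENNReal.ofReal (bracket (θ : E d) ^ (l : ℝ) * w ξ ^ (-α + (k : ℝ)) *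
      ‖iteratedFDeriv ℝ k (fun η => symbCoeff Γ b (θ : E d) η) ξ
        (fun i => EuclideanSpace.single (j i) (1 : ℝ))‖)

/-- The class `S_α(w, Γ)`. -/
structure MemSymb {d : ℕ} (Γ : Submodule ℤ (E d)) [DiscreteTopology Γ] [IsZLattice ℝ Γ]
    (w : E d → ℝ) (α : ℝ) (b : Symb d) : Prop where
  periodic : ∀ g ∈ Γ, ∀ x ξ, b (x + g) ξ = b x ξ
  continuous : ∀ ξ, Continuous fun x => b x ξ
  smooth : ∀ θ ∈ dualLattice Γ, ContDiff ℝ ∞ fun ξ => symbCoeff Γ b θ ξ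
  finite : ∀ (l : ℝ≥0) (s : ℕ), symbNorm Γ w α l s b < ⊤

/-- Symmetric symbols: `b̂(θ, ξ)` is the conjugate of `b̂(-θ, ξ + θ)`. -/
def IsSymmSymb {d : ℕ} (Γ : Submodule ℤ (E d)) [DiscreteTopology Γ] [IsZLattice ℝ Γ]
    (b : Symb d) : Prop :=
  ∀ θ ∈ dualLattice Γ, ∀ ξ, symbCoeff Γ b θ ξ = conj (symbCoeff Γ b (-θ) (ξ + θ))

/-! ### Pseudo-differential operators -/

/-- The unitary Fourier transform `(2π)^{-d/2} ∫ e^{-i⟨ξ, x⟩} f(x) dx`. -/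
def fourierTr {d : ℕ} (f : E d → ℂ) (ξ : E d) : ℂ :=
  (((2 * Real.pi) ^ (-(d : ℝ) / 2) : ℝ) : ℂ) * ∫ x, expI ξ (-x) * f x

/-- The function `Op(b) f`, given by `(2π)^{-d/2} ∫ b(x, ξ) e^{i⟨ξ, x⟩} (ℱf)(ξ) dξ`. -/
def opFun {d : ℕ} (b : Symb d) (f : E d → ℂ) (x : E d) : ℂ :=
  (((2 * Real.pi) ^ (-(d : ℝ) / 2) : ℝ) : ℂ) * ∫ ξ, b x ξ * expI ξ x * fourierTr f ξ

lemma integrable_expI_mul {d : ℕ} (ξ : E d) (f : 𝓢(E d, ℂ)) :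
    Integrable fun x => expI ξ (-x) * f x := by
  refine f.integrable.bdd_mul (c := 1) ?_ ?_
  · unfold expI
    exact (by fun_prop : Continuous fun x : E d =>
      Complex.exp (Complex.I * ((inner ℝ ξ (-x) : ℝ) : ℂ))).aestronglyMeasurable
  · refine Filter.Eventually.of_forall fun x => ?_
    rw [expI, mul_comm, Complex.norm_exp_ofReal_mul_I]

lemma fourierTr_add {d : ℕ} (f g : 𝓢(E d, ℂ)) (ξ : E d) :
    fourierTr (f + g : 𝓢(E d, ℂ)) ξ = fourierTr f ξ + fourierTr g ξ := by
  simp only [fourierTr, _root_.add_apply, mul_add]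
  rw [integral_add (integrable_expI_mul ξ f) (integrable_expI_mul ξ g), mul_add]

lemma fourierTr_smul {d : ℕ} (c : ℂ) (f : 𝓢(E d, ℂ)) (ξ : E d) :
    fourierTr (c • f : 𝓢(E d, ℂ)) ξ = c * fourierTr f ξ := by
  simp only [fourierTr, _root_.smul_apply, smul_eq_mul, mul_left_comm _ c]
  rw [integral_const_mul, mul_left_comm]

lemma fourierTr_zero {d : ℕ} (ξ : E d) : fourierTr (0 : 𝓢(E d, ℂ)) ξ = 0 := by
  have h := fourierTr_smul (0 : ℂ) (0 : 𝓢(E d, ℂ)) ξ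
  rwa [zero_smul, zero_mul] at h

/-- The graph in `L² × L²` of `Op(b)` on the Schwartz class: the pairs `(f, Op(b) f)`, where `f` is
a Schwartz function such that the integrals defining `Op(b) f` converge absolutely and
`Op(b) f` is in `L²`. -/
def opGraph {d : ℕ} (b : Symb d) : Submodule ℂ (L2 d × L2 d) where
  carrier := {p | ∃ f : 𝓢(E d, ℂ), p.1 = f.toLp 2 ∧
    (∀ x, Integrable fun ξ => b x ξ * expI ξ x * fourierTr f ξ) ∧ p.2 =ᵐ[volume] opFun b f}
  zero_mem' := by
    refine ⟨0, ?_, ?_, ?_⟩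
    · exact ((SchwartzMap.toLpCLM ℂ ℂ 2 (volume : Measure (E d))).map_zero).symm
    · intro x; simp only [fourierTr_zero, mul_zero]; exact integrable_zero _ _ _
    · refine (Lp.coeFn_zero ℂ 2 (volume : Measure (E d))).trans
        (Filter.Eventually.of_forall fun x => ?_)
      simp only [opFun, fourierTr_zero, mul_zero, integral_zero, Pi.zero_apply]
  add_mem' := by
    rintro p q ⟨f, hf1, hf2, hf3⟩ ⟨g, hg1, hg2, hg3⟩
    refine ⟨f + g, ?_, ?_, ?_⟩
    · rw [Prod.fst_add, hf1, hg1]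
      exact ((SchwartzMap.toLpCLM ℂ ℂ 2 (volume : Measure (E d))).map_add f g).symm
    · intro x
      simp only [fourierTr_add, mul_add]
      exact (hf2 x).add (hg2 x)
    · filter_upwards [Lp.coeFn_add p.2 q.2, hf3, hg3] with x h1 h2 h3
      rw [Prod.snd_add, h1, Pi.add_apply, h2, h3]
      simp only [opFun, fourierTr_add, mul_add]
      rw [integral_add (hf2 x) (hg2 x), mul_add]
  smul_mem' := by
    rintro c p ⟨f, hf1, hf2, hf3⟩
    refine ⟨c • f, ?_, ?_, ?_⟩
    · rw [Prod.smul_fst, hf1]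
      exact ((SchwartzMap.toLpCLM ℂ ℂ 2 (volume : Measure (E d))).map_smul c f).symm
    · intro x
      simp only [fourierTr_smul, mul_left_comm _ c]
      exact (hf2 x).const_mul c
    · filter_upwards [Lp.coeFn_smul c p.2, hf3] with x h1 h2
      rw [Prod.smul_snd, h1, Pi.smul_apply, h2]
      simp only [opFun, fourierTr_smul, mul_left_comm _ c, smul_eq_mul]
      rw [integral_const_mul, mul_left_comm]

/-- `Op(b)` on the Schwartz class, as an unbounded operator in `L²(ℝ^d)`. -/
def opCore {d : ℕ} (b : Symb d) : L2 d →ₗ.[ℂ] L2 d := (opGraph b).toLinearPMap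

lemma opCore_graph {d : ℕ} (b : Symb d) : (opCore b).graph = opGraph b := by
  refine Submodule.toLinearPMap_graph_eq _ ?_
  rintro ⟨u, v⟩ ⟨f, hf1, -, hf3⟩ (hu : u = 0)
  have hf : f = 0 := by
    refine SchwartzMap.injective_toLp 2 (volume : Measure (E d)) ?_
    change f.toLp 2 = (0 : 𝓢(E d, ℂ)).toLp 2
    rw [← hf1]
    exact hu.trans ((SchwartzMap.toLpCLM ℂ ℂ 2 (volume : Measure (E d))).map_zero).symm
  refine Lp.ext (hf3.trans (EventuallyEq.trans ?_
    (Lp.coeFn_zero ℂ 2 (volume : Measure (E d))).symm))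
  refine Filter.Eventually.of_forall fun x => ?_
  simp only [opFun, hf, fourierTr_zero, mul_zero, integral_zero, Pi.zero_apply]

/-- The closed operator in `L²(ℝ^d)` defined by the symbol `b`: the closure of `Op(b)` from the
Schwartz class. -/
def op {d : ℕ} (b : Symb d) : L2 d →ₗ.[ℂ] L2 d := (opCore b).closure

/-- A bounded operator, viewed as an unbounded operator with domain the whole space. -/
def bdd {d : ℕ} (T : L2 d →L[ℂ] L2 d) : L2 d →ₗ.[ℂ] L2 d :=
  (T : L2 d →ₗ[ℂ] L2 d).toPMap ⊤

/-- The product `V A U` with `U`, `V` bounded, on its natural domain `{u | U u ∈ D(A)}`. -/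
def sandwich {d : ℕ} (V : L2 d →L[ℂ] L2 d) (A : L2 d →ₗ.[ℂ] L2 d) (U : L2 d →L[ℂ] L2 d) :
    L2 d →ₗ.[ℂ] L2 d where
  domain := A.domain.comap (U : L2 d →ₗ[ℂ] L2 d)
  toFun := (V : L2 d →ₗ[ℂ] L2 d) ∘ₗ A.toFun ∘ₗ
    ((U : L2 d →ₗ[ℂ] L2 d).restrict (p := A.domain.comap (U : L2 d →ₗ[ℂ] L2 d))
      (q := A.domain) fun _ hu => hu)

/-- The symbol `h₀(ξ) = |ξ|^{2m}`. -/
def h₀ {d : ℕ} (m : ℝ) : Symb d := fun _ ξ => ((‖ξ‖ ^ (2 * m) : ℝ) : ℂ)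

/-! ### The partition of a symbol -/

/-- The cut-off profile `ι`. -/
structure IsCutoff (ι : ℝ → ℝ) : Prop where
  smooth : ContDiff ℝ ∞ ι
  nonneg : ∀ z, 0 ≤ ι z
  le_one : ∀ z, ι z ≤ 1
  eq_one : ∀ z, z ≤ 1 / 4 → ι z = 1
  eq_zero : ∀ z, 1 / 2 ≤ z → ι z = 0

/-- `e_θ(ξ)`, living on energies comparable with `ρ`. -/
def cutE {d : ℕ} (ι : ℝ → ℝ) (ρ : ℝ) (θ ξ : E d) : ℝ :=
  ι |‖ξ + (1 / 2 : ℝ) • θ‖ / ρ - 1|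

/-- `ℓ^>_θ(ξ)`, living on large energies. -/
def cutGt {d : ℕ} (ι : ℝ → ℝ) (ρ : ℝ) (θ ξ : E d) : ℝ :=
  1 - ι (‖ξ + (1 / 2 : ℝ) • θ‖ / ρ - 1)

/-- `ℓ^<_θ(ξ)`, living on small energies. -/
def cutLt {d : ℕ} (ι : ℝ → ℝ) (ρ : ℝ) (θ ξ : E d) : ℝ :=
  1 - ι (1 - ‖ξ + (1 / 2 : ℝ) • θ‖ / ρ)

/-- `ζ_θ(ξ; L)`, living in the resonant layer of width of order `L` around `θ·(ξ + θ/2) = 0`. -/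
def cutZeta {d : ℕ} (ι : ℝ → ℝ) (L : ℝ) (θ ξ : E d) : ℝ :=
  ι (|inner ℝ θ (ξ + (1 / 2 : ℝ) • θ)| / (L * ‖θ‖))

/-- The set `Θ_r` of the non-zero vectors of the dual lattice of length at most `r`. -/
def Theta {d : ℕ} (Γ : Submodule ℤ (E d)) (r : ℝ) : Set (E d) :=
  {θ | θ ∈ dualLattice Γ ∧ 0 < ‖θ‖ ∧ ‖θ‖ ≤ r}

section Parts

variable {d : ℕ} (Γ : Submodule ℤ (E d)) [DiscreteTopology Γ] [IsZLattice ℝ Γ]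

/-- The symbol `d(Γ)^{-1/2} ∑_{θ ∈ T} b̂(θ, ξ) c_θ(ξ) e^{i⟨θ, x⟩}`. -/
def cutSymb (T : Set (E d)) (c : E d → E d → ℝ) (b : Symb d) : Symb d := fun x ξ =>
  ((1 / √(ZLattice.covolume Γ) : ℝ) : ℂ) *
    ∑' θ : T, symbCoeff Γ b (θ : E d) ξ * (c (θ : E d) ξ : ℂ) * expI (θ : E d) x

/-- `b^↑`: the large Fourier coefficients, `θ ∉ Θ_r ∪ {0}`. -/
def partUp (r : ℝ) (b : Symb d) : Symb d :=
  cutSymb Γ (dualLattice Γ \ (Theta Γ r ∪ {0})) (fun _ _ => 1) b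

/-- `b^♯`: large energy. -/
def partSharp (ι : ℝ → ℝ) (ρ r : ℝ) (b : Symb d) : Symb d :=
  cutSymb Γ (Theta Γ r) (cutGt ι ρ) b

/-- `b^♭`: the resonant part. -/
def partFlat (ι : ℝ → ℝ) (β ρ r : ℝ) (b : Symb d) : Symb d :=
  cutSymb Γ (Theta Γ r) (fun θ ξ => cutZeta ι (ρ ^ β) θ ξ * cutE ι ρ θ ξ) b

/-- `b^↓`: small energy. -/
def partDown (ι : ℝ → ℝ) (ρ r : ℝ) (b : Symb d) : Symb d :=
  cutSymb Γ (Theta Γ r) (cutLt ι ρ) b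

/-- `b^o`: the zeroth Fourier coefficient; it does not depend on `x`. -/
def partZero (b : Symb d) : Symb d := fun _ ξ =>
  ((1 / √(ZLattice.covolume Γ) : ℝ) : ℂ) * symbCoeff Γ b 0 ξ

end Parts

/-- `σ = α - (2m - 2)β⁻¹ - 1`. -/
def sigma (m α β : ℝ) : ℝ := α - (2 * m - 2) / β - 1

/-- `ε_j = j(σ - 1) + (2m - 2)β⁻¹ + 2`. -/
def eps (m α β : ℝ) (j : ℕ) : ℝ := j * (sigma m α β - 1) + (2 * m - 2) / β + 2

end

end PeriodicPDO

open PeriodicPDO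

/-! # The gauge transform of a periodic pseudo-differential operator

A symbol is the same thing as the family `a θ ξ` of its Fourier coefficients, indexed by the dual
lattice, and `FamBound β γ q a A` collects the seminorms of `𝐒_γ`. The operator with this symbol
shifts the Fourier transform by `θ` after multiplying it with `a θ`, so the product of two operators
is an explicit convolution of families. In the family of a commutator each term contains a
difference of values at two points, and the mean value theorem turns it into a derivative: a
commutator of orders `γ` and `γ'` has order `γ + γ' - 1` (`FamBound.comm`), with constants that do
not depend on the set `Θ_r` of frequencies involved.

The generator `ψ` solves the homological equation `i[H₀, Ψ] = -(nonresonant part)`, that is, `ψ`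
is the nonresonant part divided by `|ξ + θ|^{2m} - |ξ|^{2m}` (`comm_kin_homSol`). On the nonresonant
region this denominator is at least of the size `ρ^{2m-2+β} |θ|` (`exists_kinDiff_lower`), and `ψ` is
supported in `|ξ| ∼ ρ`, so it belongs to all classes, with the gain `ρ^{β(σ-γ)}`
(`HasOrder.of_homSol`). The function `e_θ (1 - ζ_θ)` itself is not a suitable cut-off for all `ρ ≥ 1`,
because its support may reach a zero of `ξ` or `ξ + θ`, where the denominator is not smooth. What is
removed here is cut off by `nonresCut = step (e_θ (1 - ζ_θ))`, supported where `e_θ (1 - ζ_θ) ≥ 1/4`.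
Nothing is lost: what remains of a coefficient `y` is
`(1 - step t) y = (1 - t) · ((1 - step t) / (1 - t) · y)` with `t = e_θ (1 - ζ_θ)`, the quotient is a
smooth function of `t`, and `1 - t` is the sum of the cut-offs in the definition of the parts `♭`,
`↓` and `♯`. With `x = resPart y` these parts therefore add up to the required coefficient
(`sum_parts_resPart`).

Expanding `e^{-iΨ} H e^{iΨ}` in commutators with `ψ = homSol y`, the terms of first order in `H₀`
cancel the nonresonant part of `y`; for a fixed point `y` of `gaugeStep` the result would be `H₀` plus
the operator with the coefficients `y - nonresPart y`, up to Taylor's remainder. Since `σ < 1`, each application of `gaugeStep` to two families improves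
their difference by the factor `ρ^{β(σ-1)}` and by one degree in `b` (`HasOrder.of_gaugeIter_sub`).
After `M` steps from zero the error in the fixed-point equation and the Taylor remainder of the
commutator expansion (`norm_flowInt_sub_le`) are both of degree `M + 1` in `b` and of size
`ρ^{β(M(σ-1) + α)}`, which is the claimed bound (`exists_norm_gaugeRem_le`, `eps_succ`).

The equality of unbounded operators is reduced to bounded ones with `G = (1 + H₀)⁻¹`, which is
`invW (enWeight m)`. Because `αβ < 2m`, the operator `Op(b)` has relative bound zero with respect
to `H₀` (`exists_graph_bound`), so that the domain of each of the closures of `H₀` and `H` is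
exactly the range of `G` (`exists_of_mem_domain_op`). Since `ψ` has finitely many nonzero
coefficients, `Ψ G = G Φ` with a bounded `Φ`, hence `e^{iΨ} G = G e^{iΦ}`: the conjugated operator
has the same domain, and its action there is that of `H`, plus a bounded integral of the flow of the
commutator `i[H, Ψ]` (`exp_mul_mul_exp_eq`). Both sides of the asserted equality then have the range
of `G` as domain and act in the same way on it (`sandwich_eq`).
-/

namespace PeriodicPDO

noncomputable section

/-! ### The weight and summation over the dual lattice -/

section Bracket

variable {d : ℕ}

lemma one_le_bracket (t : E d) : 1 ≤ bracket t := by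
  unfold bracket
  rw [Real.one_le_sqrt]
  nlinarith [sq_nonneg ‖t‖]

lemma bracket_pos (t : E d) : 0 < bracket t := one_pos.trans_le (one_le_bracket t)

lemma norm_le_bracket (t : E d) : ‖t‖ ≤ bracket t := by
  unfold bracket
  exact Real.le_sqrt_of_sq_le (by linarith)

lemma bracket_le_one_add_norm (t : E d) : bracket t ≤ 1 + ‖t‖ := by
  unfold bracket
  rw [Real.sqrt_le_left (by positivity)]
  nlinarith [norm_nonneg t]

lemma bracket_mono {s t : E d} (h : ‖s‖ ≤ ‖t‖) : bracket s ≤ bracket t := by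
  unfold bracket
  gcongr

lemma bracket_neg (t : E d) : bracket (-t) = bracket t := by simp [bracket]

lemma bracket_add_le (s t : E d) : bracket (s + t) ≤ 2 * bracket s * bracket t := by
  have h1 := one_le_bracket s
  have h2 := one_le_bracket t
  have h3 := norm_le_bracket s
  have h4 : bracket (s + t) ≤ bracket s + ‖t‖ := by
    have hs : bracket s ^ 2 = 1 + ‖s‖ ^ 2 := Real.sq_sqrt (by positivity)
    unfold bracket at h3 hs ⊢
    rw [Real.sqrt_le_left (by positivity)]
    have := norm_add_le s t
    nlinarith [norm_nonneg s, norm_nonneg t, norm_nonneg (s + t),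
      mul_le_mul_of_nonneg_right h3 (norm_nonneg t)]
  nlinarith [norm_le_bracket t]

/-- Peetre's inequality, for exponents of either sign. -/
lemma bracket_add_rpow_le (s t : E d) (p : ℝ) (N : ℕ) (hp : |p| ≤ N) :
    bracket (s + t) ^ p ≤ (2 * bracket t) ^ N * bracket s ^ p := by
  have h1 := one_le_bracket t
  have hs := bracket_pos s
  have hst := bracket_pos (s + t)
  have h2 : (1 : ℝ) ≤ 2 * bracket t := by linarith
  rcases le_total 0 p with h | h
  · calc bracket (s + t) ^ p ≤ (2 * bracket t * bracket s) ^ p := by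
          refine Real.rpow_le_rpow hst.le ?_ h
          have := bracket_add_le s t
          linarith
      _ = (2 * bracket t) ^ p * bracket s ^ p := Real.mul_rpow (by linarith) hs.le
      _ ≤ (2 * bracket t) ^ (N : ℝ) * bracket s ^ p := by
          gcongr
          exact (le_abs_self p).trans hp
      _ = _ := by rw [Real.rpow_natCast]
  · have h3 : bracket s ≤ 2 * bracket t * bracket (s + t) := by
      have := bracket_add_le (s + t) (-t)
      rw [bracket_neg, add_neg_cancel_right] at this
      linarith
    have h4 : (2 * bracket t * bracket (s + t)) ^ p ≤ bracket s ^ p :=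
      Real.rpow_le_rpow_of_nonpos hs h3 h
    rw [Real.mul_rpow (by linarith) hst.le] at h4
    calc bracket (s + t) ^ p
        = (2 * bracket t) ^ (-p) * ((2 * bracket t) ^ p * bracket (s + t) ^ p) := by
          rw [← mul_assoc, ← Real.rpow_add (by linarith), neg_add_cancel, Real.rpow_zero, one_mul]
      _ ≤ (2 * bracket t) ^ (N : ℝ) * bracket s ^ p := by
          gcongr
          exact (neg_le_abs p).trans hp
      _ = _ := by rw [Real.rpow_natCast]

lemma weight_pos (β : ℝ) (ξ : E d) : 0 < weight β ξ := Real.rpow_pos_of_pos (bracket_pos ξ) β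

lemma weight_add_rpow_le {β : ℝ} (hβ : 0 < β) (hβ1 : β ≤ 1) (s t : E d) (p : ℝ) (N : ℕ)
    (hp : |p| ≤ N) : weight β (s + t) ^ p ≤ (2 * bracket t) ^ N * weight β s ^ p := by
  unfold weight
  rw [← Real.rpow_mul (bracket_pos _).le, ← Real.rpow_mul (bracket_pos _).le]
  refine bracket_add_rpow_le s t _ N ?_
  rw [abs_mul, abs_of_pos hβ]
  nlinarith [abs_nonneg p]

end Bracket

section Lattice

variable {d : ℕ} (Λ : Submodule ℤ (E d))

/-- An exponent at which negative powers of `⟨θ⟩` are summable over `Λ`. -/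
def sumExp : ℕ := Module.finrank ℤ Λ + 1

/-- The sum of `⟨θ⟩` to the power `-sumExp`. -/
def latSum : ℝ := ∑' θ : Λ, (bracket (θ : E d) ^ sumExp Λ)⁻¹

lemma latSum_nonneg : 0 ≤ latSum Λ :=
  tsum_nonneg fun θ => by have := bracket_pos (θ : E d); positivity

variable [DiscreteTopology Λ]

lemma summable_bracket_inv : Summable fun θ : Λ => (bracket (θ : E d) ^ sumExp Λ)⁻¹ := by
  have h := (ZLattice.summable_norm_pow_inv Λ (sumExp Λ) (Nat.lt_succ_self _))
  have h2 : Summable fun θ : Λ => ‖θ‖⁻¹ ^ sumExp Λ + if θ = 0 then 1 else 0 := by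
    refine h.add ?_
    exact (hasSum_ite_eq (0 : Λ) (1 : ℝ)).summable
  refine Summable.of_nonneg_of_le (fun θ => ?_) (fun θ => ?_) h2
  · have := bracket_pos (θ : E d); positivity
  · by_cases hθ : θ = 0
    · subst hθ
      have h0 : bracket ((0 : Λ) : E d) = 1 := by simp [bracket]
      rw [h0, if_pos rfl]
      simp [sumExp]
    · rw [if_neg hθ, add_zero, ← inv_pow]
      have : 0 < ‖θ‖ := norm_pos_iff.mpr hθ
      exact pow_le_pow_left₀ (inv_nonneg.2 (bracket_pos _).le)
        (inv_anti₀ this (norm_le_bracket (θ : E d))) _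

lemma summable_of_le_bracket {f : Λ → ℝ} {C : ℝ} (h0 : ∀ θ, 0 ≤ f θ)
    (h : ∀ θ : Λ, f θ ≤ C * (bracket (θ : E d) ^ sumExp Λ)⁻¹) : Summable f :=
  Summable.of_nonneg_of_le h0 h ((summable_bracket_inv Λ).mul_left C)

lemma sum_bracket_inv_le (S : Finset Λ) :
    ∑ θ ∈ S, (bracket (θ : E d) ^ sumExp Λ)⁻¹ ≤ latSum Λ :=
  (summable_bracket_inv Λ).sum_le_tsum S fun θ _ => by
    have := bracket_pos (θ : E d); positivity

/-- A discrete lattice has finitely many points in each ball. -/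
lemma finite_lattice_ball (r : ℝ) : {θ : Λ | ‖(θ : E d)‖ ≤ r}.Finite := by
  have h1 : Tendsto (fun θ : Λ => (bracket (θ : E d) ^ sumExp Λ)⁻¹) cofinite (𝓝 0) :=
    (summable_bracket_inv Λ).tendsto_cofinite_zero
  have h2 : 0 < ((1 + |r|) ^ sumExp Λ)⁻¹ / 2 := by positivity
  have h3 := h1.eventually_lt_const h2
  rw [Filter.eventually_cofinite] at h3
  refine h3.subset fun θ hθ => ?_
  simp only [Set.mem_ofPred_eq, not_lt] at hθ ⊢
  have h4 : bracket (θ : E d) ≤ 1 + |r| :=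
    (bracket_le_one_add_norm _).trans (by linarith [le_abs_self r])
  have h5 : ((1 + |r|) ^ sumExp Λ)⁻¹ ≤ (bracket (θ : E d) ^ sumExp Λ)⁻¹ := by
    have := bracket_pos (θ : E d)
    gcongr
  have : 0 < ((1 + |r|) ^ sumExp Λ)⁻¹ := by positivity
  linarith

/-- Nonzero lattice vectors are bounded away from zero. -/
lemma exists_norm_lower_bound : ∃ c₀ : ℝ, 0 < c₀ ∧ ∀ θ : Λ, θ ≠ 0 → c₀ ≤ ‖(θ : E d)‖ := by
  obtain ⟨c, hc, hcb⟩ := Metric.isOpen_iff.1 (isOpen_discrete ({0} : Set Λ)) 0 rfl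
  refine ⟨c, hc, fun θ hθ => ?_⟩
  by_contra hlt
  have : θ ∈ Metric.ball (0 : Λ) c := by
    rw [mem_ball_zero_iff]; exact not_le.1 hlt
  exact hθ (hcb this)

end Lattice

end

end PeriodicPDO

namespace PeriodicPDO

noncomputable section

/-! ### Seminorms of families of Fourier coefficients -/

section Families

variable {d : ℕ} {Λ : Submodule ℤ (E d)}

/-- A family of Fourier coefficients, all of them smooth in `ξ`. -/
def SmoothFam (a : Λ → E d → ℂ) : Prop := ∀ θ, ContDiff ℝ ∞ (a θ)

/-- `C` bounds the seminorm of order `γ` of a family of Fourier coefficients. A single index `q`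
counts both the derivatives in `ξ` and the powers of `⟨θ⟩`. -/
def FamBound (β γ : ℝ) (q : ℕ) (a : Λ → E d → ℂ) (C : ℝ) : Prop :=
  ∀ k ≤ q, ∀ (θ : Λ) (ξ : E d),
    ‖iteratedFDeriv ℝ k (a θ) ξ‖ * bracket (θ : E d) ^ q ≤ C * weight β ξ ^ (γ - (k : ℝ))

/-- Symmetry of a family of Fourier coefficients: the operator is formally self-adjoint. -/
def SymmFam (a : Λ → E d → ℂ) : Prop :=
  ∀ (θ : Λ) (ξ : E d), a θ ξ = conj (a (-θ) (ξ + θ))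

variable {β γ : ℝ} {q : ℕ} {a b : Λ → E d → ℂ} {A B : ℝ}

lemma SmoothFam.add (ha : SmoothFam a) (hb : SmoothFam b) : SmoothFam (a + b) :=
  fun θ => (ha θ).add (hb θ)

lemma SmoothFam.smul (c : ℝ) (ha : SmoothFam a) : SmoothFam (c • a) :=
  fun θ => (ha θ).const_smul c

lemma SmoothFam.zero : SmoothFam (0 : Λ → E d → ℂ) := fun _ => contDiff_const

lemma SymmFam.add (ha : SymmFam a) (hb : SymmFam b) : SymmFam (a + b) := fun θ ξ => by
  simp only [Pi.add_apply, map_add]; rw [ha θ ξ, hb θ ξ]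

lemma SymmFam.sub (ha : SymmFam a) (hb : SymmFam b) : SymmFam (a - b) := fun θ ξ => by
  simp only [Pi.sub_apply, map_sub]; rw [ha θ ξ, hb θ ξ]

lemma SymmFam.smul (c : ℝ) (ha : SymmFam a) : SymmFam (c • a) := fun θ ξ => by
  simp only [Pi.smul_apply, Complex.real_smul, map_mul, Complex.conj_ofReal]; rw [ha θ ξ]

lemma SymmFam.zero : SymmFam (0 : Λ → E d → ℂ) := fun θ ξ => by simp

lemma FamBound.mono (h : FamBound β γ q a A) (hAB : A ≤ B) : FamBound β γ q a B :=
  fun k hk θ ξ => (h k hk θ ξ).trans <| by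
    have := Real.rpow_pos_of_pos (weight_pos β ξ) (γ - (k : ℝ))
    gcongr

lemma FamBound.add (ha : SmoothFam a) (hb : SmoothFam b) (hA : FamBound β γ q a A)
    (hB : FamBound β γ q b B) : FamBound β γ q (a + b) (A + B) := fun k hk θ ξ => by
  have h : iteratedFDeriv ℝ k ((a + b) θ) ξ
      = iteratedFDeriv ℝ k (a θ) ξ + iteratedFDeriv ℝ k (b θ) ξ :=
    iteratedFDeriv_add_apply ((ha θ).contDiffAt.of_le (by exact_mod_cast le_top))
      ((hb θ).contDiffAt.of_le (by exact_mod_cast le_top))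
  rw [h, add_mul A]
  have := bracket_pos (θ : E d)
  calc _ ≤ (‖iteratedFDeriv ℝ k (a θ) ξ‖ + ‖iteratedFDeriv ℝ k (b θ) ξ‖) *
        bracket (θ : E d) ^ q := by gcongr; exact norm_add_le _ _
    _ ≤ _ := by rw [add_mul]; exact add_le_add (hA k hk θ ξ) (hB k hk θ ξ)

lemma FamBound.smul (c : ℝ) (ha : SmoothFam a) (hA : FamBound β γ q a A) :
    FamBound β γ q (c • a) (|c| * A) := fun k hk θ ξ => by
  have h : iteratedFDeriv ℝ k (c • a θ) ξ = c • iteratedFDeriv ℝ k (a θ) ξ :=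
    iteratedFDeriv_const_smul_apply ((ha θ).contDiffAt.of_le (by exact_mod_cast le_top))
  rw [Pi.smul_apply, h, norm_smul, Real.norm_eq_abs, mul_assoc, mul_assoc]
  exact mul_le_mul_of_nonneg_left (hA k hk θ ξ) (abs_nonneg c)

lemma FamBound.zero : FamBound β γ q (0 : Λ → E d → ℂ) 0 := fun k hk θ ξ => by
  have h : iteratedFDeriv ℝ k ((0 : Λ → E d → ℂ) θ) ξ = 0 := by
    have : (0 : Λ → E d → ℂ) θ = fun _ => (0 : ℂ) := rfl
    rw [this, iteratedFDeriv_fun_zero]; rfl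
  rw [h]; simp

lemma FamBound.norm_le (h : FamBound β γ q a A) {k : ℕ} (hk : k ≤ q) (θ : Λ) (ξ : E d) :
    ‖iteratedFDeriv ℝ k (a θ) ξ‖ ≤ A / bracket (θ : E d) ^ q * weight β ξ ^ (γ - (k : ℝ)) := by
  have hb : 0 < bracket (θ : E d) ^ q := pow_pos (bracket_pos _) q
  rw [div_mul_eq_mul_div, le_div_iff₀ hb]
  exact h k hk θ ξ

end Families

section Commutator

variable {d : ℕ}

/-- The increment of `f` over a shift by `η`, multiplied by `g`: the order drops by one. -/
lemma norm_iteratedFDeriv_shift_sub_mul_le {β : ℝ} (hβ : 0 < β) (hβ1 : β ≤ 1)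
    {f g : E d → ℂ} (hf : ContDiff ℝ ∞ f) (hg : ContDiff ℝ ∞ g) {k N : ℕ} {p q A B : ℝ}
    (hA : 0 ≤ A) (hN : |p| + k + 1 ≤ N)
    (hfA : ∀ i ≤ k, ∀ ζ, ‖iteratedFDeriv ℝ (i + 1) f ζ‖ ≤ A * weight β ζ ^ (p - ((i + 1 : ℕ) : ℝ)))
    (ξ η : E d) (hgB : ∀ i ≤ k, ‖iteratedFDeriv ℝ i g ξ‖ ≤ B * weight β ξ ^ (q - (i : ℝ))) :
    ‖iteratedFDeriv ℝ k (fun ζ => (f (ζ + η) - f ζ) * g ζ) ξ‖ ≤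
      2 ^ k * (2 ^ N * bracket η ^ (N + 1)) * A * B * weight β ξ ^ (p + q - 1 - (k : ℝ)) := by
  have hη := bracket_pos η
  have hw := weight_pos β ξ
  have hfs : ContDiff ℝ ∞ fun ζ => f (ζ + η) := hf.comp (contDiff_id.add contDiff_const)
  have hD : ∀ i ≤ k, ‖iteratedFDeriv ℝ i (fun ζ => f (ζ + η) - f ζ) ξ‖ ≤
      A * (2 ^ N * bracket η ^ (N + 1)) * weight β ξ ^ (p - ((i + 1 : ℕ) : ℝ)) := by
    intro i hi
    have e : iteratedFDeriv ℝ i (fun ζ => f (ζ + η) - f ζ) ξ =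
        iteratedFDeriv ℝ i f (ξ + η) - iteratedFDeriv ℝ i f ξ := by
      have := iteratedFDeriv_sub_apply (𝕜 := ℝ) (i := i) (x := ξ) (f := fun ζ => f (ζ + η)) (g := f)
        (hfs.contDiffAt.of_le (by exact_mod_cast le_top))
        (hf.contDiffAt.of_le (by exact_mod_cast le_top))
      rw [← iteratedFDeriv_comp_add_right]
      exact this
    rw [e]
    have hpi : |p - ((i + 1 : ℕ) : ℝ)| ≤ N := by
      refine le_trans (abs_sub _ _) (le_trans ?_ hN)
      rw [Nat.abs_cast]
      push_cast
      have : (i : ℝ) ≤ k := by exact_mod_cast hi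
      linarith
    -- the mean value theorem on the segment; Peetre's inequality compares the weights at its points
    -- with the weight at `ξ`
    have hseg := (convex_segment (𝕜 := ℝ) ξ (ξ + η)).norm_image_sub_le_of_norm_fderiv_le (𝕜 := ℝ)
      (f := iteratedFDeriv ℝ i f)
      (C := A * ((2 * bracket η) ^ N * weight β ξ ^ (p - ((i + 1 : ℕ) : ℝ))))
      (fun z _ => (hf.differentiable_iteratedFDeriv (by exact_mod_cast WithTop.coe_lt_top _)) z)
      (fun z hz => by
        rw [norm_fderiv_iteratedFDeriv]
        refine (hfA i hi z).trans ?_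
        obtain ⟨t, ht, rfl⟩ : ∃ t ∈ Set.Icc (0 : ℝ) 1, ξ + t • η = z := by
          rw [segment_eq_image'] at hz
          simpa using hz
        refine mul_le_mul_of_nonneg_left ?_ hA
        refine (weight_add_rpow_le hβ hβ1 ξ (t • η) _ N hpi).trans ?_
        have h1 : bracket (t • η) ≤ bracket η := bracket_mono (by
          rw [norm_smul, Real.norm_eq_abs, abs_of_nonneg ht.1]
          exact mul_le_of_le_one_left (norm_nonneg _) ht.2)
        have h2 := bracket_pos (t • η)
        gcongr)
      (left_mem_segment ℝ ξ (ξ + η)) (right_mem_segment ℝ ξ (ξ + η))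
    refine hseg.trans ?_
    rw [add_sub_cancel_left, mul_pow]
    calc A * (2 ^ N * bracket η ^ N * weight β ξ ^ (p - ((i + 1 : ℕ) : ℝ))) * ‖η‖
        ≤ A * (2 ^ N * bracket η ^ N * weight β ξ ^ (p - ((i + 1 : ℕ) : ℝ))) * bracket η := by
          gcongr; exact norm_le_bracket η
      _ = _ := by ring
  have hmul := norm_iteratedFDeriv_mul_le (hfs.sub hf) hg ξ (n := k) (by exact_mod_cast le_top)
  refine hmul.trans ?_
  calc _ ≤ ∑ i ∈ Finset.range (k + 1), (k.choose i : ℝ) *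
        ((2 ^ N * bracket η ^ (N + 1)) * A * B * weight β ξ ^ (p + q - 1 - (k : ℝ))) := by
        refine Finset.sum_le_sum fun i hi => ?_
        have hi' : i ≤ k := Nat.lt_succ_iff.1 (Finset.mem_range.1 hi)
        rw [mul_assoc]
        refine mul_le_mul_of_nonneg_left ?_ (Nat.cast_nonneg _)
        refine (mul_le_mul (hD i hi') (hgB (k - i) (Nat.sub_le k i)) (norm_nonneg _)
          (by positivity)).trans (le_of_eq ?_)
        have : weight β ξ ^ (p + q - 1 - (k : ℝ)) = weight β ξ ^ (p - ((i + 1 : ℕ) : ℝ)) *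
            weight β ξ ^ (q - ((k - i : ℕ) : ℝ)) := by
          rw [← Real.rpow_add hw]
          congr 1
          push_cast [Nat.cast_sub hi']
          ring
        rw [this]; ring
    _ = _ := by
        rw [← Finset.sum_mul, ← Nat.cast_sum, Nat.sum_range_choose]
        push_cast; ring

variable {Λ : Submodule ℤ (E d)}

/-- The family of Fourier coefficients of `i[A, Ψ]`, where `ψ` is supported in the finite set `S`
and `c` is the factor relating symbols to their Fourier series. -/
def comm (c : ℝ) (S : Finset Λ) (a ψ : Λ → E d → ℂ) : Λ → E d → ℂ := fun χ ξ =>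
  Complex.I * c * ∑ φ ∈ S, (a (χ - φ) (ξ + φ) * ψ φ ξ - ψ φ (ξ + (χ - φ : Λ)) * a (χ - φ) ξ)

variable (c : ℝ) (S : Finset Λ)

lemma SmoothFam.comm {a ψ : Λ → E d → ℂ} (ha : SmoothFam a) (hψ : SmoothFam ψ) :
    SmoothFam (comm c S a ψ) := fun χ => by
  unfold PeriodicPDO.comm
  refine contDiff_const.mul (ContDiff.sum fun φ _ => ?_)
  exact (((ha _).comp (contDiff_id.add contDiff_const)).mul (hψ φ)).sub
    (((hψ φ).comp (contDiff_id.add contDiff_const)).mul (ha _))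

lemma comm_add_left (a a' ψ : Λ → E d → ℂ) :
    comm c S (a + a') ψ = comm c S a ψ + comm c S a' ψ := by
  funext χ ξ
  simp only [comm, Pi.add_apply, ← mul_add, ← Finset.sum_add_distrib]
  congr 1
  exact Finset.sum_congr rfl fun _ _ => by ring

lemma comm_sub_left (a a' ψ : Λ → E d → ℂ) :
    comm c S (a - a') ψ = comm c S a ψ - comm c S a' ψ := by
  funext χ ξ
  simp only [comm, Pi.sub_apply, ← mul_sub, ← Finset.sum_sub_distrib]
  congr 1
  exact Finset.sum_congr rfl fun _ _ => by ring

lemma comm_sub_right (a ψ ψ' : Λ → E d → ℂ) :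
    comm c S a (ψ - ψ') = comm c S a ψ - comm c S a ψ' := by
  funext χ ξ
  simp only [comm, Pi.sub_apply, ← mul_sub, ← Finset.sum_sub_distrib]
  congr 1
  exact Finset.sum_congr rfl fun _ _ => by ring

/-- The commutator of symmetric families is symmetric. -/
lemma SymmFam.comm {a ψ : Λ → E d → ℂ} (ha : SymmFam a) (hψ : SymmFam ψ)
    (hS : ∀ φ ∈ S, -φ ∈ S) : SymmFam (comm c S a ψ) := fun χ ξ => by
  unfold PeriodicPDO.comm
  rw [map_mul, map_mul, Complex.conj_I, Complex.conj_ofReal, map_sum, neg_mul, neg_mul,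
    ← mul_neg, ← Finset.sum_neg_distrib]
  congr 1
  refine Finset.sum_bij' (fun φ _ => -φ) (fun φ _ => -φ) hS hS (fun _ _ => neg_neg _)
    (fun _ _ => neg_neg _) fun φ hφ => ?_
  rw [map_sub, map_mul, map_mul, neg_sub]
  have h1 : ψ φ ξ = conj (ψ (-φ) (ξ + φ)) := hψ φ ξ
  have h2 : a (χ - φ) (ξ + φ) = conj (a (-χ - -φ) (ξ + χ)) := by
    rw [ha (χ - φ) (ξ + φ)]
    congr 2
    · abel
    · push_cast; abel
  have h3 : ψ φ (ξ + (χ - φ : Λ)) = conj (ψ (-φ) (ξ + χ)) := by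
    rw [hψ φ]; congr 2; push_cast; abel
  have h4 : a (χ - φ) ξ = conj (a (-χ - -φ) (ξ + χ + (-φ : Λ))) := by
    rw [ha (χ - φ) ξ]
    congr 2
    · abel
    · push_cast; abel
  have h5 : ξ + χ + ((-χ - -φ : Λ) : E d) = ξ + φ := by push_cast; abel
  rw [h1, h2, h3, h4, h5]
  ring

variable [DiscreteTopology Λ]

/-- The commutator estimate: the order of `i[A, Ψ]` is one less than the sum of the orders. The
constant does not depend on the support `S` of `ψ`. -/
lemma FamBound.comm {β : ℝ} (hβ : 0 < β) (hβ1 : β ≤ 1) (γ γ' : ℝ) (q : ℕ) :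
    ∃ (C : ℝ) (q' : ℕ), 0 ≤ C ∧ ∀ (S : Finset Λ) (a ψ : Λ → E d → ℂ) (A B : ℝ), 0 ≤ A → 0 ≤ B →
      SmoothFam a → SmoothFam ψ → FamBound β γ q' a A → FamBound β γ' q' ψ B →
      FamBound β (γ + γ' - 1) q (comm c S a ψ) (C * A * B) := by
  -- `N` bounds the powers of brackets lost in Peetre's inequality; `n` is large enough for the sum
  -- of `⟨φ⟩^{-n}` over the lattice to converge
  set N : ℕ := ⌈|γ| + |γ'|⌉₊ + q + 1 with hN
  set n := sumExp Λ with hn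
  set D : ℝ := 2 ^ q * 2 ^ N * 2 ^ q with hD
  have hNle : |γ| + |γ'| + q + 1 ≤ N := by
    rw [hN]; push_cast; linarith [Nat.le_ceil (|γ| + |γ'|)]
  refine ⟨|c| * (2 * D * latSum Λ), q + N + 1 + n, ?_, ?_⟩
  · have := latSum_nonneg Λ
    positivity
  intro S a ψ A B hA hB ha hψ hbA hbB k hk χ ξ
  set W := weight β ξ ^ (γ + γ' - 1 - (k : ℝ)) with hW
  have hW0 : 0 ≤ W := (Real.rpow_pos_of_pos (weight_pos β ξ) _).le
  have hkq : (k : ℝ) ≤ q := by exact_mod_cast hk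
  -- the increments of `a` and of `ψ` are estimated separately
  set F : Λ → E d → ℂ := fun φ ζ => (a (χ - φ) (ζ + φ) - a (χ - φ) ζ) * ψ φ ζ with hF
  set G : Λ → E d → ℂ := fun φ ζ => (ψ φ (ζ + (χ - φ : Λ)) - ψ φ ζ) * a (χ - φ) ζ with hG
  have hFs : ∀ φ, ContDiff ℝ ∞ (F φ) := fun φ =>
    (((ha _).comp (contDiff_id.add contDiff_const)).sub (ha _)).mul (hψ φ)
  have hGs : ∀ φ, ContDiff ℝ ∞ (G φ) := fun φ =>
    (((hψ φ).comp (contDiff_id.add contDiff_const)).sub (hψ φ)).mul (ha _)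
  have hcomm : PeriodicPDO.comm c S a ψ χ =
      fun ζ => (Complex.I * c) • ∑ φ ∈ S, (F φ ζ - G φ ζ) := by
    funext ζ
    simp only [PeriodicPDO.comm, smul_eq_mul, hF, hG]
    congr 1
    exact Finset.sum_congr rfl fun _ _ => by ring
  -- the decay in `X = ⟨φ⟩` and `T = ⟨χ - φ⟩` compensates all losses and leaves a summable factor
  have key : ∀ X T : ℝ, 1 ≤ X → 1 ≤ T →
      X ^ (N + 1) * (X ^ q * T ^ q) / (T ^ (q + N + 1 + n) * X ^ (q + N + 1 + n)) ≤ (X ^ n)⁻¹ ∧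
      T ^ (N + 1) * (X ^ q * T ^ q) / (T ^ (q + N + 1 + n) * X ^ (q + N + 1 + n)) ≤
        (X ^ n)⁻¹ := by
    intro X T hX hT
    have hX0 : 0 < X := by linarith
    have hT0 : 0 < T := by linarith
    constructor
    · rw [div_le_iff₀ (by positivity)]
      have e : (X ^ n)⁻¹ * (T ^ (q + N + 1 + n) * X ^ (q + N + 1 + n)) =
          T ^ (q + (N + 1 + n)) * X ^ (q + N + 1) := by
        rw [pow_add X (q + N + 1) n, show q + (N + 1 + n) = q + N + 1 + n by ring]; field_simp
      rw [e]
      calc X ^ (N + 1) * (X ^ q * T ^ q) = T ^ q * X ^ (q + N + 1) := by ring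
        _ ≤ _ := by
          gcongr
          omega
    · rw [div_le_iff₀ (by positivity)]
      have e : (X ^ n)⁻¹ * (T ^ (q + N + 1 + n) * X ^ (q + N + 1 + n)) =
          T ^ (q + N + 1 + n) * X ^ (q + (N + 1)) := by
        rw [pow_add X (q + N + 1) n, ← add_assoc q N 1]; field_simp
      rw [e]
      calc T ^ (N + 1) * (X ^ q * T ^ q) = T ^ (q + N + 1) * X ^ q := by ring
        _ ≤ _ := mul_le_mul (pow_le_pow_right₀ hT (by omega)) (pow_le_pow_right₀ hX (by omega))
          (by positivity) (by positivity)
  have hterm : ∀ φ : Λ, ‖iteratedFDeriv ℝ k (fun ζ => F φ ζ - G φ ζ) ξ‖ * bracket (χ : E d) ^ q ≤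
      2 * D * A * B * W * (bracket (φ : E d) ^ n)⁻¹ := by
    intro φ
    set X := bracket (φ : E d) with hX
    set T := bracket ((χ - φ : Λ) : E d) with hT
    have hX1 : 1 ≤ X := one_le_bracket _
    have hT1 : 1 ≤ T := one_le_bracket _
    have hχ : bracket (χ : E d) ^ q ≤ 2 ^ q * (X ^ q * T ^ q) := by
      have h := bracket_add_le (φ : E d) ((χ - φ : Λ) : E d)
      have e : (φ : E d) + ((χ - φ : Λ) : E d) = χ := by push_cast; abel
      rw [e] at h
      rw [← mul_pow, ← mul_pow, ← mul_assoc]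
      exact pow_le_pow_left₀ (bracket_pos _).le h q
    have h1 := norm_iteratedFDeriv_shift_sub_mul_le hβ hβ1 (ha (χ - φ)) (hψ φ) (k := k) (N := N)
      (p := γ) (q := γ') (A := A / T ^ (q + N + 1 + n)) (B := B / X ^ (q + N + 1 + n))
      (by positivity) (by linarith [abs_nonneg γ'])
      (fun i hi ζ => hbA.norm_le (by omega) _ ζ) ξ φ (fun i hi => hbB.norm_le (by omega) _ ξ)
    have h2 := norm_iteratedFDeriv_shift_sub_mul_le hβ hβ1 (hψ φ) (ha (χ - φ)) (k := k) (N := N)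
      (p := γ') (q := γ) (A := B / X ^ (q + N + 1 + n)) (B := A / T ^ (q + N + 1 + n))
      (by positivity) (by linarith [abs_nonneg γ])
      (fun i hi ζ => hbB.norm_le (by omega) _ ζ) ξ ((χ - φ : Λ) : E d)
      (fun i hi => hbA.norm_le (by omega) _ ξ)
    rw [add_comm γ' γ] at h2
    have hsub : ‖iteratedFDeriv ℝ k (fun ζ => F φ ζ - G φ ζ) ξ‖ ≤
        ‖iteratedFDeriv ℝ k (F φ) ξ‖ + ‖iteratedFDeriv ℝ k (G φ) ξ‖ := by
      have := iteratedFDeriv_sub_apply (𝕜 := ℝ) (i := k) (x := ξ) (f := F φ) (g := G φ)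
        ((hFs φ).contDiffAt.of_le (by exact_mod_cast le_top))
        ((hGs φ).contDiffAt.of_le (by exact_mod_cast le_top))
      have e : iteratedFDeriv ℝ k (fun ζ => F φ ζ - G φ ζ) ξ = _ := this
      rw [e]
      exact norm_sub_le _ _
    obtain ⟨k1, k2⟩ := key X T hX1 hT1
    have h2k : (2 : ℝ) ^ k ≤ 2 ^ q := by gcongr; norm_num
    have hDk : 2 ^ k * 2 ^ N * 2 ^ q ≤ D := by rw [hD]; gcongr
    calc _ ≤ (‖iteratedFDeriv ℝ k (F φ) ξ‖ + ‖iteratedFDeriv ℝ k (G φ) ξ‖) *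
          (2 ^ q * (X ^ q * T ^ q)) :=
          mul_le_mul hsub hχ (pow_pos (bracket_pos _) q).le (by positivity)
      _ ≤ (2 ^ k * (2 ^ N * X ^ (N + 1)) * (A / T ^ (q + N + 1 + n)) *
            (B / X ^ (q + N + 1 + n)) * W +
          2 ^ k * (2 ^ N * T ^ (N + 1)) * (B / X ^ (q + N + 1 + n)) *
            (A / T ^ (q + N + 1 + n)) * W) * (2 ^ q * (X ^ q * T ^ q)) := by
          gcongr
      _ = (2 ^ k * 2 ^ N * 2 ^ q) * A * B * W *
          (X ^ (N + 1) * (X ^ q * T ^ q) / (T ^ (q + N + 1 + n) * X ^ (q + N + 1 + n)) +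
          T ^ (N + 1) * (X ^ q * T ^ q) / (T ^ (q + N + 1 + n) * X ^ (q + N + 1 + n))) := by
          ring
      _ ≤ D * A * B * W * ((X ^ n)⁻¹ + (X ^ n)⁻¹) := by gcongr
      _ = _ := by ring
  have hsum : iteratedFDeriv ℝ k (PeriodicPDO.comm c S a ψ χ) ξ =
      (Complex.I * c) • ∑ φ ∈ S, iteratedFDeriv ℝ k (fun ζ => F φ ζ - G φ ζ) ξ := by
    rw [hcomm]
    have e1 := iteratedFDeriv_const_smul_apply' (𝕜 := ℝ) (i := k) (x := ξ) (a := Complex.I * c)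
      (f := fun ζ => ∑ φ ∈ S, (F φ ζ - G φ ζ))
      ((ContDiff.sum fun φ _ => (hFs φ).sub (hGs φ)).contDiffAt.of_le
        (by exact_mod_cast le_top))
    rw [e1]
    congr 1
    have e2 := iteratedFDeriv_sum (𝕜 := ℝ) (i := k) (u := S) (f := fun φ ζ => F φ ζ - G φ ζ)
      (fun φ _ => ((hFs φ).sub (hGs φ)).of_le (by exact_mod_cast le_top))
    rw [e2]
    simp
  rw [hsum, norm_smul, norm_mul, Complex.norm_I, one_mul, Complex.norm_real, Real.norm_eq_abs]
  calc _ ≤ |c| * (∑ φ ∈ S, ‖iteratedFDeriv ℝ k (fun ζ => F φ ζ - G φ ζ) ξ‖) *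
        bracket (χ : E d) ^ q := by
        have := bracket_pos (χ : E d)
        gcongr; exact norm_sum_le _ _
    _ = |c| * ∑ φ ∈ S, (‖iteratedFDeriv ℝ k (fun ζ => F φ ζ - G φ ζ) ξ‖ *
        bracket (χ : E d) ^ q) := by rw [mul_assoc, Finset.sum_mul]
    _ ≤ |c| * ∑ φ ∈ S, (2 * D * A * B * W * (bracket (φ : E d) ^ n)⁻¹) := by
        exact mul_le_mul_of_nonneg_left (Finset.sum_le_sum fun φ _ => hterm φ) (abs_nonneg c)
    _ = |c| * (2 * D * A * B * W * ∑ φ ∈ S, (bracket (φ : E d) ^ n)⁻¹) := by rw [← Finset.mul_sum]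
    _ ≤ |c| * (2 * D * A * B * W * latSum Λ) := by gcongr; exact sum_bracket_inv_le Λ S
    _ = _ := by ring

end Commutator

end

end PeriodicPDO

namespace PeriodicPDO

noncomputable section

/-! ### Bounds for iterated derivatives at a point -/

section DerivativeTools

variable {V W F : Type*} [NormedAddCommGroup V] [NormedSpace ℝ V] [NormedAddCommGroup W]
  [NormedSpace ℝ W] [NormedAddCommGroup F] [NormedSpace ℝ F]

lemma exists_uniform_bound {α : Type*} (s : ℕ) (P : ℕ → α → ℝ) (Q : α → Prop)
    (h : ∀ i ≤ s, ∃ C : ℝ, ∀ x, Q x → P i x ≤ C) :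
    ∃ C : ℝ, 1 ≤ C ∧ ∀ i ≤ s, ∀ x, Q x → P i x ≤ C := by
  choose C hC using h
  refine ⟨1 + ∑ i : Fin (s + 1), |C i (Nat.lt_succ_iff.1 i.2)|, ?_, fun i hi x hx => ?_⟩
  · have : 0 ≤ ∑ i : Fin (s + 1), |C i (Nat.lt_succ_iff.1 i.2)| :=
      Finset.sum_nonneg fun _ _ => abs_nonneg _
    linarith
  · have h1 := Finset.single_le_sum (f := fun i : Fin (s + 1) => |C i (Nat.lt_succ_iff.1 i.2)|)
      (fun _ _ => abs_nonneg _) (Finset.mem_univ ⟨i, Nat.lt_succ_iff.2 hi⟩)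
    have h2 := le_abs_self (C i hi)
    have h3 := hC i hi x hx
    simp only at h1
    linarith

lemma exists_contDiffOn_open {f : V → W} {x : V} (hf : ContDiffAt ℝ ∞ f x) (n : ℕ) :
    ∃ u, IsOpen u ∧ x ∈ u ∧ ContDiffOn ℝ n f u := by
  obtain ⟨u, hu, hxu, h⟩ := (hf.of_le (m := (n : ℕ∞ω)) (by exact_mod_cast le_top)).eventually
    (by simp) |>.exists_mem |> fun ⟨v, hv, h⟩ =>
      (⟨interior v, isOpen_interior, mem_interior_iff_mem_nhds.2 hv, fun y hy =>
        (h y (interior_subset hy)).contDiffWithinAt⟩ :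
        ∃ u, IsOpen u ∧ x ∈ u ∧ ContDiffOn ℝ n f u)
  exact ⟨u, hu, hxu, h⟩

/-- A Leibniz bound at a point where the derivatives of order `i` grow like `t ^ i`. -/
lemma norm_iteratedFDeriv_mul_at_le {A : Type*} [NormedRing A] [NormedAlgebra ℝ A]
    {f g : V → A} {x : V} (hf : ContDiffAt ℝ ∞ f x) (hg : ContDiffAt ℝ ∞ g x) {s : ℕ}
    {C C' t : ℝ} (hC : 0 ≤ C) (ht : 0 ≤ t)
    (hfC : ∀ i ≤ s, ‖iteratedFDeriv ℝ i f x‖ ≤ C * t ^ i)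
    (hgC : ∀ i ≤ s, ‖iteratedFDeriv ℝ i g x‖ ≤ C' * t ^ i) :
    ∀ i ≤ s, ‖iteratedFDeriv ℝ i (fun y => f y * g y) x‖ ≤ 2 ^ s * C * C' * t ^ i := by
  intro k hk
  obtain ⟨u, hu, hxu, hfu⟩ := exists_contDiffOn_open hf k
  obtain ⟨v, hv, hxv, hgv⟩ := exists_contDiffOn_open hg k
  have hC' : 0 ≤ C' := by
    have := (norm_nonneg _).trans (hgC 0 (Nat.zero_le s))
    simpa using this
  have hx : x ∈ u ∩ v := ⟨hxu, hxv⟩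
  have ho : IsOpen (u ∩ v) := hu.inter hv
  have h := norm_iteratedFDerivWithin_mul_le (hfu.mono Set.inter_subset_left)
    (hgv.mono Set.inter_subset_right) ho.uniqueDiffOn hx (n := k) le_rfl
  simp only [iteratedFDerivWithin_of_isOpen _ ho hx] at h
  refine h.trans ?_
  calc _ ≤ ∑ i ∈ Finset.range (k + 1), (k.choose i : ℝ) * (C * C' * t ^ k) := by
        refine Finset.sum_le_sum fun i hi => ?_
        have hi' : i ≤ k := Nat.lt_succ_iff.1 (Finset.mem_range.1 hi)
        rw [mul_assoc]
        refine mul_le_mul_of_nonneg_left ?_ (Nat.cast_nonneg _)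
        refine (mul_le_mul (hfC i (hi'.trans hk)) (hgC (k - i) ((Nat.sub_le k i).trans hk))
          (norm_nonneg _) (by positivity)).trans (le_of_eq ?_)
        rw [← Nat.sub_add_cancel hi', pow_add]
        simp only [Nat.add_sub_cancel]
        ring
    _ = 2 ^ k * (C * C' * t ^ k) := by
        rw [← Finset.sum_mul, ← Nat.cast_sum, Nat.sum_range_choose]; push_cast; ring
    _ ≤ 2 ^ s * (C * C' * t ^ k) := by gcongr; norm_num
    _ = _ := by ring

/-- A composition bound at a point: only the derivatives of `f` of positive order matter. -/
lemma norm_iteratedFDeriv_comp_at_le {g : W → F} {f : V → W} {x : V}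
    (hg : ContDiffAt ℝ ∞ g (f x)) (hf : ContDiffAt ℝ ∞ f x) {s : ℕ} {A C t : ℝ} (hC : 1 ≤ C)
    (ht : 0 ≤ t) (hgA : ∀ i ≤ s, ‖iteratedFDeriv ℝ i g (f x)‖ ≤ A)
    (hfC : ∀ i, 1 ≤ i → i ≤ s → ‖iteratedFDeriv ℝ i f x‖ ≤ C * t ^ i) :
    ∀ i ≤ s, ‖iteratedFDeriv ℝ i (g ∘ f) x‖ ≤ (s.factorial * A * C ^ s) * t ^ i := by
  intro k hk
  have hA : 0 ≤ A := (norm_nonneg _).trans (hgA 0 (Nat.zero_le s))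
  obtain ⟨u, hu, hxu, hfu⟩ := exists_contDiffOn_open hf k
  obtain ⟨v, hv, hxv, hgv⟩ := exists_contDiffOn_open hg k
  obtain ⟨u', hu'u, hu', hxu'⟩ := mem_nhds_iff.1 (Filter.inter_mem (hu.mem_nhds hxu)
    (hf.continuousAt.preimage_mem_nhds (hv.mem_nhds hxv)))
  have h := norm_iteratedFDerivWithin_comp_le (𝕜 := ℝ) hgv
    (hfu.mono fun y hy => (hu'u hy).1) (n := k) le_rfl hv.uniqueDiffOn hu'.uniqueDiffOn
    (fun y hy => (hu'u hy).2) hxu' (C := A) (D := C * t)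
    (fun i hi => by rw [iteratedFDerivWithin_of_isOpen _ hv hxv]; exact hgA i (hi.trans hk))
    (fun i h1 hi => by
      rw [iteratedFDerivWithin_of_isOpen _ hu' hxu']
      refine (hfC i h1 (hi.trans hk)).trans ?_
      rw [mul_pow]
      gcongr
      exact le_self_pow₀ hC (by omega))
  rw [iteratedFDerivWithin_of_isOpen _ hu' hxu'] at h
  refine h.trans ?_
  rw [mul_pow, ← mul_assoc]
  have h1 : (k.factorial : ℝ) ≤ s.factorial := by exact_mod_cast Nat.factorial_le hk
  gcongr

/-- Derivatives of the composition with an affine map. -/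
lemma norm_iteratedFDeriv_comp_affine_le {f : W → F} (hf : ContDiff ℝ ∞ f) (L : V →L[ℝ] W)
    (v : W) (k : ℕ) (x : V) :
    ‖iteratedFDeriv ℝ k (fun y => f (L y + v)) x‖ ≤ ‖iteratedFDeriv ℝ k f (L x + v)‖ * ‖L‖ ^ k := by
  have h1 : ContDiff ℝ ∞ fun y => f (y + v) := hf.comp (contDiff_id.add contDiff_const)
  have h2 := L.iteratedFDeriv_comp_right h1 x (i := k) (by exact_mod_cast le_top)
  have e : (fun y => f (L y + v)) = (fun y => f (y + v)) ∘ L := rfl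
  rw [e, h2]
  refine (ContinuousMultilinearMap.norm_compContinuousLinearMap_le _ _).trans ?_
  rw [iteratedFDeriv_comp_add_right]
  simp

lemma exists_iteratedFDeriv_bound_of_hasCompactSupport {f : V → F} (hf : ContDiff ℝ ∞ f)
    (hc : HasCompactSupport f) (s : ℕ) :
    ∃ C : ℝ, 1 ≤ C ∧ ∀ i ≤ s, ∀ x, ‖iteratedFDeriv ℝ i f x‖ ≤ C := by
  obtain ⟨C, hC1, hC⟩ := exists_uniform_bound s (fun i x => ‖iteratedFDeriv ℝ i f x‖)
    (fun _ => True) (fun i hi => by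
      obtain ⟨C, hC⟩ := (hf.continuous_iteratedFDeriv (m := i)
        (by exact_mod_cast le_top)).bounded_above_of_compact_support (hc.iteratedFDeriv i)
      exact ⟨C, fun x _ => hC x⟩)
  exact ⟨C, hC1, fun i hi x => hC i hi x trivial⟩

lemma exists_iteratedFDeriv_bound_on {f : V → F} {K : Set V} (hK : IsCompact K)
    (hf : ∀ x ∈ K, ContDiffAt ℝ ∞ f x) (s : ℕ) :
    ∃ C : ℝ, 1 ≤ C ∧ ∀ i ≤ s, ∀ x ∈ K, ‖iteratedFDeriv ℝ i f x‖ ≤ C := by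
  refine exists_uniform_bound s (fun i x => ‖iteratedFDeriv ℝ i f x‖) (· ∈ K) fun i hi => ?_
  refine hK.exists_bound_of_continuousOn fun x hx => ?_
  obtain ⟨u, hu, hxu, hfu⟩ := exists_contDiffOn_open (hf x hx) i
  have h1 := hfu.continuousOn_iteratedFDerivWithin le_rfl hu.uniqueDiffOn
  have h2 : ContinuousOn (iteratedFDeriv ℝ i f) u := h1.congr fun y hy =>
    (iteratedFDerivWithin_of_isOpen i hu hy).symm
  exact (h2.continuousAt (hu.mem_nhds hxu)).continuousWithinAt

lemma iteratedFDeriv_eq_zero_of_eventuallyEq_const {f : V → F} {x : V} {c : F}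
    (h : f =ᶠ[𝓝 x] fun _ => c) {k : ℕ} (hk : k ≠ 0) : iteratedFDeriv ℝ k f x = 0 := by
  rw [(Filter.EventuallyEq.iteratedFDeriv ℝ h k).eq_of_nhds, iteratedFDeriv_const_of_ne hk]
  rfl

lemma norm_iteratedFDeriv_inv_le {x c : ℝ} (hc : 0 < c) (hx : c ≤ |x|) {s i : ℕ} (hi : i ≤ s) :
    ‖iteratedFDeriv ℝ i (fun y : ℝ => y⁻¹) x‖ ≤ s.factorial * (1 + c⁻¹) ^ (s + 1) := by
  rw [norm_iteratedFDeriv_eq_norm_iteratedDeriv, iteratedDeriv_eq_iterate]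
  have e : deriv^[i] (fun y : ℝ => y⁻¹) x = (-1) ^ i * i.factorial * x ^ (-1 - i : ℤ) :=
    iter_deriv_inv i x
  rw [e]
  have hx0 : 0 < |x| := hc.trans_le hx
  have e2 : ‖(-1 : ℝ) ^ i * i.factorial * x ^ (-1 - i : ℤ)‖ = i.factorial * (|x|⁻¹) ^ (i + 1) := by
    rw [norm_mul, norm_mul, norm_pow, norm_neg, norm_one, one_pow, one_mul, norm_zpow,
      Real.norm_eq_abs, Real.norm_eq_abs, Nat.abs_cast]
    congr 1
    rw [show (-1 - i : ℤ) = -((i + 1 : ℕ) : ℤ) by push_cast; ring, zpow_neg, zpow_natCast, inv_pow]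
  rw [e2]
  have h1 : (i.factorial : ℝ) ≤ s.factorial := by exact_mod_cast Nat.factorial_le hi
  have h2 : |x|⁻¹ ≤ 1 + c⁻¹ := (inv_anti₀ hc hx).trans (by linarith)
  have h3 : 1 ≤ 1 + c⁻¹ := by have := inv_pos.2 hc; linarith
  calc _ ≤ (s.factorial : ℝ) * (1 + c⁻¹) ^ (i + 1) := by gcongr
    _ ≤ _ := by gcongr

end DerivativeTools

end

end PeriodicPDO

namespace PeriodicPDO

noncomputable section

/-! ### The nonresonant cut-off -/

section Profiles

variable {d : ℕ} {ι : ℝ → ℝ}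

lemma IsCutoff.contDiff_abs (hι : IsCutoff ι) : ContDiff ℝ ∞ fun z => ι |z| := by
  rw [contDiff_iff_contDiffAt]
  intro z
  rcases lt_trichotomy z 0 with hz | hz | hz
  · have h : (fun z => ι |z|) =ᶠ[𝓝 z] fun z => ι (-z) := by
      filter_upwards [Iio_mem_nhds hz] with y hy
      rw [abs_of_neg hy]
    exact (hι.smooth.comp contDiff_neg).contDiffAt.congr_of_eventuallyEq h
  · subst hz
    have h : (fun z => ι |z|) =ᶠ[𝓝 (0 : ℝ)] fun _ => 1 := by
      filter_upwards [Metric.ball_mem_nhds (0 : ℝ) (by norm_num : (0 : ℝ) < 1 / 4)] with y hy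
      rw [mem_ball_zero_iff, Real.norm_eq_abs] at hy
      exact hι.eq_one _ hy.le
    exact contDiffAt_const.congr_of_eventuallyEq h
  · have h : (fun z => ι |z|) =ᶠ[𝓝 z] ι := by
      filter_upwards [Ioi_mem_nhds hz] with y hy
      rw [abs_of_pos hy]
    exact hι.smooth.contDiffAt.congr_of_eventuallyEq h

lemma IsCutoff.hasCompactSupport_abs (hι : IsCutoff ι) : HasCompactSupport fun z => ι |z| :=
  HasCompactSupport.intro (isCompact_closedBall (0 : ℝ) (1 / 2)) fun z hz => by
    rw [mem_closedBall_zero_iff, Real.norm_eq_abs, not_le] at hz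
    exact hι.eq_zero _ hz.le

lemma IsCutoff.contDiff_shell (hι : IsCutoff ι) :
    ContDiff ℝ ∞ fun x : E d => ι |‖x‖ - 1| := by
  rw [contDiff_iff_contDiffAt]
  intro x
  by_cases hx : x = 0
  · subst hx
    have h : (fun x : E d => ι |‖x‖ - 1|) =ᶠ[𝓝 0] fun _ => 0 := by
      filter_upwards [Metric.ball_mem_nhds (0 : E d) (by norm_num : (0 : ℝ) < 1 / 2)] with y hy
      rw [mem_ball_zero_iff] at hy
      refine hι.eq_zero _ ?_
      rw [le_abs]
      right; linarith
    exact contDiffAt_const.congr_of_eventuallyEq h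
  · exact hι.contDiff_abs.contDiffAt.comp x ((contDiffAt_norm ℝ hx).sub contDiffAt_const)

lemma IsCutoff.hasCompactSupport_shell (hι : IsCutoff ι) :
    HasCompactSupport fun x : E d => ι |‖x‖ - 1| :=
  HasCompactSupport.intro (isCompact_closedBall (0 : E d) (3 / 2)) fun x hx => by
    rw [mem_closedBall_zero_iff, not_le] at hx
    refine hι.eq_zero _ ?_
    rw [le_abs]
    left; linarith

/-- The cut-off profile stays below `1/4` slightly to the left of `1/2`. -/
lemma IsCutoff.exists_gap (hι : IsCutoff ι) :
    ∃ δ : ℝ, 0 < δ ∧ ∀ z, 1 / 4 ≤ ι z → z ≤ 1 / 2 - δ := by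
  have h0 : ι (1 / 2) < 1 / 4 := by rw [hι.eq_zero _ le_rfl]; norm_num
  obtain ⟨ε, hε, h⟩ := Metric.eventually_nhds_iff.1
    ((hι.smooth.continuous.continuousAt (x := 1 / 2)).eventually_lt_const h0)
  refine ⟨ε / 2, by positivity, fun z hz => ?_⟩
  by_contra hlt
  rw [not_le] at hlt
  rcases le_or_gt (1 / 2) z with h1 | h1
  · rw [hι.eq_zero z h1] at hz; norm_num at hz
  · have := h (y := z) (by rw [Real.dist_eq, abs_lt]; constructor <;> linarith)
    linarith

/-- A smooth step: `0` up to `1/4` and `1` from `1/2` on. -/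
def step (t : ℝ) : ℝ := Real.smoothTransition (4 * t - 1)

/-- The smooth function `(1 - step t) / (1 - t)`. -/
def coStep (t : ℝ) : ℝ := (1 - step t) / (1 - t)

lemma contDiff_step : ContDiff ℝ ∞ step :=
  Real.smoothTransition.contDiff.comp ((contDiff_const.mul contDiff_id).sub contDiff_const)

lemma step_eq_zero {t : ℝ} (ht : t ≤ 1 / 4) : step t = 0 :=
  Real.smoothTransition.zero_of_nonpos (by linarith)

lemma step_eq_one {t : ℝ} (ht : 1 / 2 ≤ t) : step t = 1 :=
  Real.smoothTransition.one_of_one_le (by linarith)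

lemma contDiff_coStep : ContDiff ℝ ∞ coStep := by
  rw [contDiff_iff_contDiffAt]
  intro t
  rcases lt_or_ge t 1 with ht | ht
  · exact (contDiffAt_const.sub contDiff_step.contDiffAt).div
      (contDiffAt_const.sub contDiffAt_id) (sub_ne_zero.2 ht.ne')
  · have h : coStep =ᶠ[𝓝 t] fun _ => 0 := by
      filter_upwards [Ioi_mem_nhds (show (1 / 2 : ℝ) < t by linarith)] with y hy
      rw [coStep, step_eq_one (le_of_lt hy)]; simp
    exact contDiffAt_const.congr_of_eventuallyEq h

lemma coStep_zero : coStep 0 = 1 := by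
  rw [coStep, step_eq_zero (by norm_num)]; simp

lemma one_sub_mul_coStep (t : ℝ) : (1 - t) * coStep t = 1 - step t := by
  rcases eq_or_ne t 1 with rfl | h
  · rw [step_eq_one (by norm_num)]; simp
  · rw [coStep, mul_div_cancel₀]
    exact sub_ne_zero.2 h.symm

end Profiles

section NonResonant

variable {d : ℕ} (ι : ℝ → ℝ) (β ρ : ℝ)

/-- The product `e_θ (1 - ζ_θ)`; the symbols cut off by it are missing from the sum of the parts
`♭`, `↓`, `♯`. -/
def shellCut (θ ξ : E d) : ℝ := cutE ι ρ θ ξ * (1 - cutZeta ι (ρ ^ β) θ ξ)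

/-- The cut-off to the part of the symbol which the gauge transform removes. It vanishes where
`e_θ (1 - ζ_θ)` is small, which keeps it away from the singularities of `|ξ|^{2m}`
and `|ξ + θ|^{2m}` even for `ρ` close to `1`. -/
def nonresCut (θ ξ : E d) : ℝ := step (shellCut ι β ρ θ ξ)

/-- The complementary cut-off: the parts `♭`, `↓`, `♯` of a symbol multiplied by `resCut` add up to
the symbol multiplied by `1 - nonresCut`. -/
def resCut (θ ξ : E d) : ℝ := coStep (shellCut ι β ρ θ ξ)

variable {ι β ρ}

lemma cutE_eq_shell (hρ : 0 < ρ) (θ : E d) : cutE ι ρ θ =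
    fun ξ => (fun x : E d => ι |‖x‖ - 1|)
      ((ρ⁻¹ • ContinuousLinearMap.id ℝ (E d)) ξ + ρ⁻¹ • ((1 / 2 : ℝ) • θ)) := by
  funext ξ
  simp only [cutE, _root_.smul_apply, ContinuousLinearMap.id_apply]
  rw [← smul_add, norm_smul, norm_inv, Real.norm_eq_abs, abs_of_pos hρ, div_eq_inv_mul]

lemma cutZeta_eq (hρ : 0 < ρ) (θ : E d) : cutZeta ι (ρ ^ β) θ =
    fun ξ => (fun z : ℝ => ι |z|) (((ρ ^ β * ‖θ‖)⁻¹ • innerSL ℝ θ) ξ +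
      (ρ ^ β * ‖θ‖)⁻¹ * inner ℝ θ ((1 / 2 : ℝ) • θ)) := by
  funext ξ
  have h : 0 ≤ ρ ^ β * ‖θ‖ := mul_nonneg (Real.rpow_nonneg hρ.le β) (norm_nonneg θ)
  simp only [cutZeta, _root_.smul_apply, smul_eq_mul, innerSL_apply_apply]
  rw [← mul_add, ← inner_add_right, abs_mul, abs_inv, abs_of_nonneg h, div_eq_inv_mul]

lemma contDiff_cutE (hι : IsCutoff ι) (hρ : 0 < ρ) (θ : E d) : ContDiff ℝ ∞ (cutE ι ρ θ) := by
  rw [cutE_eq_shell hρ]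
  exact hι.contDiff_shell.comp ((ContinuousLinearMap.contDiff _).add contDiff_const)

lemma contDiff_cutZeta (hι : IsCutoff ι) (hρ : 0 < ρ) (θ : E d) :
    ContDiff ℝ ∞ (cutZeta ι (ρ ^ β) θ) := by
  rw [cutZeta_eq hρ]
  exact hι.contDiff_abs.comp ((ContinuousLinearMap.contDiff _).add contDiff_const)

lemma contDiff_shellCut (hι : IsCutoff ι) (hρ : 0 < ρ) (θ : E d) :
    ContDiff ℝ ∞ (shellCut ι β ρ θ) :=
  (contDiff_cutE hι hρ θ).mul (contDiff_const.sub (contDiff_cutZeta hι hρ θ))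

lemma contDiff_nonresCut (hι : IsCutoff ι) (hρ : 0 < ρ) (θ : E d) :
    ContDiff ℝ ∞ (nonresCut ι β ρ θ) := contDiff_step.comp (contDiff_shellCut hι hρ θ)

lemma contDiff_resCut (hι : IsCutoff ι) (hρ : 0 < ρ) (θ : E d) :
    ContDiff ℝ ∞ (resCut ι β ρ θ) := contDiff_coStep.comp (contDiff_shellCut hι hρ θ)

lemma shellCut_mem_Icc (hι : IsCutoff ι) (θ ξ : E d) :
    shellCut ι β ρ θ ξ ∈ Set.Icc (0 : ℝ) 1 := by
  have h1 := hι.nonneg |‖ξ + (1 / 2 : ℝ) • θ‖ / ρ - 1|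
  have h2 := hι.le_one |‖ξ + (1 / 2 : ℝ) • θ‖ / ρ - 1|
  have h3 := hι.nonneg (|inner ℝ θ (ξ + (1 / 2 : ℝ) • θ)| / (ρ ^ β * ‖θ‖))
  have h4 := hι.le_one (|inner ℝ θ (ξ + (1 / 2 : ℝ) • θ)| / (ρ ^ β * ‖θ‖))
  unfold shellCut cutE cutZeta
  constructor
  · exact mul_nonneg h1 (by linarith)
  · exact mul_le_one₀ h2 (by linarith) (by linarith)

lemma shellCut_symm (θ ξ : E d) : shellCut ι β ρ (-θ) (ξ + θ) = shellCut ι β ρ θ ξ := by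
  have e : ξ + θ + (1 / 2 : ℝ) • -θ = ξ + (1 / 2 : ℝ) • θ := by module
  simp only [shellCut, cutE, cutZeta, e, inner_neg_left, abs_neg, norm_neg]

/-- The parts `♭`, `↓`, `♯` of a symbol multiply it by `1 - e_θ (1 - ζ_θ)`. -/
lemma cut_sum_eq (hι : IsCutoff ι) (θ ξ : E d) :
    cutZeta ι (ρ ^ β) θ ξ * cutE ι ρ θ ξ + cutLt ι ρ θ ξ + cutGt ι ρ θ ξ =
      1 - shellCut ι β ρ θ ξ := by
  unfold shellCut
  have h : cutLt ι ρ θ ξ + cutGt ι ρ θ ξ = 1 - cutE ι ρ θ ξ := by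
    unfold cutLt cutGt cutE
    rcases le_total 0 (‖ξ + (1 / 2 : ℝ) • θ‖ / ρ - 1) with h | h
    · rw [abs_of_nonneg h, hι.eq_one (1 - ‖ξ + (1 / 2 : ℝ) • θ‖ / ρ) (by linarith)]; ring
    · rw [abs_of_nonpos h, hι.eq_one (‖ξ + (1 / 2 : ℝ) • θ‖ / ρ - 1) (by linarith), neg_sub]; ring
  linear_combination h

/-- Every derivative of the cut-off costs a factor `ρ^{-β}`, the width of the resonance zones being `ρ^β`
and that of the shell `ρ ≥ ρ^β`. -/
lemma exists_shellCut_bound (hι : IsCutoff ι) (hβ1 : β ≤ 1) (s : ℕ) :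
    ∃ C : ℝ, 1 ≤ C ∧ ∀ ρ : ℝ, 1 ≤ ρ → ∀ θ ξ : E d, ∀ i ≤ s,
      ‖iteratedFDeriv ℝ i (shellCut ι β ρ θ) ξ‖ ≤ C * ((ρ ^ β)⁻¹) ^ i := by
  obtain ⟨C₁, h1, hC₁⟩ := exists_iteratedFDeriv_bound_of_hasCompactSupport
    (hι.contDiff_shell (d := d)) hι.hasCompactSupport_shell s
  obtain ⟨C₂, h2, hC₂⟩ := exists_iteratedFDeriv_bound_of_hasCompactSupport hι.contDiff_abs
    hι.hasCompactSupport_abs s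
  refine ⟨2 ^ s * C₁ * (1 + C₂), ?_, fun ρ hρ θ ξ => ?_⟩
  · have : (1 : ℝ) ≤ 2 ^ s := one_le_pow₀ (by norm_num)
    nlinarith [one_le_mul_of_one_le_of_one_le this h1]
  have hρ0 : 0 < ρ := by linarith
  have ht : 0 < (ρ ^ β)⁻¹ := inv_pos.2 (Real.rpow_pos_of_pos hρ0 β)
  have hE : ∀ i ≤ s, ‖iteratedFDeriv ℝ i (cutE ι ρ θ) ξ‖ ≤ C₁ * ((ρ ^ β)⁻¹) ^ i := by
    intro i hi
    rw [cutE_eq_shell hρ0]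
    refine (norm_iteratedFDeriv_comp_affine_le (hι.contDiff_shell (d := d)) _ _ i ξ).trans ?_
    refine mul_le_mul (hC₁ i hi _) ?_ (by positivity) (by linarith)
    refine pow_le_pow_left₀ (norm_nonneg _) ?_ i
    refine (ContinuousLinearMap.opNorm_le_bound _ (by positivity) (M := ρ⁻¹) fun x => ?_).trans
      (inv_anti₀ (Real.rpow_pos_of_pos hρ0 β) ?_)
    · simp [norm_smul, abs_of_pos hρ0]
    · calc ρ ^ β ≤ ρ ^ (1 : ℝ) := Real.rpow_le_rpow_of_exponent_le hρ hβ1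
        _ = ρ := Real.rpow_one ρ
  have hZ : ∀ i ≤ s, ‖iteratedFDeriv ℝ i (fun ξ => 1 - cutZeta ι (ρ ^ β) θ ξ) ξ‖ ≤
      (1 + C₂) * ((ρ ^ β)⁻¹) ^ i := by
    intro i hi
    have hz : ‖iteratedFDeriv ℝ i (cutZeta ι (ρ ^ β) θ) ξ‖ ≤ C₂ * ((ρ ^ β)⁻¹) ^ i := by
      rw [cutZeta_eq hρ0]
      refine (norm_iteratedFDeriv_comp_affine_le hι.contDiff_abs _ _ i ξ).trans ?_
      refine mul_le_mul (hC₂ i hi _) ?_ (by positivity) (by linarith)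
      refine pow_le_pow_left₀ (norm_nonneg _) ?_ i
      have hp : 0 < ρ ^ β := Real.rpow_pos_of_pos hρ0 β
      rw [norm_smul, innerSL_apply_norm, norm_inv, norm_mul, norm_norm, Real.norm_eq_abs,
        abs_of_pos hp, mul_inv, mul_assoc]
      refine mul_le_of_le_one_right ht.le ?_
      rw [inv_mul_eq_div]
      exact div_self_le_one _
    have e : iteratedFDeriv ℝ i (fun ξ => 1 - cutZeta ι (ρ ^ β) θ ξ) ξ =
        iteratedFDeriv ℝ i (fun _ => (1 : ℝ)) ξ - iteratedFDeriv ℝ i (cutZeta ι (ρ ^ β) θ) ξ :=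
      iteratedFDeriv_sub_apply contDiffAt_const
        ((contDiff_cutZeta hι hρ0 θ).contDiffAt.of_le (by exact_mod_cast le_top))
    rw [e, add_mul]
    refine (norm_sub_le _ _).trans (add_le_add ?_ hz)
    rcases Nat.eq_zero_or_pos i with rfl | hi0
    · simp
    · rw [iteratedFDeriv_const_of_ne hi0.ne']
      simp only [Pi.zero_apply, norm_zero]
      positivity
  exact norm_iteratedFDeriv_mul_at_le (contDiff_cutE hι hρ0 θ).contDiffAt
    (contDiff_const.sub (contDiff_cutZeta hι hρ0 θ)).contDiffAt (by linarith) ht.le hE hZ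

lemma exists_comp_shellCut_bound {g : ℝ → ℝ} (hg : ContDiff ℝ ∞ g) (hι : IsCutoff ι)
    (hβ1 : β ≤ 1) (s : ℕ) :
    ∃ C : ℝ, 1 ≤ C ∧ ∀ ρ : ℝ, 1 ≤ ρ → ∀ θ ξ : E d, ∀ i ≤ s,
      ‖iteratedFDeriv ℝ i (fun ξ => g (shellCut ι β ρ θ ξ)) ξ‖ ≤ C * ((ρ ^ β)⁻¹) ^ i := by
  obtain ⟨C, hC1, hC⟩ := exists_shellCut_bound (d := d) hι hβ1 s
  obtain ⟨A, hA1, hA⟩ := exists_iteratedFDeriv_bound_on (isCompact_Icc (a := (0 : ℝ)) (b := 1))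
    (fun x _ => hg.contDiffAt) s
  refine ⟨s.factorial * A * C ^ s, ?_, fun ρ hρ θ ξ => ?_⟩
  · have h1 : (1 : ℝ) ≤ s.factorial := by exact_mod_cast Nat.one_le_iff_ne_zero.2 s.factorial_ne_zero
    exact one_le_mul_of_one_le_of_one_le (one_le_mul_of_one_le_of_one_le h1 hA1) (one_le_pow₀ hC1)
  · have hρ0 : 0 < ρ := by linarith
    exact norm_iteratedFDeriv_comp_at_le hg.contDiffAt (contDiff_shellCut hι hρ0 θ).contDiffAt hC1
      (inv_pos.2 (Real.rpow_pos_of_pos hρ0 β)).le (fun i hi => hA i hi _ (shellCut_mem_Icc hι θ ξ))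
      (fun i _ hi => hC ρ hρ θ ξ i hi)

/-- The region carrying the nonresonant cut-off. -/
def NonresRegion (β ρ δ : ℝ) (θ ξ : E d) : Prop :=
  |‖ξ + (1 / 2 : ℝ) • θ‖ / ρ - 1| ≤ 1 / 2 - δ ∧
    ρ ^ β * ‖θ‖ / 4 ≤ |inner ℝ θ (ξ + (1 / 2 : ℝ) • θ)|

/-- Where the cut-off does not vanish identically, `e_θ` and `1 - ζ_θ` are both at least `1/4`. -/
lemma nonresCut_eventuallyEq_zero_or (hι : IsCutoff ι) {δ : ℝ}
    (hδ : ∀ z, 1 / 4 ≤ ι z → z ≤ 1 / 2 - δ) (hρ : 0 < ρ) (θ ξ : E d) :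
    nonresCut ι β ρ θ =ᶠ[𝓝 ξ] (fun _ => 0) ∨ NonresRegion β ρ δ θ ξ := by
  rcases lt_or_ge (shellCut ι β ρ θ ξ) (1 / 4) with h | h
  · left
    filter_upwards [((contDiff_shellCut hι hρ θ).continuous.continuousAt
      (x := ξ)).eventually_lt_const h] with y hy
    exact step_eq_zero hy.le
  · right
    have h1 := hι.nonneg |‖ξ + (1 / 2 : ℝ) • θ‖ / ρ - 1|
    have h2 := hι.le_one |‖ξ + (1 / 2 : ℝ) • θ‖ / ρ - 1|
    have h3 := hι.nonneg (|inner ℝ θ (ξ + (1 / 2 : ℝ) • θ)| / (ρ ^ β * ‖θ‖))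
    have h4 := hι.le_one (|inner ℝ θ (ξ + (1 / 2 : ℝ) • θ)| / (ρ ^ β * ‖θ‖))
    unfold shellCut cutE cutZeta at h
    constructor
    · exact hδ _ (by nlinarith)
    · by_contra hlt
      rw [not_le] at hlt
      have hp : 0 < ρ ^ β := Real.rpow_pos_of_pos hρ β
      have h5 : |inner ℝ θ (ξ + (1 / 2 : ℝ) • θ)| / (ρ ^ β * ‖θ‖) ≤ 1 / 4 := by
        refine div_le_of_le_mul₀ (by positivity) (by norm_num) (by linarith)
      rw [hι.eq_one _ h5] at h
      norm_num at h

/-- In the nonresonant region the whole segment from `ξ` to `ξ + θ` has length comparable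
with `ρ`. -/
lemma NonresRegion.norm_bounds {δ : ℝ} {θ ξ : E d} (hδ : 0 < δ) (hρ : 0 < ρ) (hθ : ‖θ‖ ≤ ρ)
    (h : NonresRegion β ρ δ θ ξ) {t : ℝ} (ht : t ∈ Set.Icc (0 : ℝ) 1) :
    δ * ρ ≤ ‖ξ + t • θ‖ ∧ ‖ξ + t • θ‖ ≤ 2 * ρ := by
  obtain ⟨h1, h2⟩ := abs_le.1 h.1
  have h3 : (1 / 2 + δ) * ρ ≤ ‖ξ + (1 / 2 : ℝ) • θ‖ := by
    rw [← le_div_iff₀ hρ]; linarith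
  have h4 : ‖ξ + (1 / 2 : ℝ) • θ‖ ≤ (3 / 2) * ρ := by
    rw [← div_le_iff₀ hρ]; linarith
  have e : ξ + t • θ = (ξ + (1 / 2 : ℝ) • θ) + (t - 1 / 2) • θ := by module
  have h5 : ‖(t - 1 / 2) • θ‖ ≤ ρ / 2 := by
    rw [norm_smul, Real.norm_eq_abs]
    have : |t - 1 / 2| ≤ 1 / 2 := abs_le.2 ⟨by linarith [ht.1], by linarith [ht.2]⟩
    calc |t - 1 / 2| * ‖θ‖ ≤ 1 / 2 * ρ := by gcongr
      _ = ρ / 2 := by ring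
  rw [e]
  have h6 := norm_add_le (ξ + (1 / 2 : ℝ) • θ) ((t - 1 / 2) • θ)
  have h7 := norm_sub_le_norm_add (ξ + (1 / 2 : ℝ) • θ) ((t - 1 / 2) • θ)
  constructor <;> linarith

end NonResonant

end

end PeriodicPDO

namespace PeriodicPDO

noncomputable section

/-! ### Multipliers and the homological equation -/

section Multipliers

variable {d : ℕ} {Λ : Submodule ℤ (E d)}

/-- `μ` is a multiplier of order `κ`, with `q` derivatives bounded by `C`. -/
def MultBound (β κ : ℝ) (q : ℕ) (μ : E d → ℝ) (C : ℝ) : Prop :=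
  ∀ i ≤ q, ∀ ξ : E d, ‖iteratedFDeriv ℝ i μ ξ‖ ≤ C * weight β ξ ^ (κ - (i : ℝ))

/-- Multiplication with multipliers of order `κ`, by the product rule. -/
lemma FamBound.mul {β γ κ : ℝ} {q : ℕ} {a : Λ → E d → ℂ} {A C : ℝ} {μ : Λ → E d → ℝ}
    (hC : 0 ≤ C) (ha : SmoothFam a) (hμ : ∀ θ, ContDiff ℝ ∞ (μ θ)) (hA : FamBound β γ q a A)
    (hμC : ∀ θ, MultBound β κ q (μ θ) C) :
    FamBound β (γ + κ) q (fun θ ξ => (μ θ ξ : ℂ) * a θ ξ) (2 ^ q * C * A) := by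
  intro k hk θ ξ
  have hw := weight_pos β ξ
  have hb : 0 < bracket (θ : E d) ^ q := pow_pos (bracket_pos _) q
  have hsplit : ∀ (p : ℝ) (i : ℕ), weight β ξ ^ (p - (i : ℝ)) =
      weight β ξ ^ p * ((weight β ξ)⁻¹) ^ i := fun p i => by
    rw [Real.rpow_sub hw, Real.rpow_natCast, inv_pow, div_eq_mul_inv]
  have hre : ∀ i, ‖iteratedFDeriv ℝ i (fun ξ => (μ θ ξ : ℂ)) ξ‖ = ‖iteratedFDeriv ℝ i (μ θ) ξ‖ :=
    fun i => Complex.ofRealLI.norm_iteratedFDeriv_comp_left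
      ((hμ θ).contDiffAt (x := ξ)) (i := i) (by exact_mod_cast le_top)
  have h := norm_iteratedFDeriv_mul_at_le (f := fun ξ => (μ θ ξ : ℂ)) (g := a θ) (x := ξ)
    (Complex.ofRealCLM.contDiff.comp (hμ θ)).contDiffAt (ha θ).contDiffAt (s := q)
    (C := C * weight β ξ ^ κ) (C' := A / bracket (θ : E d) ^ q * weight β ξ ^ γ)
    (t := (weight β ξ)⁻¹) (mul_nonneg hC (Real.rpow_nonneg hw.le κ)) (inv_pos.2 hw).le
    (fun i hi => by rw [hre, mul_assoc, ← hsplit]; exact hμC θ i hi ξ)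
    (fun i hi => by rw [mul_assoc, ← hsplit]; exact hA.norm_le hi θ ξ) k hk
  rw [← le_div_iff₀ hb]
  refine h.trans (le_of_eq ?_)
  rw [hsplit (γ + κ) k, Real.rpow_add hw]
  field_simp

lemma FamBound.I_mul {β γ : ℝ} {q : ℕ} {a : Λ → E d → ℂ} {A : ℝ} (ha : SmoothFam a)
    (hA : FamBound β γ q a A) : FamBound β γ q (fun θ ξ => Complex.I * a θ ξ) A := by
  intro k hk θ ξ
  have h : iteratedFDeriv ℝ k (fun ξ => Complex.I • a θ ξ) ξ =
      Complex.I • iteratedFDeriv ℝ k (a θ) ξ :=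
    iteratedFDeriv_const_smul_apply' ((ha θ).contDiffAt.of_le (by exact_mod_cast le_top))
  simp only [smul_eq_mul] at h
  rw [h, norm_smul, Complex.norm_I, one_mul]
  exact hA k hk θ ξ

lemma MultBound.zero {β κ C : ℝ} {q : ℕ} (hC : 0 ≤ C) :
    MultBound β κ q (fun _ : E d => (0 : ℝ)) C := fun i _ ξ => by
  rw [iteratedFDeriv_fun_zero]
  simpa using mul_nonneg hC (Real.rpow_nonneg (weight_pos β ξ).le _)

lemma MultBound.one {β C : ℝ} {q : ℕ} (hC : 1 ≤ C) :
    MultBound β 0 q (fun _ : E d => (1 : ℝ)) C := fun i _ ξ => by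
  rcases Nat.eq_zero_or_pos i with rfl | hi
  · simpa using hC
  · rw [iteratedFDeriv_const_of_ne hi.ne']
    simp only [Pi.zero_apply, norm_zero]
    exact mul_nonneg (by linarith) (Real.rpow_nonneg (weight_pos β ξ).le _)

lemma weight_le_of_norm_le {β ρ : ℝ} (hβ : 0 < β) (hρ : 1 ≤ ρ) {ξ : E d} (h : ‖ξ‖ ≤ 2 * ρ) :
    weight β ξ ≤ 3 ^ β * ρ ^ β := by
  rw [← Real.mul_rpow (by norm_num) (by linarith)]
  refine Real.rpow_le_rpow (bracket_pos ξ).le ?_ hβ.le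
  linarith [bracket_le_one_add_norm ξ]

/-- For `|ξ|` comparable with `ρ` the weight is comparable with `ρ ^ β`. -/
lemma exists_rpow_le_weight {β δ : ℝ} (hβ : 0 < β) (hδ : 0 < δ) (p : ℝ) :
    ∃ C : ℝ, ∀ (ρ : ℝ) (ξ : E d), 1 ≤ ρ → δ * ρ ≤ ‖ξ‖ → ‖ξ‖ ≤ 2 * ρ →
      (ρ ^ β) ^ p ≤ C * weight β ξ ^ p := by
  rcases le_total 0 p with hp | hp
  · refine ⟨((δ ^ β) ^ p)⁻¹, fun ρ ξ hρ h1 h2 => ?_⟩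
    have hρ0 : 0 < ρ := by linarith
    have hd : 0 < δ ^ β := Real.rpow_pos_of_pos hδ β
    have hr : 0 < ρ ^ β := Real.rpow_pos_of_pos hρ0 β
    rw [le_inv_mul_iff₀ (Real.rpow_pos_of_pos hd p), ← Real.mul_rpow hd.le hr.le,
      ← Real.mul_rpow hδ.le hρ0.le]
    refine Real.rpow_le_rpow (by positivity) ?_ hp
    exact Real.rpow_le_rpow (by positivity) (h1.trans (norm_le_bracket ξ)) hβ.le
  · refine ⟨(((3 : ℝ) ^ β) ^ p)⁻¹, fun ρ ξ hρ h1 h2 => ?_⟩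
    have hρ0 : 0 < ρ := by linarith
    have hd : 0 < (3 : ℝ) ^ β := by positivity
    have hr : 0 < ρ ^ β := Real.rpow_pos_of_pos hρ0 β
    rw [le_inv_mul_iff₀ (Real.rpow_pos_of_pos hd p), ← Real.mul_rpow hd.le hr.le]
    exact Real.rpow_le_rpow_of_nonpos (weight_pos β ξ) (weight_le_of_norm_le hβ hρ h2) hp

/-- A multiplier carried by `|ξ| ~ ρ` has every order. -/
lemma exists_multBound_of_region {β δ : ℝ} (hβ : 0 < β) (hδ : 0 < δ) (κ : ℝ) (q : ℕ) :
    ∃ C : ℝ, 1 ≤ C ∧ ∀ (ρ : ℝ) (μ : E d → ℝ) (A : ℝ), 1 ≤ ρ → 0 ≤ A →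
      (∀ ξ, μ =ᶠ[𝓝 ξ] (fun _ => 0) ∨ (δ * ρ ≤ ‖ξ‖ ∧ ‖ξ‖ ≤ 2 * ρ ∧
        ∀ i ≤ q, ‖iteratedFDeriv ℝ i μ ξ‖ ≤ A * ((ρ ^ β)⁻¹) ^ i)) →
      MultBound β κ q μ (C * A * (ρ ^ β) ^ (-κ)) := by
  obtain ⟨C, hC1, hC⟩ := exists_uniform_bound q
    (fun i (x : ℝ × E d) => (x.1 ^ β) ^ (κ - (i : ℝ)) / weight β x.2 ^ (κ - (i : ℝ)))
    (fun x => 1 ≤ x.1 ∧ δ * x.1 ≤ ‖x.2‖ ∧ ‖x.2‖ ≤ 2 * x.1) (fun i _ => by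
      obtain ⟨C, hC⟩ := exists_rpow_le_weight (d := d) hβ hδ (κ - (i : ℝ))
      refine ⟨C, fun x hx => ?_⟩
      rw [div_le_iff₀ (Real.rpow_pos_of_pos (weight_pos β _) _)]
      exact hC x.1 x.2 hx.1 hx.2.1 hx.2.2)
  refine ⟨C, hC1, fun ρ μ A hρ hA h i hi ξ => ?_⟩
  have hρ0 : 0 < ρ := by linarith
  have hr : 0 < ρ ^ β := Real.rpow_pos_of_pos hρ0 β
  have hw := Real.rpow_pos_of_pos (weight_pos β ξ) (κ - (i : ℝ))
  rcases h ξ with h0 | ⟨h1, h2, h3⟩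
  · have e : iteratedFDeriv ℝ i μ ξ = 0 := by
      rw [(Filter.EventuallyEq.iteratedFDeriv ℝ h0 i).eq_of_nhds, iteratedFDeriv_fun_zero]; rfl
    rw [e, norm_zero]
    positivity
  · refine (h3 i hi).trans ?_
    have h4 := hC i hi (ρ, ξ) ⟨hρ, h1, h2⟩
    simp only at h4
    rw [div_le_iff₀ hw] at h4
    have e : ((ρ ^ β)⁻¹) ^ i = (ρ ^ β) ^ (-κ) * (ρ ^ β) ^ (κ - (i : ℝ)) := by
      rw [← Real.rpow_add hr, inv_pow, ← Real.rpow_natCast, ← Real.rpow_neg hr.le]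
      congr 1; ring
    rw [e]
    have h5 : 0 ≤ (ρ ^ β) ^ (-κ) := Real.rpow_nonneg hr.le _
    calc A * ((ρ ^ β) ^ (-κ) * (ρ ^ β) ^ (κ - (i : ℝ)))
        ≤ A * ((ρ ^ β) ^ (-κ) * (C * weight β ξ ^ (κ - (i : ℝ)))) := by gcongr
      _ = _ := by ring

variable {ι : ℝ → ℝ}

/-- The complementary cut-off is a multiplier of order zero. -/
lemma exists_multBound_resCut (hι : IsCutoff ι) {β : ℝ} (hβ : 0 < β) (hβ1 : β ≤ 1) (q : ℕ) :
    ∃ C : ℝ, 1 ≤ C ∧ ∀ (ρ : ℝ) (θ : E d), 1 ≤ ρ → ‖θ‖ ≤ ρ →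
      MultBound β 0 q (resCut ι β ρ θ) C := by
  obtain ⟨C, hC1, hC⟩ := exists_comp_shellCut_bound (d := d) (β := β) contDiff_coStep hι hβ1 q
  have h31 : (1 : ℝ) ≤ 3 ^ β := Real.one_le_rpow (by norm_num) hβ.le
  refine ⟨C * (3 ^ β) ^ q, one_le_mul_of_one_le_of_one_le hC1 (one_le_pow₀ h31),
    fun ρ θ hρ hθ i hi ξ => ?_⟩
  have hρ0 : 0 < ρ := by linarith
  have hr : 0 < ρ ^ β := Real.rpow_pos_of_pos hρ0 β
  have hw := weight_pos β ξ
  rw [zero_sub, Real.rpow_neg hw.le, Real.rpow_natCast, ← inv_pow]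
  rcases le_or_gt ‖ξ‖ (2 * ρ) with h | h
  · refine (hC ρ hρ θ ξ i hi).trans ?_
    have h1 : (ρ ^ β)⁻¹ ≤ 3 ^ β * (weight β ξ)⁻¹ := by
      rw [← div_eq_mul_inv, le_div_iff₀ hw, inv_mul_le_iff₀ hr, mul_comm]
      exact weight_le_of_norm_le hβ hρ h
    calc C * ((ρ ^ β)⁻¹) ^ i ≤ C * (3 ^ β * (weight β ξ)⁻¹) ^ i := by gcongr
      _ = C * (3 ^ β) ^ i * ((weight β ξ)⁻¹) ^ i := by rw [mul_pow]; ring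
      _ ≤ _ := by gcongr
  · -- far away the shell cut-off vanishes and the complementary cut-off is constant
    have h0 : resCut ι β ρ θ =ᶠ[𝓝 ξ] fun _ => 1 := by
      filter_upwards [continuous_norm.continuousAt.eventually_const_lt h] with y hy
      have hs : shellCut ι β ρ θ y = 0 := by
        have h1 : 1 / 2 ≤ ‖y + (1 / 2 : ℝ) • θ‖ / ρ - 1 := by
          have h2 : ‖y‖ - ‖(1 / 2 : ℝ) • θ‖ ≤ ‖y + (1 / 2 : ℝ) • θ‖ := norm_sub_le_norm_add _ _
          rw [norm_smul, Real.norm_eq_abs, abs_of_pos (by norm_num : (0 : ℝ) < 1 / 2)] at h2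
          rw [le_sub_iff_add_le, le_div_iff₀ hρ0]
          linarith
        unfold shellCut cutE
        rw [hι.eq_zero _ (h1.trans (le_abs_self _)), zero_mul]
      rw [resCut, hs, coStep_zero]
    have hC31 : 1 ≤ C * (3 ^ β) ^ q :=
      one_le_mul_of_one_le_of_one_le hC1 (one_le_pow₀ h31)
    rcases Nat.eq_zero_or_pos i with rfl | hi0
    · rw [norm_iteratedFDeriv_zero, h0.eq_of_nhds]
      simpa using hC31
    · rw [iteratedFDeriv_eq_zero_of_eventuallyEq_const h0 hi0.ne', norm_zero]
      positivity

lemma exists_multBound_nonresCut (hι : IsCutoff ι) {β : ℝ} (hβ : 0 < β) (hβ1 : β ≤ 1) (κ : ℝ)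
    (q : ℕ) : ∃ C : ℝ, 0 ≤ C ∧ ∀ (ρ : ℝ) (θ : E d), 1 ≤ ρ → ‖θ‖ ≤ ρ →
      MultBound β κ q (nonresCut ι β ρ θ) (C * (ρ ^ β) ^ (-κ)) := by
  obtain ⟨C, hC1, hC⟩ := exists_comp_shellCut_bound (d := d) (β := β) contDiff_step hι hβ1 q
  obtain ⟨δ, hδ, hgap⟩ := hι.exists_gap
  obtain ⟨C', hC'1, hC'⟩ := exists_multBound_of_region (d := d) hβ hδ κ q
  refine ⟨C' * C, by positivity, fun ρ θ hρ hθ => hC' ρ _ C hρ (by linarith) fun ξ => ?_⟩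
  have hρ0 : 0 < ρ := by linarith
  refine (nonresCut_eventuallyEq_zero_or (β := β) hι hgap hρ0 θ ξ).imp_right fun h => ?_
  have h2 := h.norm_bounds hδ hρ0 hθ (t := 0) (by simp)
  simp only [zero_smul, add_zero] at h2
  exact ⟨h2.1, h2.2, fun i hi => hC ρ hρ θ ξ i hi⟩

/-- The symbol `|ξ|^{2m}` as a real function. -/
def kin (m : ℝ) (ξ : E d) : ℝ := ‖ξ‖ ^ (2 * m)

lemma contDiffAt_kin (m : ℝ) {ξ : E d} (hξ : ξ ≠ 0) : ContDiffAt ℝ ∞ (kin (d := d) m) ξ :=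
  (contDiffAt_norm ℝ hξ).rpow_const_of_ne (norm_ne_zero_iff.2 hξ)

/-- Derivatives of the homogeneous function `|ξ|^{2m}` for `|ξ| ~ ρ`. -/
lemma exists_kin_bound (m : ℝ) {δ : ℝ} (hδ : 0 < δ) (s : ℕ) :
    ∃ C : ℝ, 1 ≤ C ∧ ∀ i ≤ s, ∀ (ρ : ℝ) (x : E d), 0 < ρ → δ * ρ ≤ ‖x‖ → ‖x‖ ≤ 2 * ρ →
      ‖iteratedFDeriv ℝ i (kin m) x‖ ≤ C * ρ ^ (2 * m - (i : ℝ)) := by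
  have hK : IsCompact (Metric.closedBall (0 : E d) 2 ∩ {x | δ ≤ ‖x‖}) :=
    (isCompact_closedBall _ _).inter_right (isClosed_le continuous_const continuous_norm)
  -- compactness gives the bound for `ρ = 1`, and scaling with `ρ` reduces to this case
  obtain ⟨C, hC1, hC⟩ := exists_iteratedFDeriv_bound_on hK (f := kin (d := d) m)
    (fun x hx => contDiffAt_kin m (by
      rintro rfl
      have := hx.2
      simp only [Set.mem_ofPred_eq, norm_zero] at this
      linarith)) s
  refine ⟨C, hC1, fun i hi ρ x hρ h1 h2 => ?_⟩
  set L : E d ≃L[ℝ] E d := ContinuousLinearEquiv.smulLeft (Units.mk0 ρ⁻¹ (inv_pos.2 hρ).ne') with hL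
  have hLx : ∀ y, L y = ρ⁻¹ • y := fun y => rfl
  have e1 : kin (d := d) m = fun y => ρ ^ (2 * m) • (kin (d := d) m ∘ L) y := by
    funext y
    simp only [kin, Function.comp_apply, hLx, norm_smul, norm_inv, Real.norm_eq_abs,
      abs_of_pos hρ, smul_eq_mul]
    rw [Real.mul_rpow (inv_pos.2 hρ).le (norm_nonneg _), ← mul_assoc, ← Real.mul_rpow hρ.le
      (inv_pos.2 hρ).le, mul_inv_cancel₀ hρ.ne', Real.one_rpow, one_mul]
  have hx0 : x ≠ 0 := by
    rintro rfl
    rw [norm_zero] at h1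
    nlinarith
  have hnorm : ‖L x‖ = ρ⁻¹ * ‖x‖ := by
    rw [hLx, norm_smul, norm_inv, Real.norm_eq_abs, abs_of_pos hρ]
  have hLx0 : L x ≠ 0 := by simpa [hLx, hρ.ne'] using hx0
  have e2 : iteratedFDeriv ℝ i (kin (d := d) m ∘ L) x =
      (iteratedFDeriv ℝ i (kin (d := d) m) (L x)).compContinuousLinearMap
        fun _ => (L : E d →L[ℝ] E d) := by
    have := L.iteratedFDerivWithin_comp_right (kin (d := d) m) uniqueDiffOn_univ (x := x)
      (Set.mem_univ _) i
    simpa only [Set.preimage_univ, iteratedFDerivWithin_univ] using this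
  have e3 : iteratedFDeriv ℝ i (kin (d := d) m) x =
      ρ ^ (2 * m) • iteratedFDeriv ℝ i (kin (d := d) m ∘ L) x := by
    conv_lhs => rw [e1]
    exact iteratedFDeriv_const_smul_apply' (((contDiffAt_kin m hLx0).comp x
      L.contDiff.contDiffAt).of_le (by exact_mod_cast le_top))
  have hLn : ‖(L : E d →L[ℝ] E d)‖ ≤ ρ⁻¹ :=
    ContinuousLinearMap.opNorm_le_bound _ (inv_pos.2 hρ).le fun y => by
      rw [ContinuousLinearEquiv.coe_coe, hLx, norm_smul, norm_inv, Real.norm_eq_abs,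
        abs_of_pos hρ]
  rw [e3, e2, norm_smul, Real.norm_eq_abs, abs_of_pos (Real.rpow_pos_of_pos hρ _)]
  have hb : ‖iteratedFDeriv ℝ i (kin (d := d) m) (L x)‖ ≤ C := by
    refine hC i hi _ ⟨?_, ?_⟩
    · rw [mem_closedBall_zero_iff, hnorm, inv_mul_le_iff₀ hρ]; linarith
    · simp only [Set.mem_ofPred_eq]
      rw [hnorm, le_inv_mul_iff₀ hρ]; linarith
  calc _ ≤ ρ ^ (2 * m) * (C * (ρ⁻¹) ^ i) := by
        gcongr
        refine (ContinuousMultilinearMap.norm_compContinuousLinearMap_le _ _).trans ?_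
        rw [Finset.prod_const, Finset.card_univ, Fintype.card_fin]
        gcongr
    _ = _ := by
        rw [Real.rpow_sub hρ, Real.rpow_natCast, inv_pow]
        field_simp

/-- The denominator `|ξ + θ|^{2m} - |ξ|^{2m}` of the homological equation. -/
def kinDiff (m : ℝ) (θ ξ : E d) : ℝ := kin m (ξ + θ) - kin m ξ

/-- Positive-order derivatives of the denominator. -/
lemma exists_kinDiff_bound {m β : ℝ} (hβ1 : β ≤ 1) {δ : ℝ} (hδ : 0 < δ) (s : ℕ) :
    ∃ C : ℝ, 1 ≤ C ∧ ∀ i, 1 ≤ i → i ≤ s → ∀ (ρ : ℝ) (θ ξ : E d), 1 ≤ ρ →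
      (∀ t ∈ Set.Icc (0 : ℝ) 1, δ * ρ ≤ ‖ξ + t • θ‖ ∧ ‖ξ + t • θ‖ ≤ 2 * ρ) →
      ‖iteratedFDeriv ℝ i (kinDiff m θ) ξ‖ ≤
        C * (ρ ^ (2 * m - 2 + β) * ‖θ‖) * ((ρ ^ β)⁻¹) ^ i := by
  obtain ⟨C, hC1, hC⟩ := exists_kin_bound (d := d) m hδ (s + 1)
  refine ⟨C, hC1, fun i hi0 hi ρ θ ξ hρ hseg => ?_⟩
  have hρ0 : 0 < ρ := by linarith
  have hne : ∀ t ∈ Set.Icc (0 : ℝ) 1, ξ + t • θ ≠ 0 := fun t ht h0 => by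
    have := (hseg t ht).1
    rw [h0, norm_zero] at this
    nlinarith
  have hξ : ξ ≠ 0 := by simpa using hne 0 (by simp)
  have hξθ : ξ + θ ≠ 0 := by simpa using hne 1 (by simp)
  have e : iteratedFDeriv ℝ i (kinDiff m θ) ξ =
      iteratedFDeriv ℝ i (kin m) (ξ + θ) - iteratedFDeriv ℝ i (kin m) ξ := by
    have h1 : ContDiffAt ℝ i (fun ζ => kin (d := d) m (ζ + θ)) ξ :=
      ((contDiffAt_kin m hξθ).of_le (by exact_mod_cast le_top)).comp ξ
        (contDiffAt_id.add contDiffAt_const)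
    have := iteratedFDeriv_sub_apply (𝕜 := ℝ) (i := i) (x := ξ)
      (f := fun ζ => kin (d := d) m (ζ + θ)) (g := kin (d := d) m) h1
      ((contDiffAt_kin m hξ).of_le (by exact_mod_cast le_top))
    rw [← iteratedFDeriv_comp_add_right]
    exact this
  rw [e]
  have hmv := (convex_segment (𝕜 := ℝ) ξ (ξ + θ)).norm_image_sub_le_of_norm_fderiv_le (𝕜 := ℝ)
    (f := iteratedFDeriv ℝ i (kin (d := d) m)) (C := C * ρ ^ (2 * m - ((i + 1 : ℕ) : ℝ)))
    (fun z hz => by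
      rw [segment_eq_image'] at hz
      obtain ⟨t, ht, rfl⟩ := hz
      rw [add_sub_cancel_left]
      exact (contDiffAt_kin m (hne t ht)).differentiableAt_iteratedFDeriv
        (by exact_mod_cast WithTop.coe_lt_top _))
    (fun z hz => by
      rw [segment_eq_image'] at hz
      obtain ⟨t, ht, rfl⟩ := hz
      rw [add_sub_cancel_left, norm_fderiv_iteratedFDeriv]
      exact hC (i + 1) (by omega) ρ _ hρ0 (hseg t ht).1 (hseg t ht).2)
    (left_mem_segment ℝ ξ (ξ + θ)) (right_mem_segment ℝ ξ (ξ + θ))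
  refine hmv.trans ?_
  rw [add_sub_cancel_left]
  have h2 : ρ ^ (2 * m - ((i + 1 : ℕ) : ℝ)) ≤ ρ ^ (2 * m - 2 + β) * ((ρ ^ β)⁻¹) ^ i := by
    have h3 : ((ρ ^ β)⁻¹) ^ i = ρ ^ (-(β * i)) := by
      rw [inv_pow, ← Real.rpow_natCast, ← Real.rpow_mul hρ0.le, Real.rpow_neg hρ0.le]
    rw [h3, ← Real.rpow_add hρ0]
    refine Real.rpow_le_rpow_of_exponent_le hρ ?_
    have h4 : (1 : ℝ) ≤ i := by exact_mod_cast hi0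
    push_cast
    nlinarith
  calc C * ρ ^ (2 * m - ((i + 1 : ℕ) : ℝ)) * ‖θ‖
      ≤ C * (ρ ^ (2 * m - 2 + β) * ((ρ ^ β)⁻¹) ^ i) * ‖θ‖ := by gcongr
    _ = _ := by ring

/-- Lower bound for the denominator away from resonances. -/
lemma exists_kinDiff_lower {m β : ℝ} (hm : 0 < m) {δ : ℝ} (hδ : 0 < δ) :
    ∃ c : ℝ, 0 < c ∧ ∀ (ρ : ℝ) (θ ξ : E d), 1 ≤ ρ →
      (∀ t ∈ Set.Icc (0 : ℝ) 1, δ * ρ ≤ ‖ξ + t • θ‖ ∧ ‖ξ + t • θ‖ ≤ 2 * ρ) →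
      ρ ^ β * ‖θ‖ / 4 ≤ |inner ℝ θ (ξ + (1 / 2 : ℝ) • θ)| →
      c * (ρ ^ (2 * m - 2 + β) * ‖θ‖) ≤ |kinDiff m θ ξ| := by
  set c₀ : ℝ := m * min ((δ ^ 2) ^ (m - 1)) (4 ^ (m - 1)) with hc₀
  have hc₀pos : 0 < c₀ := by positivity
  -- `|ξ|^{2m}` is a function of `|ξ|²`, whose derivative is bounded below after scaling with `ρ`
  have hmono : ∀ x ∈ Set.Icc (δ ^ 2) 4, ∀ y ∈ Set.Icc (δ ^ 2) 4, x ≤ y →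
      c₀ * (y - x) ≤ y ^ m - x ^ m := by
    refine (convex_Icc (δ ^ 2) 4).mul_sub_le_image_sub_of_le_deriv
      (f := fun x : ℝ => x ^ m) ?_ ?_ ?_
    · exact fun x hx => (Real.continuousAt_rpow_const x m (Or.inr hm.le)).continuousWithinAt
    · intro x hx
      rw [interior_Icc] at hx
      have : 0 < x := lt_trans (by positivity) hx.1
      exact (Real.differentiableAt_rpow_const_of_ne m this.ne').differentiableWithinAt
    · intro x hx
      rw [interior_Icc] at hx
      have hx0 : 0 < x := lt_trans (by positivity) hx.1
      rw [Real.deriv_rpow_const]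
      rw [hc₀]
      refine mul_le_mul_of_nonneg_left ?_ hm.le
      rcases le_total 0 (m - 1) with h | h
      · exact (min_le_left _ _).trans (Real.rpow_le_rpow (by positivity) hx.1.le h)
      · exact (min_le_right _ _).trans (Real.rpow_le_rpow_of_nonpos hx0 hx.2.le h)
  have habs : ∀ x ∈ Set.Icc (δ ^ 2) 4, ∀ y ∈ Set.Icc (δ ^ 2) 4, c₀ * |y - x| ≤ |y ^ m - x ^ m| := by
    intro x hx y hy
    rcases le_total x y with h | h
    · rw [abs_of_nonneg (by linarith : 0 ≤ y - x)]
      exact (hmono x hx y hy h).trans (le_abs_self _)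
    · rw [abs_sub_comm, abs_sub_comm (y ^ m), abs_of_nonneg (by linarith : 0 ≤ x - y)]
      exact (hmono y hy x hx h).trans (le_abs_self _)
  refine ⟨c₀ / 2, by positivity, fun ρ θ ξ hρ hseg hres => ?_⟩
  have hρ0 : 0 < ρ := by linarith
  have hmem : ∀ z : E d, δ * ρ ≤ ‖z‖ ∧ ‖z‖ ≤ 2 * ρ → (‖z‖ / ρ) ^ 2 ∈ Set.Icc (δ ^ 2) 4 := by
    intro z hz
    have h1 : δ ≤ ‖z‖ / ρ := by rw [le_div_iff₀ hρ0]; exact hz.1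
    have h2 : ‖z‖ / ρ ≤ 2 := by rw [div_le_iff₀ hρ0]; exact hz.2
    constructor <;> nlinarith
  have hkin : ∀ z : E d, kin m z = ρ ^ (2 * m) * ((‖z‖ / ρ) ^ 2) ^ m := by
    intro z
    have h0 : 0 ≤ ‖z‖ / ρ := div_nonneg (norm_nonneg _) hρ0.le
    rw [← Real.rpow_natCast (‖z‖ / ρ) 2, ← Real.rpow_mul h0, Nat.cast_two, ← Real.mul_rpow hρ0.le h0,
      mul_div_cancel₀ _ hρ0.ne']
    rfl
  have h0 := hmem ξ (by simpa using hseg 0 (by simp))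
  have h1 := hmem (ξ + θ) (by simpa using hseg 1 (by simp))
  have h2 := habs _ h0 _ h1
  -- the difference of the squares is `2 θ · (ξ + θ/2)`, which is large off the resonance zone
  have e : (‖ξ + θ‖ / ρ) ^ 2 - (‖ξ‖ / ρ) ^ 2 =
      2 * inner ℝ θ (ξ + (1 / 2 : ℝ) • θ) / ρ ^ 2 := by
    rw [div_pow, div_pow, ← sub_div, norm_add_sq_real, inner_add_right, inner_smul_right,
      real_inner_self_eq_norm_sq, real_inner_comm]
    congr 1; ring
  rw [e] at h2
  have hp : ρ ^ (2 * m - 2 + β) = ρ ^ (2 * m) * (ρ ^ β / ρ ^ 2) := by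
    rw [Real.rpow_add hρ0, Real.rpow_sub hρ0]
    norm_cast
    ring
  rw [kinDiff, hkin ξ, hkin (ξ + θ), ← mul_sub, abs_mul,
    abs_of_pos (Real.rpow_pos_of_pos hρ0 (2 * m)), hp]
  have h3 : c₀ / 2 * (ρ ^ β / ρ ^ 2 * ‖θ‖) ≤
      c₀ * |2 * inner ℝ θ (ξ + (1 / 2 : ℝ) • θ) / ρ ^ 2| := by
    rw [abs_div, abs_mul, abs_of_pos (by norm_num : (0 : ℝ) < 2),
      abs_of_pos (by positivity : 0 < ρ ^ 2)]
    have : c₀ / 2 * (ρ ^ β / ρ ^ 2 * ‖θ‖) = c₀ * (2 * (ρ ^ β * ‖θ‖ / 4) / ρ ^ 2) := by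
      field_simp; ring
    rw [this]
    gcongr
  have hp0 : 0 ≤ ρ ^ (2 * m) := Real.rpow_nonneg hρ0.le _
  calc _ = ρ ^ (2 * m) * (c₀ / 2 * (ρ ^ β / ρ ^ 2 * ‖θ‖)) := by ring
    _ ≤ _ := mul_le_mul_of_nonneg_left (h3.trans h2) hp0

/-- The multiplier `n_θ(ξ) / (|ξ + θ|^{2m} - |ξ|^{2m})` solving the homological equation; it is
zero outside the support of the nonresonant cut-off `n_θ`. -/
def homMult (ι : ℝ → ℝ) (m β ρ : ℝ) (θ ξ : E d) : ℝ := nonresCut ι β ρ θ ξ / kinDiff m θ ξ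

lemma kinDiff_ne_zero {m β : ℝ} (hm : 0 < m) {δ ρ : ℝ} (hδ : 0 < δ) (hρ : 1 ≤ ρ) {θ ξ : E d}
    (hθ : ‖θ‖ ≤ ρ) (hθ0 : θ ≠ 0) (h : NonresRegion β ρ δ θ ξ) : kinDiff m θ ξ ≠ 0 := by
  obtain ⟨c, hc, hlow⟩ := exists_kinDiff_lower (d := d) (m := m) (β := β) hm hδ
  have hρ0 : 0 < ρ := by linarith
  have h1 := hlow ρ θ ξ hρ (fun t ht => h.norm_bounds hδ hρ0 hθ ht) h.2
  have h2 : 0 < c * (ρ ^ (2 * m - 2 + β) * ‖θ‖) := by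
    have := norm_pos_iff.2 hθ0
    positivity
  exact abs_pos.1 (h2.trans_le h1)

lemma NonresRegion.contDiffAt_kinDiff {m β δ ρ : ℝ} (hδ : 0 < δ) (hρ : 1 ≤ ρ) {θ ξ : E d}
    (hθ : ‖θ‖ ≤ ρ) (h : NonresRegion β ρ δ θ ξ) : ContDiffAt ℝ ∞ (kinDiff m θ) ξ := by
  have hρ0 : 0 < ρ := by linarith
  have hpos : 0 < δ * ρ := by positivity
  have h0 := (h.norm_bounds hδ hρ0 hθ (t := 0) (by simp)).1
  have h1 := (h.norm_bounds hδ hρ0 hθ (t := 1) (by simp)).1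
  simp only [zero_smul, add_zero, one_smul] at h0 h1
  exact ((contDiffAt_kin m (norm_pos_iff.1 (hpos.trans_le h1))).comp ξ
    (contDiffAt_id.add contDiffAt_const)).sub (contDiffAt_kin m (norm_pos_iff.1 (hpos.trans_le h0)))

lemma contDiff_homMult (hι : IsCutoff ι) {m β ρ : ℝ} (hm : 0 < m) (hρ : 1 ≤ ρ) {θ : E d}
    (hθ : ‖θ‖ ≤ ρ) (hθ0 : θ ≠ 0) : ContDiff ℝ ∞ (homMult ι m β ρ θ) := by
  obtain ⟨δ, hδ, hgap⟩ := hι.exists_gap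
  have hρ0 : 0 < ρ := by linarith
  rw [contDiff_iff_contDiffAt]
  intro ξ
  rcases nonresCut_eventuallyEq_zero_or (β := β) hι hgap hρ0 θ ξ with h | h
  · refine (contDiffAt_const (c := (0 : ℝ))).congr_of_eventuallyEq ?_
    filter_upwards [h] with y hy
    rw [homMult, hy, zero_div]
  · exact (contDiff_nonresCut hι hρ0 θ).contDiffAt.div (h.contDiffAt_kinDiff hδ hρ hθ)
      (kinDiff_ne_zero hm hδ hρ hθ hθ0 h)

/-- The solution of the homological equation gains the factor `ρ^{-(2m-2)-β}`. -/
lemma exists_multBound_homMult (hι : IsCutoff ι) {m β : ℝ} (hm : 0 < m) (hβ : 0 < β)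
    (hβ1 : β ≤ 1) {c₀ : ℝ} (hc₀ : 0 < c₀) (κ : ℝ) (q : ℕ) :
    ∃ C : ℝ, 0 ≤ C ∧ ∀ (ρ : ℝ) (θ : E d), 1 ≤ ρ → ‖θ‖ ≤ ρ → c₀ ≤ ‖θ‖ →
      MultBound β κ q (homMult ι m β ρ θ)
        (C * ρ ^ (-(2 * m - 2 + β)) * (ρ ^ β) ^ (-κ)) := by
  obtain ⟨δ, hδ, hgap⟩ := hι.exists_gap
  obtain ⟨C₁, hC₁1, hC₁⟩ := exists_comp_shellCut_bound (d := d) (β := β) contDiff_step hι hβ1 q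
  obtain ⟨C₂, hC₂1, hC₂⟩ := exists_kinDiff_bound (d := d) (m := m) hβ1 hδ q
  obtain ⟨c, hc, hlow⟩ := exists_kinDiff_lower (d := d) (m := m) (β := β) hm hδ
  obtain ⟨C', hC'1, hC'⟩ := exists_multBound_of_region (d := d) hβ hδ κ q
  set D : ℝ := 2 ^ q * C₁ * (q.factorial * (q.factorial * (1 + c⁻¹) ^ (q + 1)) * C₂ ^ q) with hD
  have hD0 : 0 ≤ D := by positivity
  refine ⟨C' * (c₀⁻¹ * D), by positivity, fun ρ θ hρ hθ hθc => ?_⟩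
  have hρ0 : 0 < ρ := by linarith
  have hr : 0 < ρ ^ β := Real.rpow_pos_of_pos hρ0 β
  have hθpos : 0 < ‖θ‖ := hc₀.trans_le hθc
  set P : ℝ := ρ ^ (2 * m - 2 + β) * ‖θ‖ with hP
  have hPpos : 0 < P := by positivity
  have hmain : MultBound β κ q (homMult ι m β ρ θ) (C' * (P⁻¹ * D) * (ρ ^ β) ^ (-κ)) := by
    refine hC' ρ _ _ hρ (by positivity) fun ξ => ?_
    rcases nonresCut_eventuallyEq_zero_or (β := β) hι hgap hρ0 θ ξ with h | h
    · left
      filter_upwards [h] with y hy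
      rw [homMult, hy, zero_div]
    · right
      have hb := h.norm_bounds hδ hρ0 hθ (t := 0) (by simp)
      simp only [zero_smul, add_zero] at hb
      refine ⟨hb.1, hb.2, fun i hi => ?_⟩
      have hseg := fun t ht => h.norm_bounds hδ hρ0 hθ (t := t) ht
      have hkd : ContDiffAt ℝ ∞ (kinDiff m θ) ξ := h.contDiffAt_kinDiff hδ hρ hθ
      -- the normalized denominator is bounded below, with derivatives of order `i`
      -- bounded by `ρ ^ (-β i)`
      set f : E d → ℝ := fun ξ => P⁻¹ • kinDiff m θ ξ with hf
      have hfs : ContDiffAt ℝ ∞ f ξ := hkd.const_smul P⁻¹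
      have hflow : c ≤ |f ξ| := by
        simp only [hf, smul_eq_mul]
        rw [abs_mul, abs_of_pos (inv_pos.2 hPpos), le_inv_mul_iff₀ hPpos, mul_comm]
        exact hlow ρ θ ξ hρ hseg h.2
      have hf0 : f ξ ≠ 0 := abs_pos.1 (hc.trans_le hflow)
      have hfb : ∀ i, 1 ≤ i → i ≤ q → ‖iteratedFDeriv ℝ i f ξ‖ ≤ C₂ * ((ρ ^ β)⁻¹) ^ i := by
        intro i hi1 hi
        have e : iteratedFDeriv ℝ i f ξ = P⁻¹ • iteratedFDeriv ℝ i (kinDiff m θ) ξ :=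
          iteratedFDeriv_const_smul_apply' (hkd.of_le (by exact_mod_cast le_top))
        rw [e, norm_smul, norm_inv, Real.norm_eq_abs, abs_of_pos hPpos, inv_mul_le_iff₀ hPpos]
        refine (hC₂ i hi1 hi ρ θ ξ hρ hseg).trans (le_of_eq ?_)
        rw [hP]; ring
      have hinv := norm_iteratedFDeriv_comp_at_le (g := fun y : ℝ => y⁻¹) (f := f) (x := ξ)
        (contDiffAt_inv ℝ hf0) hfs hC₂1 (inv_pos.2 hr).le (s := q)
        (fun i hi => norm_iteratedFDeriv_inv_le hc hflow hi) hfb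
      have hprod := norm_iteratedFDeriv_mul_at_le (f := nonresCut ι β ρ θ)
        (g := (fun y : ℝ => y⁻¹) ∘ f) (x := ξ) (contDiff_nonresCut hι hρ0 θ).contDiffAt
        ((contDiffAt_inv ℝ hf0).comp ξ hfs) (by linarith) (inv_pos.2 hr).le
        (fun i hi => hC₁ ρ hρ θ ξ i hi) hinv i hi
      have e : homMult ι m β ρ θ =
          fun y => P⁻¹ • (nonresCut ι β ρ θ y * ((fun y : ℝ => y⁻¹) ∘ f) y) := by
        funext y
        simp only [homMult, hf, Function.comp_apply, smul_eq_mul, mul_inv, inv_inv]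
        field_simp
      have e2 : iteratedFDeriv ℝ i (homMult ι m β ρ θ) ξ = P⁻¹ • iteratedFDeriv ℝ i
          (fun y => nonresCut ι β ρ θ y * ((fun y : ℝ => y⁻¹) ∘ f) y) ξ := by
        rw [e]
        exact iteratedFDeriv_const_smul_apply' (((contDiff_nonresCut hι hρ0 θ).contDiffAt.mul
          ((contDiffAt_inv ℝ hf0).comp ξ hfs)).of_le (by exact_mod_cast le_top))
      rw [e2, norm_smul, norm_inv, Real.norm_eq_abs, abs_of_pos hPpos, mul_assoc P⁻¹]
      exact mul_le_mul_of_nonneg_left hprod (inv_pos.2 hPpos).le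
  intro i hi ξ
  refine (hmain i hi ξ).trans ?_
  have hw := Real.rpow_pos_of_pos (weight_pos β ξ) (κ - (i : ℝ))
  have hP' : P⁻¹ ≤ c₀⁻¹ * ρ ^ (-(2 * m - 2 + β)) := by
    rw [hP, mul_inv, ← Real.rpow_neg hρ0.le, mul_comm]
    gcongr
  have hk : 0 ≤ (ρ ^ β) ^ (-κ) := Real.rpow_nonneg hr.le _
  refine mul_le_mul_of_nonneg_right ?_ hw.le
  calc C' * (P⁻¹ * D) * (ρ ^ β) ^ (-κ)
      ≤ C' * (c₀⁻¹ * ρ ^ (-(2 * m - 2 + β)) * D) * (ρ ^ β) ^ (-κ) := by gcongr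
    _ = _ := by ring

end Multipliers

end

end PeriodicPDO

namespace PeriodicPDO

noncomputable section

/-! ### The iteration for the gauge transform -/

section Iteration

set_option linter.unusedSectionVars false

variable {d : ℕ} {Λ : Submodule ℤ (E d)}

section Maps

variable (ι : ℝ → ℝ) (m β ρ c : ℝ) (S : Finset Λ)

open Classical in
/-- The part of a family which the gauge transform removes. -/
def nonresPart (y : Λ → E d → ℂ) : Λ → E d → ℂ := fun θ ξ =>
  (((if θ ∈ S then nonresCut ι β ρ (θ : E d) else fun _ => 0) ξ : ℝ) : ℂ) * y θ ξ

open Classical in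
/-- The family whose parts `♭`, `↓`, `♯` make up what `nonresPart` leaves of `y`. -/
def resPart (y : Λ → E d → ℂ) : Λ → E d → ℂ := fun θ ξ =>
  (((if θ ∈ S then resCut ι β ρ (θ : E d) else fun _ => 1) ξ : ℝ) : ℂ) * y θ ξ

open Classical in
/-- The solution `ψ` of the homological equation `i[H₀, Ψ] = - nonresPart y`. -/
def homSol (y : Λ → E d → ℂ) : Λ → E d → ℂ := fun θ ξ =>
  Complex.I * ((((if θ ∈ S then homMult ι m β ρ (θ : E d) else fun _ => 0) ξ : ℝ) : ℂ) * y θ ξ)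

/-- The family of `i[H, Ψ]` for `ψ = homSol y`. -/
def firstComm (b y : Λ → E d → ℂ) : Λ → E d → ℂ :=
  comm c S b (homSol ι m β ρ S y) - nonresPart ι β ρ S y

/-- Iterated commutators with `ψ`. -/
def iterComm (ψ a : Λ → E d → ℂ) (j : ℕ) : Λ → E d → ℂ := (fun u => comm c S u ψ)^[j] a

/-- The terms of the conjugated operator `e^{-iΨ} H e^{iΨ}` up to degree `N + 1` in `Ψ`, without
`H₀` and with `nonresPart y` added back, where `ψ = homSol y`. -/
def gaugeStep (N : ℕ) (b y : Λ → E d → ℂ) : Λ → E d → ℂ :=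
  b + comm c S b (homSol ι m β ρ S y) + ∑ j ∈ Finset.range N, (((j + 2).factorial : ℝ)⁻¹) •
    iterComm c S (homSol ι m β ρ S y) (firstComm ι m β ρ c S b y) (j + 1)

/-- The iterates of `gaugeStep`, starting from zero. -/
def gaugeIter (N : ℕ) (b : Λ → E d → ℂ) (n : ℕ) : Λ → E d → ℂ :=
  (gaugeStep ι m β ρ c S N b)^[n] 0

variable {ι m β ρ c S}

lemma iterComm_succ (ψ a : Λ → E d → ℂ) (j : ℕ) :
    iterComm c S ψ a (j + 1) = comm c S (iterComm c S ψ a j) ψ :=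
  Function.iterate_succ_apply' _ _ _

lemma gaugeIter_succ (N : ℕ) (b : Λ → E d → ℂ) (n : ℕ) :
    gaugeIter ι m β ρ c S N b (n + 1) =
      gaugeStep ι m β ρ c S N b (gaugeIter ι m β ρ c S N b n) :=
  Function.iterate_succ_apply' _ _ _

lemma homSol_sub (y y' : Λ → E d → ℂ) :
    homSol ι m β ρ S (y - y') = homSol ι m β ρ S y - homSol ι m β ρ S y' := by
  funext θ ξ; simp only [homSol, Pi.sub_apply]; ring

lemma nonresPart_sub (y y' : Λ → E d → ℂ) :
    nonresPart ι β ρ S (y - y') = nonresPart ι β ρ S y - nonresPart ι β ρ S y' := by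
  funext θ ξ; simp only [nonresPart, Pi.sub_apply]; ring

lemma gaugeStep_sub (N : ℕ) (b y y' : Λ → E d → ℂ) :
    gaugeStep ι m β ρ c S N b y - gaugeStep ι m β ρ c S N b y' =
      comm c S b (homSol ι m β ρ S y) - comm c S b (homSol ι m β ρ S y') +
      ∑ j ∈ Finset.range N, (((j + 2).factorial : ℝ)⁻¹) •
        (iterComm c S (homSol ι m β ρ S y) (firstComm ι m β ρ c S b y) (j + 1) -
          iterComm c S (homSol ι m β ρ S y') (firstComm ι m β ρ c S b y') (j + 1)) := by
  simp only [gaugeStep, smul_sub, Finset.sum_sub_distrib]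
  abel

lemma SymmFam.nonresPart {y : Λ → E d → ℂ} (hy : SymmFam y) (hS : ∀ φ, -φ ∈ S ↔ φ ∈ S) :
    SymmFam (nonresPart ι β ρ S y) := fun θ ξ => by
  unfold PeriodicPDO.nonresPart
  rw [map_mul, Complex.conj_ofReal, ← hy θ ξ]
  by_cases h : θ ∈ S
  · rw [if_pos h, if_pos ((hS θ).2 h)]
    simp only [nonresCut, Submodule.coe_neg, shellCut_symm]
  · rw [if_neg h, if_neg (mt (hS θ).1 h)]

lemma SymmFam.resPart {y : Λ → E d → ℂ} (hy : SymmFam y) (hS : ∀ φ, -φ ∈ S ↔ φ ∈ S) :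
    SymmFam (resPart ι β ρ S y) := fun θ ξ => by
  unfold PeriodicPDO.resPart
  rw [map_mul, Complex.conj_ofReal, ← hy θ ξ]
  by_cases h : θ ∈ S
  · rw [if_pos h, if_pos ((hS θ).2 h)]
    simp only [resCut, Submodule.coe_neg, shellCut_symm]
  · rw [if_neg h, if_neg (mt (hS θ).1 h)]

lemma SymmFam.homSol {y : Λ → E d → ℂ} (hy : SymmFam y) (hS : ∀ φ, -φ ∈ S ↔ φ ∈ S) :
    SymmFam (homSol ι m β ρ S y) := fun θ ξ => by
  unfold PeriodicPDO.homSol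
  rw [map_mul, map_mul, Complex.conj_ofReal, ← hy θ ξ, Complex.conj_I]
  by_cases h : θ ∈ S
  · rw [if_pos h, if_pos ((hS θ).2 h)]
    have e : kinDiff m (-(θ : E d)) (ξ + θ) = -kinDiff m (θ : E d) ξ := by
      simp only [kinDiff, add_neg_cancel_right, neg_sub]
    simp only [homMult, nonresCut, Submodule.coe_neg, shellCut_symm, e, div_neg, Complex.ofReal_neg]
    ring
  · rw [if_neg h, if_neg (mt (hS θ).1 h)]
    simp

lemma SymmFam.iterComm {ψ a : Λ → E d → ℂ} (hψ : SymmFam ψ) (ha : SymmFam a)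
    (hS : ∀ φ, -φ ∈ S ↔ φ ∈ S) (j : ℕ) : SymmFam (iterComm c S ψ a j) := by
  induction j with
  | zero => exact ha
  | succ j ih => rw [iterComm_succ]; exact ih.comm c S hψ fun φ => (hS φ).2

lemma SymmFam.sum {s : Finset ℕ} {f : ℕ → Λ → E d → ℂ} (hf : ∀ j ∈ s, SymmFam (f j)) :
    SymmFam (∑ j ∈ s, f j) :=
  Finset.sum_induction f SymmFam (fun _ _ => SymmFam.add) SymmFam.zero hf

lemma SymmFam.firstComm {b y : Λ → E d → ℂ} (hb : SymmFam b) (hy : SymmFam y)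
    (hS : ∀ φ, -φ ∈ S ↔ φ ∈ S) : SymmFam (firstComm ι m β ρ c S b y) :=
  (hb.comm c S (hy.homSol hS) fun φ => (hS φ).2).sub (hy.nonresPart hS)

lemma SymmFam.gaugeStep {b y : Λ → E d → ℂ} (hb : SymmFam b) (hy : SymmFam y)
    (hS : ∀ φ, -φ ∈ S ↔ φ ∈ S) (N : ℕ) : SymmFam (gaugeStep ι m β ρ c S N b y) :=
  (hb.add (hb.comm c S (hy.homSol hS) fun φ => (hS φ).2)).add <| SymmFam.sum fun j _ =>
    ((hy.homSol hS).iterComm (hb.firstComm hy hS) hS (j + 1)).smul _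

lemma SymmFam.gaugeIter {b : Λ → E d → ℂ} (hb : SymmFam b) (hS : ∀ φ, -φ ∈ S ↔ φ ∈ S) (N n : ℕ) :
    SymmFam (gaugeIter ι m β ρ c S N b n) := by
  induction n with
  | zero => exact SymmFam.zero
  | succ n ih => rw [gaugeIter_succ]; exact hb.gaugeStep ih hS N

end Maps

variable [DiscreteTopology Λ]

variable (Λ) in
open Classical in
/-- The set `Θ_r` inside the lattice `Λ`. -/
def thetaFinset (r : ℝ) : Finset Λ := (finite_lattice_ball Λ r).toFinset.filter fun θ => θ ≠ 0

lemma mem_thetaFinset {r : ℝ} {θ : Λ} : θ ∈ thetaFinset Λ r ↔ ‖(θ : E d)‖ ≤ r ∧ θ ≠ 0 := by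
  simp [thetaFinset]

lemma neg_mem_thetaFinset {r : ℝ} (θ : Λ) : -θ ∈ thetaFinset Λ r ↔ θ ∈ thetaFinset Λ r := by
  simp [mem_thetaFinset]

variable (Λ) in
/-- The data over which the estimates of the gauge transform are uniform: the energy `ρ`, the
radius `r`, and a symmetric family `b` of order `α` with its seminorms `nb q`, bounded by `K q`. -/
structure GaugeData (β α : ℝ) (K : ℕ → ℝ) where
  ρ : ℝ
  r : ℝ
  b : Λ → E d → ℂ
  nb : ℕ → ℝ
  one_le_ρ : 1 ≤ ρ
  r_le : r ≤ ρ
  smooth : SmoothFam b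
  symm : SymmFam b
  bound : ∀ q, FamBound β α q b (nb q)
  mono : Monotone nb
  nonneg : ∀ q, 0 ≤ nb q
  nb_le : ∀ q, nb q ≤ K q

variable {β α : ℝ} {K : ℕ → ℝ}

/-- A family depending on the data is of order `γ`, of size `ρ ^ (β e)`, and of degree at least
`n + 1` in `b`, uniformly in the data. -/
structure HasOrder (γ e : ℝ) (n : ℕ) (A : GaugeData Λ β α K → Λ → E d → ℂ) : Prop where
  smooth : ∀ i, SmoothFam (A i)
  bound : ∀ q, ∃ (C : ℝ) (q' : ℕ), 0 ≤ C ∧ ∀ i, FamBound β γ q (A i)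
    (C * (i.ρ ^ β) ^ e * i.nb q' ^ (n + 1))

namespace GaugeData

variable (i : GaugeData Λ β α K)

/-- The set `Θ_r` of the data. -/
def S : Finset Λ := thetaFinset Λ i.r

lemma ρ_pos : 0 < i.ρ := by linarith [i.one_le_ρ]

lemma ρβ_pos : 0 < i.ρ ^ β := Real.rpow_pos_of_pos i.ρ_pos β

lemma one_le_ρβ (hβ : 0 < β) : 1 ≤ i.ρ ^ β := Real.one_le_rpow i.one_le_ρ hβ.le

end GaugeData

namespace HasOrder

variable {γ γ' e e' : ℝ} {n n' : ℕ} {A B : GaugeData Λ β α K → Λ → E d → ℂ}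

lemma add (hA : HasOrder γ e n A) (hB : HasOrder γ e n B) :
    HasOrder γ e n fun i => A i + B i where
  smooth i := (hA.smooth i).add (hB.smooth i)
  bound q := by
    obtain ⟨C₁, q₁, h1, hC₁⟩ := hA.bound q
    obtain ⟨C₂, q₂, h2, hC₂⟩ := hB.bound q
    refine ⟨C₁ + C₂, max q₁ q₂, by positivity, fun i => ?_⟩
    refine (FamBound.add (hA.smooth i) (hB.smooth i) (hC₁ i) (hC₂ i)).mono ?_
    have hr := Real.rpow_pos_of_pos i.ρβ_pos e
    have m1 := i.mono (le_max_left q₁ q₂)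
    have m2 := i.mono (le_max_right q₁ q₂)
    have n1 := i.nonneg q₁
    have n2 := i.nonneg q₂
    rw [add_mul, add_mul]
    gcongr

lemma smul (c : ℝ) (hA : HasOrder γ e n A) : HasOrder γ e n fun i => c • A i where
  smooth i := (hA.smooth i).smul c
  bound q := by
    obtain ⟨C, q', h, hC⟩ := hA.bound q
    refine ⟨|c| * C, q', by positivity, fun i => ?_⟩
    have := FamBound.smul c (hA.smooth i) (hC i)
    rwa [← mul_assoc, ← mul_assoc] at this

lemma sub (hA : HasOrder γ e n A) (hB : HasOrder γ e n B) :
    HasOrder γ e n fun i => A i - B i := by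
  have h := hA.add (hB.smul (-1))
  have e : (fun i => A i + (-1 : ℝ) • B i) = fun i => A i - B i := by
    funext i; rw [neg_smul, one_smul, sub_eq_add_neg]
  rwa [e] at h

lemma zero : HasOrder γ e n fun _ : GaugeData Λ β α K => (0 : Λ → E d → ℂ) where
  smooth _ := SmoothFam.zero
  bound q := ⟨0, 0, le_rfl, fun i => by simpa using FamBound.zero⟩

lemma sum {s : Finset ℕ} {f : ℕ → GaugeData Λ β α K → Λ → E d → ℂ}
    (hf : ∀ j ∈ s, HasOrder γ e n (f j)) : HasOrder γ e n fun i => ∑ j ∈ s, f j i := by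
  classical
  induction s using Finset.induction_on with
  | empty => simpa using zero
  | insert j s hj ih =>
    simp only [Finset.sum_insert hj]
    exact (hf j (Finset.mem_insert_self j s)).add
      (ih fun k hk => hf k (Finset.mem_insert_of_mem hk))

/-- Surplus powers of `b` are absorbed by the bounds `K`, surplus negative powers of `ρ` by `1`. -/
lemma mono (hβ : 0 < β) (hA : HasOrder γ e' n' A) (he : e' ≤ e) (hn : n ≤ n') :
    HasOrder γ e n A where
  smooth := hA.smooth
  bound q := by
    obtain ⟨C, q', h, hC⟩ := hA.bound q
    refine ⟨C * (|K q'|) ^ (n' - n), q', by positivity, fun i => (hC i).mono ?_⟩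
    have h1 : (i.ρ ^ β) ^ e' ≤ (i.ρ ^ β) ^ e :=
      Real.rpow_le_rpow_of_exponent_le (i.one_le_ρβ hβ) he
    have h2 : i.nb q' ≤ |K q'| := (i.nb_le q').trans (le_abs_self _)
    have h0 := i.nonneg q'
    have hr := Real.rpow_pos_of_pos i.ρβ_pos e
    have e1 : n' + 1 = (n' - n) + (n + 1) := by omega
    rw [e1, pow_add]
    calc C * (i.ρ ^ β) ^ e' * (i.nb q' ^ (n' - n) * i.nb q' ^ (n + 1))
        ≤ C * (i.ρ ^ β) ^ e * (|K q'| ^ (n' - n) * i.nb q' ^ (n + 1)) := by gcongr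
      _ = _ := by ring

lemma base : HasOrder α 0 0 fun i : GaugeData Λ β α K => i.b where
  smooth i := i.smooth
  bound q := ⟨1, q, by norm_num, fun i => by simpa using i.bound q⟩

/-- Commutators: the orders add up with the gain of one, the degrees in `b` add up. -/
lemma of_comm (c : ℝ) (hβ : 0 < β) (hβ1 : β ≤ 1) (hA : HasOrder γ e n A) (hB : HasOrder γ' e' n' B) :
    HasOrder (γ + γ' - 1) (e + e') (n + n' + 1) fun i => comm c i.S (A i) (B i) where
  smooth i := (hA.smooth i).comm c i.S (hB.smooth i)
  bound q := by
    obtain ⟨C, q', hC0, hC⟩ := FamBound.comm (Λ := Λ) c hβ hβ1 γ γ' q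
    obtain ⟨C₁, q₁, h1, hC₁⟩ := hA.bound q'
    obtain ⟨C₂, q₂, h2, hC₂⟩ := hB.bound q'
    refine ⟨C * C₁ * C₂, max q₁ q₂, by positivity, fun i => ?_⟩
    have n1 := i.nonneg q₁
    have n2 := i.nonneg q₂
    have hr := Real.rpow_pos_of_pos i.ρβ_pos e
    have hr' := Real.rpow_pos_of_pos i.ρβ_pos e'
    refine (hC i.S (A i) (B i) _ _ (by positivity) (by positivity) (hA.smooth i) (hB.smooth i)
      (hC₁ i) (hC₂ i)).mono ?_
    have m1 := i.mono (le_max_left q₁ q₂)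
    have m2 := i.mono (le_max_right q₁ q₂)
    have e1 : n + n' + 1 + 1 = (n + 1) + (n' + 1) := by ring
    have n3 := i.nonneg (max q₁ q₂)
    rw [e1, pow_add (i.nb (max q₁ q₂)), Real.rpow_add i.ρβ_pos]
    calc _ = C * C₁ * C₂ * ((i.ρ ^ β) ^ e * (i.ρ ^ β) ^ e') *
          (i.nb q₁ ^ (n + 1) * i.nb q₂ ^ (n' + 1)) := by ring
      _ ≤ _ := by gcongr

variable {ι : ℝ → ℝ} {m : ℝ}

/-- Since `nonresCut` is supported in `|ξ| ∼ ρ`, the order can be changed at the price of a power of `ρ^β`. -/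
lemma of_nonresPart (hι : IsCutoff ι) (hβ : 0 < β) (hβ1 : β ≤ 1) (hA : HasOrder γ e n A) (κ : ℝ) :
    HasOrder (γ + κ) (e - κ) n fun i => nonresPart ι β i.ρ i.S (A i) where
  smooth i θ := by
    have hsm : ContDiff ℝ ∞ (if θ ∈ i.S then nonresCut ι β i.ρ (θ : E d) else fun _ => 0) := by
      split_ifs
      · exact contDiff_nonresCut hι i.ρ_pos _
      · exact contDiff_const
    exact (Complex.ofRealCLM.contDiff.comp hsm).mul (hA.smooth i θ)
  bound q := by
    obtain ⟨C, hC0, hC⟩ := exists_multBound_nonresCut (d := d) hι hβ hβ1 κ q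
    obtain ⟨C₁, q₁, h1, hC₁⟩ := hA.bound q
    refine ⟨2 ^ q * C * C₁, q₁, by positivity, fun i => ?_⟩
    have hr := Real.rpow_pos_of_pos i.ρβ_pos (-κ)
    refine (FamBound.mul (κ := κ) (C := C * (i.ρ ^ β) ^ (-κ)) (by positivity) (hA.smooth i)
      (fun θ => ?_) (hC₁ i) (fun θ => ?_)).mono (le_of_eq ?_)
    · split_ifs
      · exact contDiff_nonresCut hι i.ρ_pos _
      · exact contDiff_const
    · split_ifs with h
      · exact hC i.ρ θ i.one_le_ρ ((mem_thetaFinset.1 h).1.trans i.r_le)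
      · exact MultBound.zero (by positivity)
    · rw [sub_eq_add_neg e κ, Real.rpow_add i.ρβ_pos]; ring

lemma of_resPart (hι : IsCutoff ι) (hβ : 0 < β) (hβ1 : β ≤ 1) (hA : HasOrder γ e n A) :
    HasOrder γ e n fun i => resPart ι β i.ρ i.S (A i) where
  smooth i θ := by
    have hsm : ContDiff ℝ ∞ (if θ ∈ i.S then resCut ι β i.ρ (θ : E d) else fun _ => 1) := by
      split_ifs
      · exact contDiff_resCut hι i.ρ_pos _
      · exact contDiff_const
    exact (Complex.ofRealCLM.contDiff.comp hsm).mul (hA.smooth i θ)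
  bound q := by
    obtain ⟨C, hC0, hC⟩ := exists_multBound_resCut (d := d) hι hβ hβ1 q
    obtain ⟨C₁, q₁, h1, hC₁⟩ := hA.bound q
    refine ⟨2 ^ q * C * C₁, q₁, by positivity, fun i => ?_⟩
    have h := FamBound.mul (κ := 0) (C := C) (by positivity) (hA.smooth i)
      (μ := fun θ => if θ ∈ i.S then resCut ι β i.ρ (θ : E d) else fun _ => 1)
      (fun θ => ?_) (hC₁ i) (fun θ => ?_)
    · rw [add_zero] at h
      exact h.mono (le_of_eq (by ring))
    · split_ifs
      · exact contDiff_resCut hι i.ρ_pos _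
      · exact contDiff_const
    · split_ifs with h
      · exact hC i.ρ θ i.one_le_ρ ((mem_thetaFinset.1 h).1.trans i.r_le)
      · exact MultBound.one hC0

/-- The solution of the homological equation belongs to all classes; the denominator `ρ^{2m-2+β}` accounts
for the exponent `σ`. -/
lemma of_homSol (hι : IsCutoff ι) (hm : 0 < m) (hβ : 0 < β) (hβ1 : β ≤ 1) (hA : HasOrder α e n A)
    (γ : ℝ) : HasOrder γ (e + (sigma m α β - γ)) n fun i => homSol ι m β i.ρ i.S (A i) := by
  have hsm : ∀ (i : GaugeData Λ β α K) (θ : Λ), ContDiff ℝ ∞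
      (if θ ∈ i.S then homMult ι m β i.ρ (θ : E d) else fun _ => 0) := fun i θ => by
    split_ifs with h
    · obtain ⟨h1, h2⟩ := mem_thetaFinset.1 h
      exact contDiff_homMult hι hm i.one_le_ρ (h1.trans i.r_le) (by simpa using h2)
    · exact contDiff_const
  have hsm2 : ∀ i : GaugeData Λ β α K, SmoothFam fun (θ : Λ) ξ =>
      (((if θ ∈ i.S then homMult ι m β i.ρ (θ : E d) else fun _ => 0) ξ : ℝ) : ℂ) * A i θ ξ :=
    fun i θ => (Complex.ofRealCLM.contDiff.comp (hsm i θ)).mul (hA.smooth i θ)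
  refine ⟨fun i θ => contDiff_const.mul (hsm2 i θ), fun q => ?_⟩
  obtain ⟨c₀, hc₀, hlow⟩ := exists_norm_lower_bound Λ
  obtain ⟨C, hC0, hC⟩ := exists_multBound_homMult (d := d) hι hm hβ hβ1 hc₀ (γ - α) q
  obtain ⟨C₁, q₁, h1, hC₁⟩ := hA.bound q
  refine ⟨2 ^ q * C * C₁, q₁, by positivity, fun i => ?_⟩
  have hr := Real.rpow_pos_of_pos i.ρβ_pos (-(γ - α))
  have hr' := Real.rpow_pos_of_pos i.ρ_pos (-(2 * m - 2 + β))
  have h := FamBound.mul (κ := γ - α)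
    (C := C * i.ρ ^ (-(2 * m - 2 + β)) * (i.ρ ^ β) ^ (-(γ - α)))
    (by positivity) (hA.smooth i) (hsm i) (hC₁ i) (fun θ => by
      split_ifs with h
      · obtain ⟨h1, h2⟩ := mem_thetaFinset.1 h
        exact hC i.ρ θ i.one_le_ρ (h1.trans i.r_le) (hlow θ h2)
      · exact MultBound.zero (by positivity))
  rw [add_sub_cancel] at h
  refine (FamBound.I_mul (hsm2 i) h).mono (le_of_eq ?_)
  have e1 : i.ρ ^ (-(2 * m - 2 + β)) * (i.ρ ^ β) ^ (-(γ - α)) = (i.ρ ^ β) ^ (sigma m α β - γ) := by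
    rw [← Real.rpow_mul i.ρ_pos.le, ← Real.rpow_mul i.ρ_pos.le, ← Real.rpow_add i.ρ_pos]
    congr 1
    unfold sigma
    field_simp
    ring
  rw [Real.rpow_add i.ρβ_pos, ← e1]
  ring

end HasOrder

variable {ι : ℝ → ℝ} {m c : ℝ}

/-- Commutators with `homSol Y` gain `ρ^{β(σ-1)}` and raise the degree in `b`. -/
lemma HasOrder.of_comm_homSol (hι : IsCutoff ι) (hm : 0 < m) (hβ : 0 < β) (hβ1 : β ≤ 1)
    {U Y : GaugeData Λ β α K → Λ → E d → ℂ} {e e' : ℝ} {n n' : ℕ}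
    (hU : HasOrder α e n U) (hY : HasOrder α e' n' Y) (γ : ℝ) :
    HasOrder γ (e + e' + (sigma m α β - 1) + (α - γ)) (n + n' + 1)
      fun i => comm c i.S (U i) (homSol ι m β i.ρ i.S (Y i)) := by
  have h := HasOrder.of_comm c hβ hβ1 hU (HasOrder.of_homSol hι hm hβ hβ1 hY (γ + 1 - α))
  have e1 : α + (γ + 1 - α) - 1 = γ := by ring
  have e2 : e + (e' + (sigma m α β - (γ + 1 - α))) = e + e' + (sigma m α β - 1) + (α - γ) := by ring
  rwa [e1, e2] at h

variable (hι : IsCutoff ι) (hm : 0 < m) (hβ : 0 < β) (hβ1 : β ≤ 1) (hσ : sigma m α β < 1)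
include hι hm hβ hβ1 hσ

lemma HasOrder.of_iterComm_homSol {U Y : GaugeData Λ β α K → Λ → E d → ℂ} (hU : HasOrder α 0 0 U)
    (hY : HasOrder α 0 0 Y) (j : ℕ) :
    HasOrder α (j * (sigma m α β - 1)) j
      fun i => iterComm c i.S (homSol ι m β i.ρ i.S (Y i)) (U i) j := by
  induction j with
  | zero => simpa [iterComm] using hU
  | succ j ih =>
    simp only [iterComm_succ]
    have h := ih.of_comm_homSol (c := c) hι hm hβ hβ1 hY α
    refine h.mono hβ (le_of_eq ?_) (by omega)
    push_cast; ring

lemma HasOrder.of_firstComm {Y : GaugeData Λ β α K → Λ → E d → ℂ} (hY : HasOrder α 0 0 Y) (γ : ℝ) :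
    HasOrder γ (α - γ) 0 fun i => firstComm ι m β i.ρ c i.S i.b (Y i) := by
  have h1 := (HasOrder.base (Λ := Λ) (β := β) (α := α) (K := K)).of_comm_homSol (c := c) hι hm hβ hβ1
    hY γ
  have h2 := HasOrder.of_nonresPart hι hβ hβ1 hY (γ - α)
  rw [add_sub_cancel] at h2
  exact (h1.mono hβ (by linarith) (Nat.zero_le _)).sub (h2.mono hβ (by linarith) le_rfl)

lemma HasOrder.of_gaugeStep {Y : GaugeData Λ β α K → Λ → E d → ℂ} (hY : HasOrder α 0 0 Y) (N : ℕ) :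
    HasOrder α 0 0 fun i => gaugeStep ι m β i.ρ c i.S N i.b (Y i) := by
  have h1 := HasOrder.base.of_comm_homSol (c := c) hι hm hβ hβ1 hY α
  have h2 := HasOrder.of_firstComm (c := c) hι hm hβ hβ1 hσ hY α
  rw [sub_self] at h2
  refine (HasOrder.base.add (h1.mono hβ (by linarith) (Nat.zero_le _))).add
    (HasOrder.sum fun j _ => HasOrder.smul _ ?_)
  refine (HasOrder.of_iterComm_homSol (c := c) hι hm hβ hβ1 hσ h2 hY (j + 1)).mono hβ ?_
    (Nat.zero_le _)
  have : (0 : ℝ) ≤ ((j + 1 : ℕ) : ℝ) := Nat.cast_nonneg _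
  nlinarith

/-- All iterates are of the size of `b`. -/
lemma HasOrder.of_gaugeIter (N n : ℕ) :
    HasOrder α 0 0 fun i : GaugeData Λ β α K => gaugeIter ι m β i.ρ c i.S N i.b n := by
  induction n with
  | zero => exact HasOrder.zero
  | succ n ih =>
    simp only [gaugeIter_succ]
    exact ih.of_gaugeStep hι hm hβ hβ1 hσ N

/-- Commutators with `homSol` turn a difference of degree `k` into one of degree `k + 1`. -/
lemma HasOrder.of_comm_homSol_sub {U U' Y Y' : GaugeData Λ β α K → Λ → E d → ℂ} {k : ℕ}
    (hU' : HasOrder α 0 0 U') (hY : HasOrder α 0 0 Y)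
    (hUU : HasOrder α (k * (sigma m α β - 1)) k fun i => U i - U' i)
    (hYY : HasOrder α (k * (sigma m α β - 1)) k fun i => Y i - Y' i) :
    HasOrder α ((k + 1 : ℕ) * (sigma m α β - 1)) (k + 1) fun i =>
      comm c i.S (U i) (homSol ι m β i.ρ i.S (Y i)) -
        comm c i.S (U' i) (homSol ι m β i.ρ i.S (Y' i)) := by
  have h1 := hUU.of_comm_homSol (c := c) hι hm hβ hβ1 hY α
  have h2 := hU'.of_comm_homSol (c := c) hι hm hβ hβ1 hYY α
  have h := (h1.mono hβ (e := (k + 1 : ℕ) * (sigma m α β - 1)) (n := k + 1)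
    (le_of_eq (by push_cast; ring)) (by omega)).add
    (h2.mono hβ (e := (k + 1 : ℕ) * (sigma m α β - 1)) (n := k + 1)
    (le_of_eq (by push_cast; ring)) (by omega))
  convert h using 2 with i
  rw [homSol_sub, comm_sub_left, comm_sub_right]
  abel

/-- The same for iterated commutators: the additional ones do not spoil the bound, as `σ < 1`. -/
lemma HasOrder.of_iterComm_sub {U U' Y Y' : GaugeData Λ β α K → Λ → E d → ℂ} {k : ℕ}
    (hU' : HasOrder α 0 0 U') (hY : HasOrder α 0 0 Y) (hY' : HasOrder α 0 0 Y')
    (hUU : HasOrder α (k * (sigma m α β - 1)) k fun i => U i - U' i)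
    (hYY : HasOrder α (k * (sigma m α β - 1)) k fun i => Y i - Y' i) (j : ℕ) :
    HasOrder α ((k + 1 : ℕ) * (sigma m α β - 1)) (k + 1) fun i =>
      iterComm c i.S (homSol ι m β i.ρ i.S (Y i)) (U i) (j + 1) -
        iterComm c i.S (homSol ι m β i.ρ i.S (Y' i)) (U' i) (j + 1) := by
  have hdrop : ∀ {A : GaugeData Λ β α K → Λ → E d → ℂ},
      HasOrder α ((k + 1 : ℕ) * (sigma m α β - 1)) (k + 1) A →
      HasOrder α (k * (sigma m α β - 1)) k A := fun h =>
    h.mono hβ (by push_cast; nlinarith) (Nat.le_succ k)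
  induction j with
  | zero =>
    simp only [iterComm_succ]
    exact HasOrder.of_comm_homSol_sub hι hm hβ hβ1 hσ hU' hY hUU hYY
  | succ j ih =>
    simp only [iterComm_succ _ _ (j + 1)]
    refine HasOrder.of_comm_homSol_sub hι hm hβ hβ1 hσ ?_ hY (hdrop ih) hYY
    refine (HasOrder.of_iterComm_homSol (c := c) hι hm hβ hβ1 hσ hU' hY' (j + 1)).mono hβ ?_
      (Nat.zero_le _)
    have : (0 : ℝ) ≤ ((j + 1 : ℕ) : ℝ) := Nat.cast_nonneg _
    nlinarith

/-- The iteration converges: each step improves the difference of successive iterates by one degree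
in `b` and the factor `ρ^{β(σ-1)}`. -/
lemma HasOrder.of_gaugeIter_sub (N n : ℕ) :
    HasOrder α (n * (sigma m α β - 1)) n fun i : GaugeData Λ β α K =>
      gaugeIter ι m β i.ρ c i.S N i.b (n + 1) - gaugeIter ι m β i.ρ c i.S N i.b n := by
  induction n with
  | zero =>
    have h := HasOrder.of_gaugeIter (Λ := Λ) (α := α) (K := K) (c := c) hι hm hβ hβ1 hσ N 1
    simpa [PeriodicPDO.gaugeIter] using h
  | succ n ih =>
    have hY := HasOrder.of_gaugeIter (Λ := Λ) (α := α) (K := K) (c := c) hι hm hβ hβ1 hσ N (n + 1)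
    have hY' := HasOrder.of_gaugeIter (Λ := Λ) (α := α) (K := K) (c := c) hι hm hβ hβ1 hσ N n
    have hb := HasOrder.base (Λ := Λ) (β := β) (α := α) (K := K)
    have hbb : HasOrder α (n * (sigma m α β - 1)) n
        fun i : GaugeData Λ β α K => i.b - i.b := by
      simpa using HasOrder.zero
    have h1 := HasOrder.of_comm_homSol_sub (c := c) hι hm hβ hβ1 hσ hb hY hbb ih
    have hnr := HasOrder.of_nonresPart hι hβ hβ1 ih 0
    rw [add_zero, sub_zero] at hnr
    have hU : HasOrder α (n * (sigma m α β - 1)) n fun i : GaugeData Λ β α K =>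
        PeriodicPDO.firstComm ι m β i.ρ c i.S i.b (PeriodicPDO.gaugeIter ι m β i.ρ c i.S N i.b (n + 1)) -
          PeriodicPDO.firstComm ι m β i.ρ c i.S i.b (PeriodicPDO.gaugeIter ι m β i.ρ c i.S N i.b n) := by
      have h := (h1.mono hβ (e := n * (sigma m α β - 1)) (n := n) (by push_cast; nlinarith)
        (Nat.le_succ n)).sub hnr
      convert h using 2 with i
      rw [nonresPart_sub]
      unfold PeriodicPDO.firstComm
      abel
    have hU' := HasOrder.of_firstComm (c := c) hι hm hβ hβ1 hσ hY' α
    rw [sub_self] at hU'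
    have hs := HasOrder.sum (s := Finset.range N) fun j _ =>
      HasOrder.smul (((j + 2).factorial : ℝ)⁻¹)
        (HasOrder.of_iterComm_sub (c := c) hι hm hβ hβ1 hσ hU' hY hY' hU ih j)
    convert h1.add hs using 2 with i
    exact (congrArg₂ _ (gaugeIter_succ N i.b (n + 1)) (gaugeIter_succ N i.b n)).trans
      (gaugeStep_sub _ _ _ _)

end Iteration

end

end PeriodicPDO

namespace PeriodicPDO

noncomputable section

/-! ### Bounded operators with given Fourier coefficients -/

section Elementary

variable {d : ℕ}

/-- Bounded continuous functions of the frequency. -/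
structure BddCont (f : E d → ℂ) : Prop where
  cont : Continuous f
  bdd : ∃ C, ∀ ξ, ‖f ξ‖ ≤ C

lemma BddCont.memLp {f : E d → ℂ} (hf : BddCont f) : MemLp f ∞ (volume : Measure (E d)) := by
  obtain ⟨C, hC⟩ := hf.bdd
  exact memLp_top_of_bound hf.cont.aestronglyMeasurable C (Eventually.of_forall hC)

lemma BddCont.mul {f g : E d → ℂ} (hf : BddCont f) (hg : BddCont g) :
    BddCont fun ξ => f ξ * g ξ := by
  obtain ⟨C, hC⟩ := hf.bdd
  obtain ⟨D, hD⟩ := hg.bdd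
  refine ⟨hf.cont.mul hg.cont, C * D, fun ξ => ?_⟩
  rw [norm_mul]
  exact mul_le_mul (hC ξ) (hD ξ) (norm_nonneg _) ((norm_nonneg _).trans (hC ξ))

lemma BddCont.comp {f : E d → ℂ} (hf : BddCont f) {g : E d → E d} (hg : Continuous g) :
    BddCont fun ξ => f (g ξ) :=
  ⟨hf.cont.comp hg, hf.bdd.imp fun _ h ξ => h (g ξ)⟩

lemma BddCont.conj {f : E d → ℂ} (hf : BddCont f) : BddCont fun ξ => conj (f ξ) :=
  ⟨Complex.continuous_conj.comp hf.cont, hf.bdd.imp fun _ h ξ => by simpa using h ξ⟩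

open Classical in
/-- Multiplication by a bounded function (zero if the function is not bounded). -/
def mulOp (f : E d → ℂ) : L2 d →L[ℂ] L2 d :=
  if h : MemLp f ∞ (volume : Measure (E d)) then
    (ContinuousLinearMap.mul ℂ ℂ).holderL volume ∞ 2 2 (h.toLp f)
  else 0

lemma coeFn_mulOp {f : E d → ℂ} (hf : BddCont f) (u : L2 d) :
    mulOp f u =ᵐ[volume] fun η => f η * u η := by
  unfold mulOp
  rw [dif_pos hf.memLp]
  filter_upwards [(ContinuousLinearMap.mul ℂ ℂ).coeFn_holder (r := 2) (hf.memLp.toLp f) u,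
    hf.memLp.coeFn_toLp] with η h1 h2
  rw [← h2]
  exact h1

/-- The translation by `v / 2π` in `L²`. -/
def shiftOp (v : E d) : L2 d →L[ℂ] L2 d :=
  (Lp.compMeasurePreservingₗᵢ ℂ (fun η : E d => η - (2 * Real.pi)⁻¹ • v)
    (measurePreserving_sub_right volume _)).toContinuousLinearMap

lemma coeFn_shiftOp (v : E d) (u : L2 d) :
    shiftOp v u =ᵐ[volume] fun η => u (η - (2 * Real.pi)⁻¹ • v) :=
  Lp.coeFn_compMeasurePreserving u (measurePreserving_sub_right volume ((2 * Real.pi)⁻¹ • v))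

lemma norm_shiftOp_apply (v : E d) (u : L2 d) : ‖shiftOp v u‖ = ‖u‖ :=
  LinearIsometry.norm_map _ _

/-- The operator which, on the Fourier side and in the frequency variable `ξ = 2π η`, multiplies by
`f` and then translates by `v`. -/
def elemOp (v : E d) (f : E d → ℂ) : L2 d →L[ℂ] L2 d :=
  shiftOp v ∘L mulOp fun η => f ((2 * Real.pi) • η)

lemma ae_comp_sub {p : E d → Prop} (h : ∀ᵐ η, p η) (w : E d) : ∀ᵐ η : E d, p (η - w) :=
  (measurePreserving_sub_right volume w).quasiMeasurePreserving.ae h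

lemma two_pi_smul_sub (v η : E d) :
    (2 * Real.pi) • (η - (2 * Real.pi)⁻¹ • v) = (2 * Real.pi) • η - v := by
  rw [smul_sub, smul_smul, mul_inv_cancel₀ Real.two_pi_pos.ne', one_smul]

lemma BddCont.scale {f : E d → ℂ} (hf : BddCont f) : BddCont fun η => f ((2 * Real.pi) • η) :=
  hf.comp (by fun_prop)

lemma coeFn_elemOp (v : E d) {f : E d → ℂ} (hf : BddCont f) (u : L2 d) :
    elemOp v f u =ᵐ[volume] fun η =>
      f ((2 * Real.pi) • η - v) * u (η - (2 * Real.pi)⁻¹ • v) := by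
  have h1 := coeFn_shiftOp v (mulOp (fun η => f ((2 * Real.pi) • η)) u)
  have h2 := ae_comp_sub (coeFn_mulOp hf.scale u) ((2 * Real.pi)⁻¹ • v)
  filter_upwards [h1, h2] with η h1 h2
  simp only [two_pi_smul_sub] at h2
  rw [← h2, ← h1]
  rfl

lemma norm_elemOp_apply_le (v : E d) {f : E d → ℂ} (hf : BddCont f) {C : ℝ}
    (hC : ∀ ξ, ‖f ξ‖ ≤ C) (u : L2 d) : ‖elemOp v f u‖ ≤ C * ‖u‖ := by
  unfold elemOp
  rw [ContinuousLinearMap.comp_apply, norm_shiftOp_apply]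
  refine Lp.norm_le_mul_norm_of_ae_le_mul ?_
  filter_upwards [coeFn_mulOp hf.scale u] with η h
  rw [h, norm_mul]
  exact mul_le_mul_of_nonneg_right (hC _) (norm_nonneg _)

lemma norm_elemOp_le (v : E d) {f : E d → ℂ} (hf : BddCont f) {C : ℝ}
    (hC : ∀ ξ, ‖f ξ‖ ≤ C) : ‖elemOp v f‖ ≤ C :=
  ContinuousLinearMap.opNorm_le_bound _ ((norm_nonneg _).trans (hC 0))
    (norm_elemOp_apply_le v hf hC)

lemma elemOp_mul (v w : E d) {f g : E d → ℂ} (hf : BddCont f) (hg : BddCont g) :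
    elemOp v f * elemOp w g = elemOp (v + w) fun ξ => f (ξ + w) * g ξ := by
  refine ContinuousLinearMap.ext fun u => Lp.ext ?_
  have hfg : BddCont fun ξ => f (ξ + w) * g ξ := (hf.comp (by fun_prop)).mul hg
  filter_upwards [coeFn_elemOp v hf (elemOp w g u), coeFn_elemOp (v + w) hfg u,
    ae_comp_sub (coeFn_elemOp w hg u) ((2 * Real.pi)⁻¹ • v)] with η h1 h2 h3
  rw [mul_apply_eq_comp, h1, h2, h3, two_pi_smul_sub, ← mul_assoc]
  have e1 : (2 * Real.pi) • η - (v + w) + w = (2 * Real.pi) • η - v := by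
    rw [add_comm v w, ← sub_sub, sub_right_comm, sub_add_cancel]
  have e2 : η - (2 * Real.pi)⁻¹ • (v + w) = η - (2 * Real.pi)⁻¹ • v - (2 * Real.pi)⁻¹ • w := by
    rw [smul_add, sub_sub]
  rw [e1, e2, sub_sub]

lemma elemOp_add (v : E d) {f g : E d → ℂ} (hf : BddCont f) (hg : BddCont g) :
    elemOp v (f + g) = elemOp v f + elemOp v g := by
  have hfg : BddCont (f + g) := by
    obtain ⟨C, hC⟩ := hf.bdd
    obtain ⟨D, hD⟩ := hg.bdd
    exact ⟨hf.cont.add hg.cont, C + D, fun ξ => (norm_add_le _ _).trans (add_le_add (hC ξ) (hD ξ))⟩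
  refine ContinuousLinearMap.ext fun u => Lp.ext ?_
  filter_upwards [coeFn_elemOp v hf u, coeFn_elemOp v hg u, coeFn_elemOp v hfg u,
    Lp.coeFn_add (elemOp v f u) (elemOp v g u)] with η h1 h2 h3 h4
  rw [h3, _root_.add_apply, h4, Pi.add_apply, Pi.add_apply, h1, h2, add_mul]

lemma elemOp_smul (v : E d) {f : E d → ℂ} (hf : BddCont f) (z : ℂ) :
    elemOp v (fun ξ => z * f ξ) = z • elemOp v f := by
  have hfg : BddCont fun ξ => z * f ξ :=
    BddCont.mul ⟨continuous_const, ‖z‖, fun _ => le_rfl⟩ hf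
  refine ContinuousLinearMap.ext fun u => Lp.ext ?_
  filter_upwards [coeFn_elemOp v hf u, coeFn_elemOp v hfg u,
    Lp.coeFn_smul z (elemOp v f u)] with η h1 h3 h4
  rw [h3, _root_.smul_apply, h4, Pi.smul_apply, h1, smul_eq_mul, mul_assoc]

lemma elemOp_zero (v : E d) : elemOp v (fun _ => 0) = 0 := by
  have h0 : BddCont (fun _ : E d => (0 : ℂ)) := ⟨continuous_const, 0, fun _ => by simp⟩
  simpa using elemOp_smul v h0 0

lemma elemOp_one : elemOp (0 : E d) (fun _ => 1) = 1 := by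
  have h0 : BddCont (fun _ : E d => (1 : ℂ)) := ⟨continuous_const, 1, fun _ => by simp⟩
  refine ContinuousLinearMap.ext fun u => Lp.ext ?_
  filter_upwards [coeFn_elemOp 0 h0 u] with η h
  simp [h]

/-- The adjoint shifts back, so that its coefficient is evaluated at the shifted point; this is where the
symmetry condition on symbols comes from. -/
lemma star_elemOp (v : E d) {f : E d → ℂ} (hf : BddCont f) :
    star (elemOp v f) = elemOp (-v) fun ξ => conj (f (ξ - v)) := by
  rw [ContinuousLinearMap.star_eq_adjoint, eq_comm, ContinuousLinearMap.eq_adjoint_iff]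
  intro u w
  have hg : BddCont fun ξ => conj (f (ξ - v)) :=
    (hf.comp (g := fun ξ => ξ - v) (by fun_prop)).conj
  rw [L2.inner_def, L2.inner_def]
  have e1 : ∫ η, inner ℂ (elemOp (-v) (fun ξ => conj (f (ξ - v))) u η) (w η) =
      ∫ η, inner ℂ (conj (f ((2 * Real.pi) • η)) * u (η + (2 * Real.pi)⁻¹ • v)) (w η) := by
    refine integral_congr_ae ?_
    filter_upwards [coeFn_elemOp (-v) hg u] with η h
    rw [h]
    simp only [smul_neg, sub_neg_eq_add, add_sub_cancel_right]
  have e2 : ∫ η, inner ℂ (u η) (elemOp v f w η) =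
      ∫ η, inner ℂ (u η) (f ((2 * Real.pi) • η - v) * w (η - (2 * Real.pi)⁻¹ • v)) := by
    refine integral_congr_ae ?_
    filter_upwards [coeFn_elemOp v hf w] with η h
    rw [h]
  rw [e1, e2, ← integral_sub_right_eq_self _ ((2 * Real.pi)⁻¹ • v)]
  refine integral_congr_ae (Eventually.of_forall fun η => ?_)
  simp only [two_pi_smul_sub, sub_add_cancel, RCLike.inner_apply, map_mul, Complex.conj_conj]
  ring

end Elementary

section FreqOp

variable {d : ℕ} {Λ : Submodule ℤ (E d)}

/-- Families of bounded continuous coefficients with summable sup norms. -/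
structure BddFam (a : Λ → E d → ℂ) : Prop where
  cont : ∀ θ, Continuous (a θ)
  bdd : ∃ B : Λ → ℝ, Summable B ∧ ∀ θ ξ, ‖a θ ξ‖ ≤ B θ

namespace BddFam

variable {a b : Λ → E d → ℂ}

lemma bddCont (ha : BddFam a) (θ : Λ) : BddCont (a θ) := by
  obtain ⟨B, -, hB⟩ := ha.bdd
  exact ⟨ha.cont θ, B θ, hB θ⟩

lemma add (ha : BddFam a) (hb : BddFam b) : BddFam (a + b) := by
  obtain ⟨B, hB, hB'⟩ := ha.bdd
  obtain ⟨D, hD, hD'⟩ := hb.bdd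
  exact ⟨fun θ => (ha.cont θ).add (hb.cont θ), B + D, hB.add hD, fun θ ξ =>
    (norm_add_le _ _).trans (add_le_add (hB' θ ξ) (hD' θ ξ))⟩

lemma const_mul (ha : BddFam a) (z : ℂ) : BddFam fun θ ξ => z * a θ ξ := by
  obtain ⟨B, hB, hB'⟩ := ha.bdd
  refine ⟨fun θ => continuous_const.mul (ha.cont θ), _, hB.mul_left ‖z‖, fun θ ξ => ?_⟩
  rw [norm_mul]
  exact mul_le_mul_of_nonneg_left (hB' θ ξ) (norm_nonneg _)

lemma zero : BddFam (0 : Λ → E d → ℂ) :=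
  ⟨fun _ => continuous_const, 0, summable_zero, fun _ _ => by simp⟩

lemma smul (ha : BddFam a) (r : ℝ) : BddFam (r • a) := by
  have h := ha.const_mul (r : ℂ)
  exact h

lemma sub (ha : BddFam a) (hb : BddFam b) : BddFam (a - b) := by
  have h := ha.add (hb.smul (-1))
  rwa [neg_smul, one_smul, ← sub_eq_add_neg] at h

lemma sum {κ : Type*} {s : Finset κ} {f : κ → Λ → E d → ℂ} (hf : ∀ j ∈ s, BddFam (f j)) :
    BddFam (∑ j ∈ s, f j) :=
  Finset.sum_induction f BddFam (fun _ _ => BddFam.add) BddFam.zero hf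

lemma of_finset (S : Finset Λ) (hS : ∀ θ ∉ S, a θ = 0) (h : ∀ θ, BddCont (a θ)) : BddFam a := by
  classical
  choose B hB using fun θ => (h θ).bdd
  refine ⟨fun θ => (h θ).cont, fun θ => if θ ∈ S then B θ else 0, ?_, fun θ ξ => ?_⟩
  · exact summable_of_ne_finset_zero (s := S) fun θ hθ => if_neg hθ
  · by_cases hθ : θ ∈ S
    · simpa [hθ] using hB θ ξ
    · simp [hS θ hθ, hθ]

/-- Multiplication by a single coefficient from the right. -/
lemma mul_right (ha : BddFam a) (φ : Λ) {g : E d → ℂ} (hg : BddCont g) :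
    BddFam fun (χ : Λ) ξ => a (χ - φ) (ξ + φ) * g ξ := by
  obtain ⟨B, hB, hB'⟩ := ha.bdd
  obtain ⟨C, hC⟩ := hg.bdd
  refine ⟨fun χ => ((ha.cont _).comp (by fun_prop)).mul hg.cont, fun χ => B (χ - φ) * C,
    ((Equiv.subRight φ).summable_iff.2 hB).mul_right C, fun χ ξ => ?_⟩
  rw [norm_mul]
  exact mul_le_mul (hB' _ _) (hC ξ) (norm_nonneg _) ((norm_nonneg _).trans (hB' (χ - φ) ξ))

/-- Multiplication by a single coefficient from the left. -/
lemma mul_left (ha : BddFam a) (φ : Λ) {g : E d → ℂ} (hg : BddCont g) :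
    BddFam fun (χ : Λ) ξ => g (ξ + (χ - φ : Λ)) * a (χ - φ) ξ := by
  obtain ⟨B, hB, hB'⟩ := ha.bdd
  obtain ⟨C, hC⟩ := hg.bdd
  refine ⟨fun χ => (hg.cont.comp (by fun_prop)).mul (ha.cont _), fun χ => C * B (χ - φ),
    ((Equiv.subRight φ).summable_iff.2 hB).mul_left C, fun χ ξ => ?_⟩
  rw [norm_mul]
  exact mul_le_mul (hC _) (hB' _ _) (norm_nonneg _) ((norm_nonneg _).trans (hC ξ))

lemma summable_elemOp (ha : BddFam a) : Summable fun θ : Λ => elemOp (θ : E d) (a θ) := by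
  obtain ⟨B, hB, hB'⟩ := ha.bdd
  exact Summable.of_norm_bounded hB fun θ => norm_elemOp_le _ (ha.bddCont θ) (hB' θ)

end BddFam

variable (c : ℝ)

/-- The operator with Fourier coefficients `a`, on the Fourier side; `c` stands for
`d(Γ)^{-1/2}`. -/
def opFreq (a : Λ → E d → ℂ) : L2 d →L[ℂ] L2 d := (c : ℂ) • ∑' θ : Λ, elemOp (θ : E d) (a θ)

variable {a b : Λ → E d → ℂ}

lemma opFreq_add (ha : BddFam a) (hb : BddFam b) :
    opFreq c (a + b) = opFreq c a + opFreq c b := by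
  unfold opFreq
  rw [← smul_add, ← ha.summable_elemOp.tsum_add hb.summable_elemOp]
  simp only [Pi.add_apply, elemOp_add _ (ha.bddCont _) (hb.bddCont _)]

lemma opFreq_const_mul (ha : BddFam a) (z : ℂ) :
    opFreq c (fun θ ξ => z * a θ ξ) = z • opFreq c a := by
  unfold opFreq
  simp only [elemOp_smul _ (ha.bddCont _)]
  rw [tsum_const_smul'', smul_comm]

lemma opFreq_zero : opFreq c (0 : Λ → E d → ℂ) = 0 := by
  have h : ∀ θ : Λ, elemOp (θ : E d) ((0 : Λ → E d → ℂ) θ) = 0 := fun θ => elemOp_zero _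
  unfold opFreq
  simp only [h, tsum_zero, smul_zero]

lemma opFreq_sum {κ : Type*} {s : Finset κ} {f : κ → Λ → E d → ℂ} (hf : ∀ j ∈ s, BddFam (f j)) :
    opFreq c (∑ j ∈ s, f j) = ∑ j ∈ s, opFreq c (f j) := by
  classical
  induction s using Finset.induction_on with
  | empty => exact opFreq_zero c
  | insert j s hj ih =>
    have h2 : ∀ k ∈ s, BddFam (f k) := fun k hk => hf k (Finset.mem_insert_of_mem hk)
    rw [Finset.sum_insert hj, Finset.sum_insert hj, opFreq_add c
      (hf j (Finset.mem_insert_self j s)) (BddFam.sum h2), ih h2]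

lemma norm_opFreq_le {B : Λ → ℝ} (ha : BddFam a) (hB : Summable B)
    (hB' : ∀ θ ξ, ‖a θ ξ‖ ≤ B θ) : ‖opFreq c a‖ ≤ |c| * ∑' θ, B θ := by
  unfold opFreq
  rw [norm_smul, Complex.norm_real, Real.norm_eq_abs]
  exact mul_le_mul_of_nonneg_left (tsum_of_norm_bounded hB.hasSum fun θ =>
    norm_elemOp_le _ (ha.bddCont θ) (hB' θ)) (abs_nonneg c)

lemma opFreq_of_finset (S : Finset Λ) (hS : ∀ θ ∉ S, a θ = 0) :
    opFreq c a = (c : ℂ) • ∑ θ ∈ S, elemOp (θ : E d) (a θ) := by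
  unfold opFreq
  rw [tsum_eq_sum fun θ hθ => by rw [hS θ hθ]; exact elemOp_zero _]

lemma opFreq_mul_elemOp (ha : BddFam a) (φ : Λ) {g : E d → ℂ} (hg : BddCont g) :
    opFreq c a * elemOp (φ : E d) g = opFreq c fun (χ : Λ) ξ => a (χ - φ) (ξ + φ) * g ξ := by
  unfold opFreq
  rw [smul_mul_assoc, ← ha.summable_elemOp.tsum_mul_right]
  rw [← (Equiv.subRight φ).tsum_eq]
  congr 1
  refine tsum_congr fun χ => ?_
  rw [elemOp_mul _ _ (ha.bddCont _) hg, Equiv.subRight_apply, Submodule.coe_sub, sub_add_cancel]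

lemma elemOp_mul_opFreq (ha : BddFam a) (φ : Λ) {g : E d → ℂ} (hg : BddCont g) :
    elemOp (φ : E d) g * opFreq c a =
      opFreq c fun (χ : Λ) ξ => g (ξ + (χ - φ : Λ)) * a (χ - φ) ξ := by
  unfold opFreq
  rw [mul_smul_comm, ← ha.summable_elemOp.tsum_mul_left]
  rw [← (Equiv.subRight φ).tsum_eq]
  congr 1
  refine tsum_congr fun χ => ?_
  rw [elemOp_mul _ _ hg (ha.bddCont _), Equiv.subRight_apply]
  congr 1
  rw [Submodule.coe_sub, add_sub_cancel]

lemma opFreq_star (ha : BddFam a) :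
    star (opFreq c a) = opFreq c fun (θ : Λ) ξ => conj (a (-θ) (ξ + θ)) := by
  unfold opFreq
  rw [star_smul, tsum_star, ← (Equiv.neg Λ).tsum_eq]
  simp only [RCLike.star_def, Complex.conj_ofReal]
  congr 1
  refine tsum_congr fun θ => ?_
  rw [star_elemOp _ (ha.bddCont _)]
  simp

lemma opFreq_isSelfAdjoint (ha : BddFam a) (hs : SymmFam a) : IsSelfAdjoint (opFreq c a) := by
  rw [IsSelfAdjoint, opFreq_star c ha]
  congr 1
  funext θ ξ
  exact (hs θ ξ).symm

/-- The product of the operators with families `a` and `ψ`, the latter supported in `S`. -/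
def famMul (S : Finset Λ) (a ψ : Λ → E d → ℂ) : Λ → E d → ℂ := fun χ ξ =>
  c * ∑ φ ∈ S, a (χ - φ) (ξ + φ) * ψ φ ξ

/-- The product of the operators with families `ψ` and `a`, the former supported in `S`. -/
def famMulLeft (S : Finset Λ) (ψ a : Λ → E d → ℂ) : Λ → E d → ℂ := fun χ ξ =>
  c * ∑ φ ∈ S, ψ φ (ξ + (χ - φ : Λ)) * a (χ - φ) ξ

variable (S : Finset Λ) {ψ : Λ → E d → ℂ}

lemma BddFam.famMul (ha : BddFam a) (hψ : ∀ θ, BddCont (ψ θ)) : BddFam (famMul c S a ψ) := by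
  have h := (BddFam.sum (s := S) fun φ _ => ha.mul_right φ (hψ φ)).const_mul c
  convert h using 1
  funext χ ξ; simp [PeriodicPDO.famMul]

lemma BddFam.famMulLeft (ha : BddFam a) (hψ : ∀ θ, BddCont (ψ θ)) :
    BddFam (famMulLeft c S ψ a) := by
  have h := (BddFam.sum (s := S) fun φ _ => ha.mul_left φ (hψ φ)).const_mul c
  convert h using 1
  funext χ ξ; simp [PeriodicPDO.famMulLeft]

lemma opFreq_mul (ha : BddFam a) (hψ : ∀ θ, BddCont (ψ θ)) (hS : ∀ θ ∉ S, ψ θ = 0) :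
    opFreq c a * opFreq c ψ = opFreq c (famMul c S a ψ) := by
  have h1 := opFreq_const_mul c (BddFam.sum (s := S) fun φ _ => ha.mul_right φ (hψ φ)) c
  rw [opFreq_sum c fun φ _ => ha.mul_right φ (hψ φ)] at h1
  rw [opFreq_of_finset c S hS, mul_smul_comm, Finset.mul_sum]
  simp only [opFreq_mul_elemOp c ha _ (hψ _)]
  rw [← h1]
  congr 1
  funext χ ξ; simp [PeriodicPDO.famMul]

lemma opFreq_mul_left (ha : BddFam a) (hψ : ∀ θ, BddCont (ψ θ)) (hS : ∀ θ ∉ S, ψ θ = 0) :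
    opFreq c ψ * opFreq c a = opFreq c (famMulLeft c S ψ a) := by
  have h1 := opFreq_const_mul c (BddFam.sum (s := S) fun φ _ => ha.mul_left φ (hψ φ)) c
  rw [opFreq_sum c fun φ _ => ha.mul_left φ (hψ φ)] at h1
  rw [opFreq_of_finset c S hS, smul_mul_assoc, Finset.sum_mul]
  simp only [elemOp_mul_opFreq c ha _ (hψ _)]
  rw [← h1]
  congr 1
  funext χ ξ; simp [PeriodicPDO.famMulLeft]

lemma comm_eq_famMul (a ψ : Λ → E d → ℂ) :
    comm c S a ψ = fun χ ξ => Complex.I * (famMul c S a ψ χ ξ - famMulLeft c S ψ a χ ξ) := by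
  funext χ ξ
  simp only [comm, famMul, famMulLeft, Finset.sum_sub_distrib]
  ring

end FreqOp

/-! ### The operators on the physical side -/

section PhysOp

variable {d : ℕ} {Λ : Submodule ℤ (E d)}

variable (d) in
/-- Conjugation with the Fourier transform. -/
def fourierConj : (L2 d →L[ℂ] L2 d) ≃⋆ₐ[ℂ] (L2 d →L[ℂ] L2 d) :=
  (Lp.fourierTransformₗᵢ (E d) ℂ).symm.conjStarAlgEquiv

lemma norm_fourierConj (T : L2 d →L[ℂ] L2 d) : ‖fourierConj d T‖ = ‖T‖ := by
  have h : ∀ (e : L2 d ≃ₗᵢ[ℂ] L2 d) (T : L2 d →L[ℂ] L2 d), ‖e.conjStarAlgEquiv T‖ ≤ ‖T‖ :=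
    fun e T => ContinuousLinearMap.opNorm_le_bound _ (norm_nonneg _) fun u => by
      rw [LinearIsometryEquiv.conjStarAlgEquiv_apply_apply, LinearIsometryEquiv.norm_map]
      exact (T.le_opNorm _).trans (by rw [LinearIsometryEquiv.norm_map])
  refine le_antisymm (h _ T) ?_
  have := h (Lp.fourierTransformₗᵢ (E d) ℂ) (fourierConj d T)
  have e : (Lp.fourierTransformₗᵢ (E d) ℂ).conjStarAlgEquiv (fourierConj d T) = T := by
    ext1 u
    simp [fourierConj, LinearIsometryEquiv.conjStarAlgEquiv_apply_apply]
  rwa [e] at this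

variable (c : ℝ)

/-- The bounded operator with Fourier coefficients `a`. -/
def opB (a : Λ → E d → ℂ) : L2 d →L[ℂ] L2 d := fourierConj d (opFreq c a)

/-- The Fourier multiplier with symbol `f(ξ)`. -/
def fmult (f : E d → ℂ) : L2 d →L[ℂ] L2 d := fourierConj d (elemOp 0 f)

variable {a b ψ : Λ → E d → ℂ}

lemma opB_add (ha : BddFam a) (hb : BddFam b) : opB c (a + b) = opB c a + opB c b := by
  unfold opB; rw [opFreq_add c ha hb, map_add]

lemma opB_const_mul (ha : BddFam a) (z : ℂ) : opB c (fun θ ξ => z * a θ ξ) = z • opB c a := by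
  unfold opB; rw [opFreq_const_mul c ha, map_smul]

lemma opB_smul (ha : BddFam a) (r : ℝ) : opB c (r • a) = (r : ℂ) • opB c a := by
  rw [← opB_const_mul c ha]; congr 1

lemma opB_sub (ha : BddFam a) (hb : BddFam b) : opB c (a - b) = opB c a - opB c b := by
  have h := opB_add c ha (hb.smul (-1))
  rw [opB_smul c hb, neg_smul, one_smul, ← sub_eq_add_neg] at h
  rw [h]; simp [sub_eq_add_neg]

lemma opB_sum {κ : Type*} {s : Finset κ} {f : κ → Λ → E d → ℂ} (hf : ∀ j ∈ s, BddFam (f j)) :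
    opB c (∑ j ∈ s, f j) = ∑ j ∈ s, opB c (f j) := by
  unfold opB; rw [opFreq_sum c hf, map_sum]

lemma norm_opB_le {B : Λ → ℝ} (ha : BddFam a) (hB : Summable B)
    (hB' : ∀ θ ξ, ‖a θ ξ‖ ≤ B θ) : ‖opB c a‖ ≤ |c| * ∑' θ, B θ := by
  unfold opB; rw [norm_fourierConj]; exact norm_opFreq_le c ha hB hB'

lemma opB_isSelfAdjoint (ha : BddFam a) (hs : SymmFam a) : IsSelfAdjoint (opB c a) := by
  have h := opFreq_isSelfAdjoint c ha hs
  rw [IsSelfAdjoint] at h ⊢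
  unfold opB
  rw [← map_star, h]

lemma opB_mul (S : Finset Λ) (ha : BddFam a) (hψ : ∀ θ, BddCont (ψ θ)) (hS : ∀ θ ∉ S, ψ θ = 0) :
    opB c a * opB c ψ = opB c (famMul c S a ψ) := by
  unfold opB; rw [← map_mul, opFreq_mul c S ha hψ hS]

lemma opB_mul_left (S : Finset Λ) (ha : BddFam a) (hψ : ∀ θ, BddCont (ψ θ))
    (hS : ∀ θ ∉ S, ψ θ = 0) : opB c ψ * opB c a = opB c (famMulLeft c S ψ a) := by
  unfold opB; rw [← map_mul, opFreq_mul_left c S ha hψ hS]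

lemma BddFam.comm (S : Finset Λ) (ha : BddFam a) (hψ : ∀ θ, BddCont (ψ θ)) :
    BddFam (comm c S a ψ) := by
  rw [comm_eq_famMul]
  exact ((ha.famMul c S hψ).sub (ha.famMulLeft c S hψ)).const_mul Complex.I

/-- The family `comm c S a ψ` is that of `i [A, Ψ]`. -/
lemma opB_comm (S : Finset Λ) (ha : BddFam a) (hψ : ∀ θ, BddCont (ψ θ)) (hS : ∀ θ ∉ S, ψ θ = 0) :
    opB c (PeriodicPDO.comm c S a ψ) =
      Complex.I • (opB c a * opB c ψ - opB c ψ * opB c a) := by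
  rw [comm_eq_famMul, opB_mul c S ha hψ hS, opB_mul_left c S ha hψ hS,
    ← opB_sub c (ha.famMul c S hψ) (ha.famMulLeft c S hψ),
    ← opB_const_mul c ((ha.famMul c S hψ).sub (ha.famMulLeft c S hψ))]
  rfl

lemma opB_mul_fmult (ha : BddFam a) {g : E d → ℂ} (hg : BddCont g) :
    opB c a * fmult g = opB c fun (χ : Λ) ξ => a χ ξ * g ξ := by
  have h := opFreq_mul_elemOp c ha 0 hg
  unfold opB fmult
  rw [← map_mul]
  simp only [Submodule.coe_zero, add_zero, sub_zero] at h
  rw [h]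

lemma fmult_mul_opB (ha : BddFam a) {g : E d → ℂ} (hg : BddCont g) :
    fmult g * opB c a = opB c fun (χ : Λ) ξ => g (ξ + χ) * a χ ξ := by
  have h := elemOp_mul_opFreq c ha 0 hg
  unfold opB fmult
  rw [← map_mul]
  simp only [Submodule.coe_zero, sub_zero] at h
  rw [h]

lemma fmult_one : fmult (fun _ : E d => 1) = 1 := by
  unfold fmult; rw [elemOp_one, map_one]

end PhysOp

end

end PeriodicPDO

namespace PeriodicPDO

noncomputable section

/-! ### Pseudo-differential operators on the Schwartz class -/

section Schwartz

open scoped FourierTransform RealInnerProductSpace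

variable {d : ℕ}

lemma continuous_neg_innerₗ : Continuous fun p : E d × E d => (-innerₗ (E d)) p.1 p.2 :=
  (continuous_inner (𝕜 := ℝ)).neg

/-- The inverse Fourier transform in `L²` is given by the Fourier integral, if that converges. -/
lemma fourierInv_ae_eq_integral {u : L2 d} {g : E d → ℂ} (hg : Integrable g)
    (hu : u =ᵐ[volume] g) : (𝓕⁻ u : L2 d) =ᵐ[volume] 𝓕⁻ g := by
  have hcont : Continuous (𝓕⁻ g) :=
    VectorFourier.fourierIntegral_continuous Real.continuous_fourierChar
      continuous_neg_innerₗ hg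
  refine ae_eq_of_integral_contDiff_smul_eq
    ((Lp.memLp (𝓕⁻ u : L2 d)).locallyIntegrable (by norm_num)) hcont.locallyIntegrable ?_
  intro χ hχ hχs
  have hχs' : HasCompactSupport fun x => (χ x : ℂ) :=
    hχs.comp_left (g := fun t : ℝ => (t : ℂ)) Complex.ofReal_zero
  set φ : 𝓢(E d, ℂ) := hχs'.toSchwartzMap (Complex.ofRealCLM.contDiff.comp hχ) with hφ
  have hφx : ∀ x, φ x = (χ x : ℂ) := fun x => rfl
  have h1 := congrArg (fun T => T φ) (Lp.fourierInv_toTemperedDistribution_eq u)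
  simp only [TemperedDistribution.fourierInv_apply, Lp.toTemperedDistribution_apply] at h1
  have h2 : ∫ x, φ x • (𝓕⁻ g) x = ∫ x, (𝓕⁻ (φ : E d → ℂ)) x • g x := by
    have h := VectorFourier.integral_fourierIntegral_smul_eq_flip (μ := volume) (ν := volume)
      (L := -innerₗ (E d)) (e := Real.fourierChar) (f := (φ : E d → ℂ)) (g := g)
      Real.continuous_fourierChar
      continuous_neg_innerₗ φ.integrable hg
    have e : (-innerₗ (E d)).flip = -innerₗ (E d) := by
      ext x y; simp [real_inner_comm]
    rw [e] at h
    exact h.symm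
  have h3 : ∫ x, (𝓕⁻ φ) x • u x = ∫ x, (𝓕⁻ (φ : E d → ℂ)) x • g x := by
    refine integral_congr_ae ?_
    filter_upwards [hu] with x hx
    rw [hx, SchwartzMap.fourierInv_coe]
  simp only [hφx, Complex.coe_smul] at h1 h2
  rw [h2, ← h3, ← h1]

lemma expI_eq_fourierChar (η x : E d) :
    expI ((2 * Real.pi) • η) x = (Real.fourierChar ⟪η, x⟫ : ℂ) := by
  rw [expI, Real.fourierChar_apply, inner_smul_left]
  congr 1
  push_cast
  simp
  ring

lemma fourierTr_scale (f : E d → ℂ) (η : E d) :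
    fourierTr f ((2 * Real.pi) • η) =
      (((2 * Real.pi) ^ (-(d : ℝ) / 2) : ℝ) : ℂ) * (𝓕 f) η := by
  unfold fourierTr
  rw [Real.fourier_eq]
  congr 1
  refine integral_congr_ae (Eventually.of_forall fun x => ?_)
  simp only [expI_eq_fourierChar, inner_neg_right, Circle.smul_def, smul_eq_mul, real_inner_comm]

/-- The integral defining `Op(b) f`, in the frequency variable `ξ = 2π η`. -/
lemma opFun_eq (b : Symb d) (f : E d → ℂ) (x : E d) :
    opFun b f x = ∫ η, b x ((2 * Real.pi) • η) * expI ((2 * Real.pi) • η) x * (𝓕 f) η := by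
  have h := Measure.integral_comp_smul volume
    (fun ξ : E d => b x ξ * expI ξ x * fourierTr f ξ) (2 * Real.pi)
  have hp : (0 : ℝ) < 2 * Real.pi := Real.two_pi_pos
  rw [finrank_euclideanSpace_fin, abs_of_pos (by positivity), eq_comm,
    inv_smul_eq_iff₀ (by positivity)] at h
  unfold opFun
  rw [h]
  simp only [fourierTr_scale]
  have e1 : ∀ η, b x ((2 * Real.pi) • η) * expI ((2 * Real.pi) • η) x *
      ((((2 * Real.pi) ^ (-(d : ℝ) / 2) : ℝ) : ℂ) * (𝓕 f) η) =
      (((2 * Real.pi) ^ (-(d : ℝ) / 2) : ℝ) : ℂ) *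
        (b x ((2 * Real.pi) • η) * expI ((2 * Real.pi) • η) x * (𝓕 f) η) := fun η => by ring
  simp only [e1]
  rw [integral_const_mul, ← Complex.coe_smul, smul_eq_mul, ← mul_assoc, ← mul_assoc,
    ← Complex.ofReal_mul, ← Complex.ofReal_mul, ← Real.rpow_natCast, ← Real.rpow_add hp,
    ← Real.rpow_add hp]
  have e2 : -(d : ℝ) / 2 + d + -(d : ℝ) / 2 = 0 := by ring
  rw [e2, Real.rpow_zero, Complex.ofReal_one, one_mul]

/-- Weights in `ξ` by which symbols are divided to make them bounded. -/
structure IsWeight (q : E d → ℝ) : Prop where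
  cont : Continuous q
  one_le : ∀ ξ, 1 ≤ q ξ
  growth : ∃ (C : ℝ) (N : ℕ), ∀ ξ, q ξ ≤ C * (1 + ‖ξ‖ ^ N)

namespace IsWeight

variable {q : E d → ℝ} (hq : IsWeight q)
include hq

lemma pos (ξ : E d) : 0 < q ξ := one_pos.trans_le (hq.one_le ξ)

lemma ne_zero (ξ : E d) : (q ξ : ℂ) ≠ 0 := Complex.ofReal_ne_zero.2 (hq.pos ξ).ne'

lemma bddCont_inv : BddCont fun ξ => (q ξ : ℂ)⁻¹ := by
  refine ⟨(Complex.continuous_ofReal.comp hq.cont).inv₀ hq.ne_zero, 1, fun ξ => ?_⟩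
  rw [norm_inv, Complex.norm_real, Real.norm_of_nonneg (hq.pos ξ).le]
  exact inv_le_one_of_one_le₀ (hq.one_le ξ)

lemma continuous_mul (φ : 𝓢(E d, ℂ)) :
    Continuous fun η => (q ((2 * Real.pi) • η) : ℂ) * φ η :=
  (Complex.continuous_ofReal.comp (hq.cont.comp (by fun_prop))).mul φ.continuous

lemma integrable_mul (φ : 𝓢(E d, ℂ)) :
    Integrable fun η => (q ((2 * Real.pi) • η) : ℂ) * φ η := by
  obtain ⟨C, N, hC⟩ := hq.growth
  have h0 := φ.integrable_pow_mul volume 0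
  have hN := φ.integrable_pow_mul volume N
  refine ((h0.add (hN.const_mul ((2 * Real.pi) ^ N))).const_mul C).mono'
    (hq.continuous_mul φ).aestronglyMeasurable (Eventually.of_forall fun η => ?_)
  rw [norm_mul, Complex.norm_real, Real.norm_of_nonneg (hq.pos _).le]
  calc _ ≤ C * (1 + ‖(2 * Real.pi) • η‖ ^ N) * ‖φ η‖ :=
        mul_le_mul_of_nonneg_right (hC _) (norm_nonneg _)
    _ = _ := by
        rw [norm_smul, Real.norm_of_nonneg Real.two_pi_pos.le]
        simp only [Pi.add_apply, pow_zero]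
        ring

lemma memLp_mul (φ : 𝓢(E d, ℂ)) :
    MemLp (fun η => (q ((2 * Real.pi) • η) : ℂ) * φ η) 2 volume := by
  obtain ⟨C, N, hC⟩ := hq.growth
  obtain ⟨D, hD, hD'⟩ := φ.decay N 0
  obtain ⟨D0, hD0, hD0'⟩ := φ.decay 0 0
  simp only [norm_iteratedFDeriv_zero, pow_zero, one_mul] at hD' hD0'
  have hC0 : 0 ≤ C := by
    have := (hq.one_le 0).trans (hC 0)
    by_contra hneg
    have h2 : (0 : ℝ) ≤ 1 + ‖(0 : E d)‖ ^ N := by positivity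
    nlinarith
  have hb : ∀ η, ‖(q ((2 * Real.pi) • η) : ℂ) * φ η‖ ≤ C * (D0 + (2 * Real.pi) ^ N * D) := by
    intro η
    rw [norm_mul, Complex.norm_real, Real.norm_of_nonneg (hq.pos _).le]
    calc _ ≤ C * (1 + ‖(2 * Real.pi) • η‖ ^ N) * ‖φ η‖ :=
          mul_le_mul_of_nonneg_right (hC _) (norm_nonneg _)
      _ = C * (‖φ η‖ + (2 * Real.pi) ^ N * (‖η‖ ^ N * ‖φ η‖)) := by
          rw [norm_smul, Real.norm_of_nonneg Real.two_pi_pos.le]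
          ring
      _ ≤ _ := by
          have := hD' η
          have := hD0' η
          have := Real.two_pi_pos
          gcongr
  rw [memLp_two_iff_integrable_sq_norm (hq.continuous_mul φ).aestronglyMeasurable]
  refine ((hq.integrable_mul φ).norm.const_mul (C * (D0 + (2 * Real.pi) ^ N * D))).mono'
    ((hq.continuous_mul φ).norm.pow 2).aestronglyMeasurable (Eventually.of_forall fun η => ?_)
  rw [Real.norm_of_nonneg (by positivity), pow_two]
  exact mul_le_mul_of_nonneg_right (hb η) (norm_nonneg _)

end IsWeight

/-- The element of `L²` given by `q(2π η) φ(η)`. -/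
def wmul {q : E d → ℝ} (hq : IsWeight q) (φ : 𝓢(E d, ℂ)) : L2 d := (hq.memLp_mul φ).toLp _

lemma coeFn_wmul {q : E d → ℝ} (hq : IsWeight q) (φ : 𝓢(E d, ℂ)) :
    wmul hq φ =ᵐ[volume] fun η => (q ((2 * Real.pi) • η) : ℂ) * φ η :=
  (hq.memLp_mul φ).coeFn_toLp

/-- The functions `q φ` are dense in `L²`. -/
lemma dense_wmul {q : E d → ℝ} (hq : IsWeight q) :
    Dense (Submodule.span ℂ (Set.range (wmul hq)) : Set (L2 d)) := by
  rw [Submodule.dense_iff_topologicalClosure_eq_top, Submodule.topologicalClosure_eq_top_iff,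
    Submodule.eq_bot_iff]
  intro u hu
  have hcont : Continuous fun η : E d => q ((2 * Real.pi) • η) := hq.cont.comp (by fun_prop)
  have hloc : LocallyIntegrable (fun η => q ((2 * Real.pi) • η) • u η) volume :=
    LocallyIntegrable.continuous_smul hcont ((Lp.memLp u).locallyIntegrable (by norm_num))
  have hz : ∀ᵐ η, q ((2 * Real.pi) • η) • u η = 0 := by
    refine ae_eq_zero_of_integral_contDiff_smul_eq_zero hloc fun χ hχ hχs => ?_
    have hχs' : HasCompactSupport fun x => (χ x : ℂ) :=
      hχs.comp_left (g := fun t : ℝ => (t : ℂ)) Complex.ofReal_zero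
    set φ : 𝓢(E d, ℂ) := hχs'.toSchwartzMap (Complex.ofRealCLM.contDiff.comp hχ) with hφ
    have hφx : ∀ x, φ x = (χ x : ℂ) := fun x => rfl
    have h0 := hu (wmul hq φ) (Submodule.subset_span ⟨φ, rfl⟩)
    rw [L2.inner_def] at h0
    rw [← h0]
    refine integral_congr_ae ?_
    filter_upwards [coeFn_wmul hq φ] with η h
    rw [h, hφx, RCLike.inner_apply, map_mul, Complex.conj_ofReal, Complex.conj_ofReal,
      Complex.real_smul, Complex.real_smul]
    ring
  refine Lp.ext ?_
  filter_upwards [hz, Lp.coeFn_zero ℂ 2 (volume : Measure (E d))] with η h h0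
  rw [h0]
  exact (smul_eq_zero.1 h).resolve_left (hq.pos _).ne'

variable {Λ : Submodule ℤ (E d)}

/-- The symbol with Fourier coefficients `a`; `c` stands for `d(Γ)^{-1/2}`. -/
def symbOf (c : ℝ) (a : Λ → E d → ℂ) : Symb d := fun x ξ => c * ∑' θ : Λ, a θ ξ * expI (θ : E d) x

lemma norm_expI (ξ x : E d) : ‖expI ξ x‖ = 1 := by
  rw [expI, mul_comm, Complex.norm_exp_ofReal_mul_I]

lemma expI_add (ξ η x : E d) : expI (ξ + η) x = expI ξ x * expI η x := by
  rw [expI, expI, expI, ← Complex.exp_add, inner_add_left]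
  push_cast
  ring_nf

lemma continuous_expI_left (x : E d) : Continuous fun ξ => expI ξ x := by
  unfold expI; fun_prop

lemma continuous_expI_right (ξ : E d) : Continuous fun x => expI ξ x := by
  unfold expI; fun_prop

lemma fourierInv_eq_expI (g : E d → ℂ) (x : E d) :
    (𝓕⁻ g) x = ∫ η, expI ((2 * Real.pi) • η) x * g η := by
  rw [Real.fourierInv_eq]
  simp only [expI_eq_fourierChar, Circle.smul_def, smul_eq_mul]

/-- The limit of a series in `L²` is the sum of the pointwise series, if that converges. -/
lemma ae_eq_of_hasSum {κ : Type*} [Countable κ] {u : κ → L2 d} {w : L2 d} (hu : HasSum u w)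
    {h : κ → E d → ℂ} (hh : ∀ k, u k =ᵐ[volume] h k) {H : E d → ℂ}
    (hH : ∀ x, HasSum (fun k => h k x) (H x)) : w =ᵐ[volume] H := by
  obtain ⟨ns, hns, hae⟩ := (tendstoInMeasure_of_tendsto_Lp hu).exists_seq_tendsto_ae'
  have hsum : ∀ s : Finset κ, (∑ k ∈ s, u k : L2 d) =ᵐ[volume] fun x => ∑ k ∈ s, h k x := by
    classical
    intro s
    induction s using Finset.induction_on with
    | empty =>
      simp only [Finset.sum_empty]
      exact Lp.coeFn_zero ℂ 2 (volume : Measure (E d))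
    | insert k s hk ih =>
      simp only [Finset.sum_insert hk]
      filter_upwards [Lp.coeFn_add (u k) (∑ k ∈ s, u k), hh k, ih] with x h1 h2 h3
      rw [h1, Pi.add_apply, h2, h3]
  filter_upwards [hae, ae_all_iff.2 fun n => hsum (ns n)] with x h1 h2
  simp only [h2] at h1
  exact tendsto_nhds_unique h1 ((hH x).comp hns)

/-- The quotient of a family by a weight. -/
def famDiv (a : Λ → E d → ℂ) (q : E d → ℝ) : Λ → E d → ℂ := fun θ ξ => a θ ξ * (q ξ : ℂ)⁻¹

section Core

variable (c : ℝ) {a : Λ → E d → ℂ} {q : E d → ℝ} (hq : IsWeight q) (ha : BddFam (famDiv a q))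
include hq

lemma famDiv_mul (θ : Λ) (ξ : E d) : famDiv a q θ ξ * (q ξ : ℂ) = a θ ξ := by
  rw [famDiv, inv_mul_cancel_right₀ (hq.ne_zero ξ)]

lemma symbOf_eq (x ξ : E d) : symbOf c a x ξ = symbOf c (famDiv a q) x ξ * q ξ := by
  unfold symbOf
  rw [mul_assoc, ← tsum_mul_right]
  congr 1
  refine tsum_congr fun θ => ?_
  rw [← famDiv_mul (a := a) hq θ ξ]
  ring

omit hq in
lemma continuous_symbOf {a : Λ → E d → ℂ} (ha : BddFam a) (x : E d) :
    Continuous fun ξ => symbOf c a x ξ := by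
  obtain ⟨B, hB, hB'⟩ := ha.bdd
  refine continuous_const.mul (continuous_tsum (u := B)
    (fun θ => (ha.cont θ).mul continuous_const) hB fun θ ξ => ?_)
  rw [norm_mul, norm_expI, mul_one]
  exact hB' θ ξ

include ha

/-- The pieces of `Op(b) f` belonging to the single Fourier coefficients. -/
lemma fourierInv_elemOp_ae_eq (φ : 𝓢(E d, ℂ)) (θ : Λ) :
    (𝓕⁻ (elemOp (θ : E d) (famDiv a q θ) (wmul hq φ)) : L2 d) =ᵐ[volume] fun x =>
      ∫ η, a θ ((2 * Real.pi) • η) * expI (θ : E d) x * expI ((2 * Real.pi) • η) x * φ η := by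
  set w := (2 * Real.pi)⁻¹ • (θ : E d) with hw
  obtain ⟨B, hB, hB'⟩ := ha.bdd
  have hG : Integrable fun η => a θ ((2 * Real.pi) • η) * φ η := by
    have h := (hq.integrable_mul φ).bdd_mul (c := B θ)
      (f := fun η => famDiv a q θ ((2 * Real.pi) • η))
      ((ha.cont θ).comp (by fun_prop)).aestronglyMeasurable (Eventually.of_forall fun η => hB' θ _)
    simp only [← mul_assoc, famDiv_mul hq] at h
    exact h
  have hg : Integrable fun η => a θ ((2 * Real.pi) • (η - w)) * φ (η - w) := hG.comp_sub_right w
  have hae : elemOp (θ : E d) (famDiv a q θ) (wmul hq φ) =ᵐ[volume]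
      fun η => a θ ((2 * Real.pi) • (η - w)) * φ (η - w) := by
    filter_upwards [coeFn_elemOp (θ : E d) (ha.bddCont θ) (wmul hq φ),
      ae_comp_sub (coeFn_wmul hq φ) w] with η h1 h2
    rw [h1, h2, ← two_pi_smul_sub, ← mul_assoc, famDiv_mul hq]
  refine (fourierInv_ae_eq_integral hg hae).trans (Eventually.of_forall fun x => ?_)
  simp only
  rw [fourierInv_eq_expI, ← integral_add_right_eq_self _ w]
  refine integral_congr_ae (Eventually.of_forall fun η => ?_)
  have e : (2 * Real.pi) • w = (θ : E d) := by
    rw [hw, smul_smul, mul_inv_cancel₀ Real.two_pi_pos.ne', one_smul]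
  simp only [add_sub_cancel_right, smul_add, e, expI_add]
  ring

/-- `Op` with the symbol of a family, on the Schwartz class. -/
lemma opB_wmul_ae_eq [Countable Λ] (f : 𝓢(E d, ℂ)) :
    opB c (famDiv a q) (𝓕⁻ (wmul hq (𝓕 f))) =ᵐ[volume] opFun (symbOf c a) f := by
  obtain ⟨B, hB, hB'⟩ := ha.bdd
  set φ : 𝓢(E d, ℂ) := 𝓕 f with hφ
  set u : Λ → L2 d := fun θ => 𝓕⁻ (elemOp (θ : E d) (famDiv a q θ) (wmul hq φ)) with hu
  set T : L2 d →L[ℂ] L2 d :=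
    (Lp.fourierTransformₗᵢ (E d) ℂ).symm.toLinearIsometry.toContinuousLinearMap with hT
  have hs := (ha.summable_elemOp.hasSum.mapL
    (ContinuousLinearMap.apply ℂ (L2 d) (wmul hq φ))).mapL T
  have e1 : opB c (famDiv a q) (𝓕⁻ (wmul hq φ)) =
      (c : ℂ) • T ((∑' θ : Λ, elemOp (θ : E d) (famDiv a q θ)) (wmul hq φ)) := by
    change (Lp.fourierTransformₗᵢ (E d) ℂ).symm (opFreq c (famDiv a q)
      ((Lp.fourierTransformₗᵢ (E d) ℂ) ((Lp.fourierTransformₗᵢ (E d) ℂ).symm (wmul hq φ)))) = _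
    rw [LinearIsometryEquiv.apply_symm_apply, opFreq, _root_.smul_apply, map_smul]
    rfl
  have hint : ∀ x (θ : Λ), Integrable fun η : E d =>
      a θ ((2 * Real.pi) • η) * expI (θ : E d) x * expI ((2 * Real.pi) • η) x * φ η := by
    intro x θ
    have h := (hq.integrable_mul φ).bdd_mul (c := B θ)
      (f := fun η => famDiv a q θ ((2 * Real.pi) • η) * expI (θ : E d) x *
        expI ((2 * Real.pi) • η) x)
      ((((ha.cont θ).comp (by fun_prop)).mul continuous_const).mul
        ((continuous_expI_left x).comp (by fun_prop))).aestronglyMeasurable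
      (Eventually.of_forall fun η => by
        simp only [norm_mul, norm_expI, mul_one]
        exact hB' θ _)
    refine h.congr (Eventually.of_forall fun η => ?_)
    simp only
    rw [← famDiv_mul (a := a) hq θ]
    ring
  have hnorm : ∀ x (θ : Λ), ∫ η : E d,
      ‖a θ ((2 * Real.pi) • η) * expI (θ : E d) x * expI ((2 * Real.pi) • η) x * φ η‖ ≤
        B θ * ∫ η : E d, ‖(q ((2 * Real.pi) • η) : ℂ) * φ η‖ := by
    intro x θ
    rw [← integral_const_mul]
    refine integral_mono (hint x θ).norm ((hq.integrable_mul φ).norm.const_mul _) fun η => ?_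
    simp only [norm_mul, norm_expI, mul_one]
    rw [← famDiv_mul (a := a) hq θ, norm_mul, mul_assoc]
    exact mul_le_mul_of_nonneg_right (hB' θ _) (by positivity)
  have hpt : ∀ x, HasSum (fun θ : Λ => ∫ η : E d,
      a θ ((2 * Real.pi) • η) * expI (θ : E d) x * expI ((2 * Real.pi) • η) x * φ η)
      (∫ η : E d, ∑' θ : Λ,
        a θ ((2 * Real.pi) • η) * expI (θ : E d) x * expI ((2 * Real.pi) • η) x * φ η) :=
    fun x => hasSum_integral_of_summable_integral_norm (hint x)
      (Summable.of_nonneg_of_le (fun θ => integral_nonneg fun _ => norm_nonneg _) (hnorm x)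
        (hB.mul_right _))
  have hae := ae_eq_of_hasSum hs (fun θ => fourierInv_elemOp_ae_eq hq ha φ θ) hpt
  rw [e1]
  filter_upwards [hae, Lp.coeFn_smul (c : ℂ)
    (T ((∑' θ : Λ, elemOp (θ : E d) (famDiv a q θ)) (wmul hq φ)))] with x h1 h2
  rw [h2, Pi.smul_apply, opFun_eq, smul_eq_mul]
  refine (congrArg (fun z => (c : ℂ) * z) h1).trans ?_
  rw [← integral_const_mul]
  refine integral_congr_ae (Eventually.of_forall fun η => ?_)
  simp only [tsum_mul_right, symbOf, hφ, SchwartzMap.fourier_coe]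
  ring

/-- The integral defining `Op(a) f` converges, because `a` grows at most like the weight `q`. -/
lemma integrable_symbOf (f : 𝓢(E d, ℂ)) (x : E d) :
    Integrable fun ξ => symbOf c a x ξ * expI ξ x * fourierTr f ξ := by
  rw [← integrable_comp_smul_iff volume _ Real.two_pi_pos.ne']
  obtain ⟨B, hB, hB'⟩ := ha.bdd
  have h := (hq.integrable_mul (𝓕 f)).bdd_mul
    (c := |c| * (∑' θ, B θ) * ‖(((2 * Real.pi) ^ (-(d : ℝ) / 2) : ℝ) : ℂ)‖)
    (f := fun η => symbOf c (famDiv a q) x ((2 * Real.pi) • η) *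
      expI ((2 * Real.pi) • η) x * (((2 * Real.pi) ^ (-(d : ℝ) / 2) : ℝ) : ℂ))
    ((((continuous_symbOf c ha x).comp (by fun_prop)).mul
      ((continuous_expI_left x).comp (by fun_prop))).mul continuous_const).aestronglyMeasurable
    (Eventually.of_forall fun η => by
      rw [norm_mul, norm_mul, norm_expI, mul_one, symbOf, norm_mul, Complex.norm_real,
        Real.norm_eq_abs]
      gcongr
      exact tsum_of_norm_bounded hB.hasSum fun θ => by
        rw [norm_mul, norm_expI, mul_one]; exact hB' θ _)
  refine h.congr (Eventually.of_forall fun η => ?_)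
  simp only [fourierTr_scale, symbOf_eq c hq (a := a), SchwartzMap.fourier_coe]
  ring

omit ha in
/-- Division by the weight recovers the Schwartz function. -/
lemma fmult_wmul (f : 𝓢(E d, ℂ)) :
    fmult (fun ξ => (q ξ : ℂ)⁻¹) (𝓕⁻ (wmul hq (𝓕 f))) = f.toLp 2 := by
  have h1 : fmult (fun ξ => (q ξ : ℂ)⁻¹) (𝓕⁻ (wmul hq (𝓕 f))) =
      (𝓕⁻ (elemOp 0 (fun ξ => (q ξ : ℂ)⁻¹) (wmul hq (𝓕 f))) : L2 d) := by
    change (Lp.fourierTransformₗᵢ (E d) ℂ).symm (elemOp 0 (fun ξ => (q ξ : ℂ)⁻¹)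
      ((Lp.fourierTransformₗᵢ (E d) ℂ) ((Lp.fourierTransformₗᵢ (E d) ℂ).symm (wmul hq _)))) = _
    rw [LinearIsometryEquiv.apply_symm_apply]
    rfl
  have h2 : elemOp 0 (fun ξ => (q ξ : ℂ)⁻¹) (wmul hq (𝓕 f)) = (𝓕 f).toLp 2 := by
    refine Lp.ext ?_
    filter_upwards [coeFn_elemOp 0 hq.bddCont_inv (wmul hq (𝓕 f)), coeFn_wmul hq (𝓕 f),
      (𝓕 f).coeFn_toLp 2 volume] with η e1 e2 e3
    simp only [smul_zero, sub_zero] at e1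
    rw [e1, e2, e3, inv_mul_cancel_left₀ (hq.ne_zero _)]
  rw [h1, h2, SchwartzMap.toLp_fourierInv_eq]
  simp

/-- The graph of `Op` on the Schwartz class, parametrized by `v = 𝓕⁻ (q 𝓕 f)`. -/
lemma mem_opGraph_symbOf [Countable Λ] (p : L2 d × L2 d) :
    p ∈ opGraph (symbOf c a) ↔ ∃ f : 𝓢(E d, ℂ),
      p = (fmult (fun ξ => (q ξ : ℂ)⁻¹) (𝓕⁻ (wmul hq (𝓕 f))),
        opB c (famDiv a q) (𝓕⁻ (wmul hq (𝓕 f)))) := by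
  constructor
  · rintro ⟨f, h1, -, h3⟩
    refine ⟨f, Prod.ext (h1.trans (fmult_wmul hq f).symm) (Lp.ext ?_)⟩
    exact h3.trans (opB_wmul_ae_eq c hq ha f).symm
  · rintro ⟨f, rfl⟩
    exact ⟨f, fmult_wmul hq f, integrable_symbOf c hq ha f, opB_wmul_ae_eq c hq ha f⟩

/-- The closure of the graph contains all pairs `(q⁻¹ v, A q⁻¹ v)`. -/
lemma mem_closure_opGraph [Countable Λ] (v : L2 d) :
    (fmult (fun ξ => (q ξ : ℂ)⁻¹) v, opB c (famDiv a q) v) ∈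
      (opGraph (symbOf c a)).topologicalClosure := by
  have hd : DenseRange fun φ : L2 d => (𝓕⁻ φ : L2 d) :=
    (Lp.fourierTransformₗᵢ (E d) ℂ).symm.surjective.denseRange
  have hcont : Continuous fun φ : L2 d => (𝓕⁻ φ : L2 d) :=
    (Lp.fourierTransformₗᵢ (E d) ℂ).symm.continuous
  set T : L2 d →ₗ[ℂ] L2 d × L2 d := (LinearMap.prod
    (fmult (fun ξ => (q ξ : ℂ)⁻¹)).toLinearMap (opB c (famDiv a q)).toLinearMap) ∘ₗ
      (Lp.fourierTransformₗᵢ (E d) ℂ).symm.toLinearEquiv.toLinearMap with hT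
  have hTc : Continuous T :=
    (((fmult (fun ξ => (q ξ : ℂ)⁻¹)).continuous.comp hcont).prodMk
      ((opB c (famDiv a q)).continuous.comp hcont))
  have hle : ∀ φ ∈ Submodule.span ℂ (Set.range (wmul hq)), T φ ∈ opGraph (symbOf c a) := by
    intro φ hφ
    have : Submodule.span ℂ (Set.range (wmul hq)) ≤ (opGraph (symbOf c a)).comap T := by
      rw [Submodule.span_le]
      rintro _ ⟨g, rfl⟩
      refine (mem_opGraph_symbOf c hq ha _).2 ⟨𝓕⁻ g, ?_⟩
      rw [FourierTransform.fourier_fourierInv_eq]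
      rfl
    exact this hφ
  have key : ∀ φ : L2 d, T φ ∈ (opGraph (symbOf c a)).topologicalClosure := by
    intro φ
    refine map_mem_closure hTc (dense_wmul hq φ) hle
  have := key (𝓕 v)
  have e : T (𝓕 v) = (fmult (fun ξ => (q ξ : ℂ)⁻¹) v, opB c (famDiv a q) v) := by
    have : (Lp.fourierTransformₗᵢ (E d) ℂ).symm (𝓕 v) = v :=
      (Lp.fourierTransformₗᵢ (E d) ℂ).symm_apply_apply v
    exact congrArg (fun w => (fmult (fun ξ => (q ξ : ℂ)⁻¹) w, opB c (famDiv a q) w)) this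
  rwa [e] at this

end Core

end Schwartz

end

end PeriodicPDO

namespace PeriodicPDO

noncomputable section

/-! ### Closures of pseudo-differential operators -/

section Closure

variable {d : ℕ} {Λ : Submodule ℤ (E d)}

/-- The bounded operator `Op(q)⁻¹` of a weight `q`. -/
def invW (q : E d → ℝ) : L2 d →L[ℂ] L2 d := fmult fun ξ => (q ξ : ℂ)⁻¹

lemma invW_injective {q : E d → ℝ} (hq : IsWeight q) : Function.Injective (invW q) := by
  refine (injective_iff_map_eq_zero _).2 fun v hv => ?_
  set F := Lp.fourierTransformₗᵢ (E d) ℂ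
  have h1 : F.symm (elemOp 0 (fun ξ => (q ξ : ℂ)⁻¹) (F v)) = 0 := hv
  rw [LinearIsometryEquiv.map_eq_zero_iff] at h1
  have h2 : F v = 0 := by
    refine Lp.ext ?_
    have h3 := coeFn_elemOp 0 hq.bddCont_inv (F v)
    rw [h1] at h3
    filter_upwards [h3, Lp.coeFn_zero ℂ 2 (volume : Measure (E d))] with η e1 e2
    rw [e2] at e1 ⊢
    simp only [smul_zero, sub_zero, Pi.zero_apply] at e1 ⊢
    exact (mul_eq_zero.1 e1.symm).resolve_left (inv_ne_zero (hq.ne_zero _))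
  rwa [LinearIsometryEquiv.map_eq_zero_iff] at h2

lemma star_invW {q : E d → ℝ} (hq : IsWeight q) : star (invW q) = invW q := by
  unfold invW fmult
  rw [← map_star, star_elemOp 0 hq.bddCont_inv]
  simp

lemma isWeight_one : IsWeight (fun _ : E d => (1 : ℝ)) :=
  ⟨continuous_const, fun _ => le_rfl, 1, 0, fun _ => by simp⟩

lemma invW_one : invW (fun _ : E d => (1 : ℝ)) = 1 := by
  unfold invW; simpa using fmult_one (d := d)

lemma famDiv_one (a : Λ → E d → ℂ) : famDiv a (fun _ => 1) = a := by
  funext θ ξ; simp [famDiv]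

/-- The unbounded operator `A` acts on the range of `Op(q)⁻¹` by `A Op(q)⁻¹ = T`. -/
def ActsBy (q : E d → ℝ) (A : L2 d →ₗ.[ℂ] L2 d) (T : L2 d →L[ℂ] L2 d) : Prop :=
  ∀ v, (invW q v, T v) ∈ A.graph

lemma ActsBy.add {q : E d → ℝ} {A B : L2 d →ₗ.[ℂ] L2 d} {S T : L2 d →L[ℂ] L2 d}
    (hA : ActsBy q A S) (hB : ActsBy q B T) : ActsBy q (A + B) (S + T) := fun v => by
  obtain ⟨x, hx1, hx2⟩ := (LinearPMap.mem_graph_iff _).1 (hA v)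
  obtain ⟨y, hy1, hy2⟩ := (LinearPMap.mem_graph_iff _).1 (hB v)
  simp only at hx1 hx2 hy1 hy2
  refine (LinearPMap.mem_graph_iff _).2 ⟨⟨invW q v, ?_, ?_⟩, rfl, ?_⟩
  · rw [← hx1]; exact x.2
  · rw [← hy1]; exact y.2
  · rw [LinearPMap.add_apply]
    simp only [_root_.add_apply, ← hx2, ← hy2]
    congr 2 <;> exact Subtype.ext (by simp [hx1, hy1])

lemma ActsBy.bdd (q : E d → ℝ) (T : L2 d →L[ℂ] L2 d) :
    ActsBy q (bdd T) (T * invW q) := fun v =>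
  (LinearPMap.mem_graph_iff _).2 ⟨⟨invW q v, trivial⟩, rfl, rfl⟩

/-- Operators with domain the range of `Op(q)⁻¹` are determined by their action. -/
lemma ActsBy.eq {q : E d → ℝ} {A B : L2 d →ₗ.[ℂ] L2 d} {T : L2 d →L[ℂ] L2 d}
    (hA : ActsBy q A T) (hB : ActsBy q B T) (hA' : ∀ u ∈ A.domain, ∃ v, invW q v = u)
    (hB' : ∀ u ∈ B.domain, ∃ v, invW q v = u) : A = B := by
  have key : ∀ {A B : L2 d →ₗ.[ℂ] L2 d}, ActsBy q A T → ActsBy q B T →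
      (∀ u ∈ A.domain, ∃ v, invW q v = u) → A.graph ≤ B.graph := by
    intro A B hA hB hA' p hp
    obtain ⟨v, hv⟩ := hA' p.1 (LinearPMap.mem_domain_of_mem_graph hp)
    have h1 := hA v
    have h2 : p.2 = T v := LinearPMap.mem_graph_snd_inj A hp h1 hv.symm
    have h3 : p = (invW q v, T v) := Prod.ext hv.symm h2
    rw [h3]; exact hB v
  exact LinearPMap.eq_of_eq_graph (le_antisymm (key hA hB hA') (key hB hA hB'))

variable [Countable Λ] (c : ℝ) {a : Λ → E d → ℂ} {q : E d → ℝ}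

/-- Operators with symmetric symbols are closable, being symmetric on a dense domain. -/
lemma isClosable_opCore (hq : IsWeight q) (ha : BddFam (famDiv a q)) (hs : SymmFam a) :
    (opCore (symbOf c a)).IsClosable := by
  set G := invW q with hG
  set K := opB c (famDiv a q) with hK
  -- the symmetry of `Op(a)` on the range of `G`, as self-adjointness of a bounded operator
  have hsa : IsSelfAdjoint (G * K) := by
    rw [hG, hK, invW, fmult_mul_opB c ha hq.bddCont_inv]
    refine opB_isSelfAdjoint c ?_ fun θ ξ => ?_
    · obtain ⟨B, hB, hB'⟩ := ha.bdd
      refine ⟨fun θ => (hq.bddCont_inv.cont.comp (by fun_prop)).mul (ha.cont θ), B, hB,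
        fun θ ξ => ?_⟩
      rw [norm_mul]
      refine (mul_le_of_le_one_left (norm_nonneg _) ?_).trans (hB' θ ξ)
      rw [norm_inv, Complex.norm_real, Real.norm_of_nonneg (hq.pos _).le]
      exact inv_le_one_of_one_le₀ (hq.one_le _)
    · simp only [famDiv, map_mul, map_inv₀, Complex.conj_ofReal, ← hs θ ξ, Submodule.coe_neg,
        add_neg_cancel_right]
      ring
  have hcomm : star K * G = G * K := by
    have h := hsa.star_eq
    rwa [star_mul, star_invW hq] at h
  have hadj : ∀ v v', inner ℂ (K v) (G v') = inner ℂ (G v) (K v') := fun v v' => by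
    rw [← ContinuousLinearMap.adjoint_inner_right, ← ContinuousLinearMap.star_eq_adjoint,
      ← mul_apply_eq_comp, hcomm, mul_apply_eq_comp, ← ContinuousLinearMap.adjoint_inner_left,
      ← ContinuousLinearMap.star_eq_adjoint, star_invW hq]
  -- symmetry passes to the closure of the graph, whose vertical part is thus orthogonal to the
  -- dense range of `G`
  have hcl : ∀ p ∈ (opGraph (symbOf c a)).topologicalClosure, ∀ v',
      inner ℂ p.2 (G v') = inner ℂ p.1 (K v') := by
    intro p hp v'
    have hclosed : IsClosed {p : L2 d × L2 d | inner ℂ p.2 (G v') = inner ℂ p.1 (K v')} :=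
      isClosed_eq (by fun_prop) (by fun_prop)
    refine closure_minimal (fun p hp => ?_) hclosed hp
    obtain ⟨f, rfl⟩ := (mem_opGraph_symbOf c hq ha _).1 hp
    exact hadj _ _
  refine ⟨(opGraph (symbOf c a)).topologicalClosure.toLinearPMap, ?_⟩
  rw [opCore_graph, Submodule.toLinearPMap_graph_eq]
  rintro p hp hp0
  have h := hcl p hp
  simp only [hp0, inner_zero_left] at h
  have h2 : G p.2 = 0 := by
    refine ext_inner_right ℂ fun v' => ?_
    rw [inner_zero_left, ← ContinuousLinearMap.adjoint_inner_right,
      ← ContinuousLinearMap.star_eq_adjoint, star_invW hq]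
    exact h v'
  exact invW_injective hq (h2.trans (map_zero G).symm)

lemma op_graph (hq : IsWeight q) (ha : BddFam (famDiv a q)) (hs : SymmFam a) :
    (op (symbOf c a)).graph = (opGraph (symbOf c a)).topologicalClosure := by
  rw [op, ← (isClosable_opCore c hq ha hs).graph_closure_eq_closure_graph, opCore_graph]

/-- The closure of the operator maps `Op(q)⁻¹ v` to `Op(a / q) v`, for all `v` in `L²`. -/
lemma actsBy_op (hq : IsWeight q) (ha : BddFam (famDiv a q)) (hs : SymmFam a) :
    ActsBy q (op (symbOf c a)) (opB c (famDiv a q)) := fun v => by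
  rw [op_graph c hq ha hs]
  exact mem_closure_opGraph c hq ha v

/-- If the graph norm controls `v`, then the domain of the closure is the range of `Op(q)⁻¹`. -/
lemma exists_of_mem_domain_op (hq : IsWeight q) (ha : BddFam (famDiv a q)) (hs : SymmFam a)
    {C : ℝ} (hC : ∀ v, ‖v‖ ≤ C * (‖invW q v‖ + ‖opB c (famDiv a q) v‖)) :
    ∀ u ∈ (op (symbOf c a)).domain, ∃ v, invW q v = u := by
  intro u hu
  obtain ⟨w, hw⟩ := LinearPMap.mem_domain_iff.1 hu
  set T : L2 d →L[ℂ] L2 d × L2 d := (invW q).prod (opB c (famDiv a q)) with hT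
  -- `T` is bounded below, so its range is closed; it contains the graph on Schwartz functions
  have hclosed : IsClosed (Set.range T) := by
    have hC0 : 0 ≤ max C 0 := le_max_right _ _
    refine AntilipschitzWith.isClosed_range (K := (2 * max C 0).toNNReal) ?_ T.uniformContinuous
    refine T.antilipschitz_of_bound fun v => ?_
    rw [Real.coe_toNNReal _ (by positivity)]
    have h1 : ‖invW q v‖ ≤ ‖T v‖ := le_max_left _ _
    have h2 : ‖opB c (famDiv a q) v‖ ≤ ‖T v‖ := le_max_right _ _
    calc ‖v‖ ≤ C * (‖invW q v‖ + ‖opB c (famDiv a q) v‖) := hC v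
      _ ≤ max C 0 * (‖T v‖ + ‖T v‖) := by
        gcongr
        exact le_max_left _ _
      _ = _ := by ring
  rw [op_graph c hq ha hs] at hw
  have : (u, w) ∈ Set.range T := by
    refine closure_minimal (fun p hp => ?_) hclosed hw
    obtain ⟨f, rfl⟩ := (mem_opGraph_symbOf c hq ha _).1 hp
    exact ⟨_, rfl⟩
  obtain ⟨v, hv⟩ := this
  exact ⟨v, congrArg Prod.fst hv⟩

/-- A bounded symmetric symbol defines a bounded operator. -/
lemma op_eq_bdd (ha : BddFam a) (hs : SymmFam a) : op (symbOf c a) = bdd (opB c a) := by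
  have ha' : BddFam (famDiv a fun _ => 1) := by rwa [famDiv_one]
  have h1 := actsBy_op c isWeight_one ha' hs
  have h2 := ActsBy.bdd (fun _ => 1) (opB c a)
  rw [famDiv_one] at h1
  rw [invW_one, mul_one] at h2
  have h3 : ∀ u : L2 d, ∃ v, invW (fun _ => 1) v = u := fun u => ⟨u, by rw [invW_one]; rfl⟩
  exact h1.eq h2 (fun u _ => h3 u) fun u _ => h3 u

end Closure

end

end PeriodicPDO

namespace PeriodicPDO

noncomputable section

/-! ### Fourier series on a lattice -/

section Lattice

open scoped Pointwise

variable {d : ℕ} (Γ : Submodule ℤ (E d))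

/-- The dual lattice as a subgroup. -/
def dualSub : Submodule ℤ (E d) where
  carrier := dualLattice Γ
  zero_mem' := fun g _ => ⟨0, by simp⟩
  add_mem' := by
    rintro θ θ' h h' g hg
    obtain ⟨n, hn⟩ := h g hg
    obtain ⟨n', hn'⟩ := h' g hg
    exact ⟨n + n', by rw [inner_add_left, hn, hn']; push_cast; ring⟩
  smul_mem' := by
    rintro k θ h g hg
    obtain ⟨n, hn⟩ := h g hg
    refine ⟨k * n, ?_⟩
    rw [← Int.cast_smul_eq_zsmul ℝ, inner_smul_left, hn]
    push_cast
    simp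
    ring

lemma expI_periodic {θ : E d} (hθ : θ ∈ dualLattice Γ) {g : E d} (hg : g ∈ Γ) (x : E d) :
    expI θ (x + g) = expI θ x := by
  obtain ⟨n, hn⟩ := hθ g hg
  rw [expI, expI, inner_add_right, hn]
  have e : Complex.I * ((inner ℝ θ x + 2 * Real.pi * n : ℝ) : ℂ) =
      Complex.I * ((inner ℝ θ x : ℝ) : ℂ) + n * (2 * Real.pi * Complex.I) := by
    push_cast; ring
  rw [e, Complex.exp_add, Complex.exp_int_mul_two_pi_mul_I, mul_one]

lemma expI_zero_left (x : E d) : expI 0 x = 1 := by simp [expI]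

lemma expI_neg_right (θ x : E d) : expI θ (-x) = expI (-θ) x := by
  rw [expI, expI, inner_neg_right, inner_neg_left]

variable [DiscreteTopology Γ] [IsZLattice ℝ Γ]

/-- The basis of the lattice spanning the fundamental domain. -/
def latBasis : Module.Basis (@Module.Free.ChooseBasisIndex ℤ Γ _ _ _ (ZLattice.module_free ℝ Γ))
    ℝ (E d) :=
  haveI : Module.Finite ℤ Γ := ZLattice.module_finite ℝ Γ
  haveI : Module.Free ℤ Γ := ZLattice.module_free ℝ Γ
  (Module.Free.chooseBasis ℤ Γ).ofZLatticeBasis ℝ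

local notation "LI" => @Module.Free.ChooseBasisIndex ℤ Γ _ _ _ (ZLattice.module_free ℝ Γ)

instance fintypeLatIndex : Fintype LI :=
  haveI : Module.Finite ℤ Γ := ZLattice.module_finite ℝ Γ
  haveI : Module.Free ℤ Γ := ZLattice.module_free ℝ Γ
  inferInstance

lemma fundDomain_eq : fundDomain Γ = ZSpan.fundamentalDomain (latBasis Γ) := rfl

lemma latBasis_mem (i : LI) : latBasis Γ i ∈ Γ := by
  have : Module.Finite ℤ Γ := ZLattice.module_finite ℝ Γ
  have : Module.Free ℤ Γ := ZLattice.module_free ℝ Γ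
  unfold latBasis
  rw [Module.Basis.ofZLatticeBasis_apply]
  exact Subtype.coe_prop _

lemma latBasis_repr_int {g : E d} (hg : g ∈ Γ) (i : LI) :
    ∃ n : ℤ, (latBasis Γ).repr g i = n := by
  have : Module.Finite ℤ Γ := ZLattice.module_finite ℝ Γ
  have : Module.Free ℤ Γ := ZLattice.module_free ℝ Γ
  exact ⟨_, Module.Basis.ofZLatticeBasis_repr_apply ℝ Γ (Module.Free.chooseBasis ℤ Γ) ⟨g, hg⟩ i⟩

lemma isAddFundamentalDomain_fundDomain : IsAddFundamentalDomain Γ (fundDomain Γ) volume := by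
  have : Module.Finite ℤ Γ := ZLattice.module_finite ℝ Γ
  have : Module.Free ℤ Γ := ZLattice.module_free ℝ Γ
  exact ZLattice.isAddFundamentalDomain (Module.Free.chooseBasis ℤ Γ) volume

instance discreteTopology_dualSub : DiscreteTopology (dualSub Γ) := by
  refine discreteTopology_of_isOpen_singleton_zero ?_
  have hopen : IsOpen {θ : dualSub Γ | ∀ i : LI, |inner ℝ (θ : E d) (latBasis Γ i)| < 2 * Real.pi} := by
    rw [Set.ofPred_forall]
    exact isOpen_iInter_of_finite fun i => isOpen_lt (by fun_prop) continuous_const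
  convert hopen
  ext θ
  constructor
  · rintro rfl i
    simp [Real.pi_pos]
  · intro h
    have h0 : ∀ i, inner ℝ (θ : E d) (latBasis Γ i) = 0 := fun i => by
      obtain ⟨n, hn⟩ := θ.2 _ (latBasis_mem Γ i)
      have h1 := h i
      rw [hn, abs_mul, abs_of_pos Real.two_pi_pos] at h1
      have h2 : |(n : ℝ)| < 1 := by
        by_contra hc
        have := Real.two_pi_pos
        nlinarith
      have h3 : n = 0 := by
        rw [← Int.abs_lt_one_iff]; exact_mod_cast h2
      rw [hn, h3]; simp
    refine Subtype.ext ?_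
    have h1 : (innerₗ (E d)) (θ : E d) = 0 := (latBasis Γ).ext fun i => h0 i
    exact inner_self_eq_zero.1 (LinearMap.congr_fun h1 (θ : E d))

instance countable_dualSub : Countable (dualSub Γ) := by
  have h := (summable_bracket_inv (dualSub Γ)).countable_support
  have e : Function.support (fun θ : dualSub Γ =>
      (bracket (θ : E d) ^ sumExp (dualSub Γ))⁻¹) = Set.univ := by
    ext θ
    have := bracket_pos (θ : E d)
    simp [this.ne']
  rw [e] at h
  exact Set.countable_univ_iff.1 h

lemma measure_fundDomain_lt_top : (volume : Measure (E d)) (fundDomain Γ) < ⊤ := by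
  rw [fundDomain_eq]
  exact (ZSpan.fundamentalDomain_isBounded (latBasis Γ)).measure_lt_top

lemma measureReal_fundDomain : (volume : Measure (E d)).real (fundDomain Γ) = ZLattice.covolume Γ :=
  (ZLattice.covolume_eq_measure_fundamentalDomain Γ volume
    (isAddFundamentalDomain_fundDomain Γ)).symm

/-- The integral of a periodic function over the fundamental domain is translation invariant. -/
lemma setIntegral_fundDomain_add {f : E d → ℂ} (hf : ∀ g ∈ Γ, ∀ x, f (x + g) = f x) (y : E d) :
    ∫ x in fundDomain Γ, f (x + y) = ∫ x in fundDomain Γ, f x := by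
  have : MeasurableVAdd Γ (E d) := (inferInstance : MeasurableVAdd Γ.toAddSubgroup (E d))
  have : VAddInvariantMeasure Γ (E d) volume :=
    (inferInstance : VAddInvariantMeasure Γ.toAddSubgroup (E d) volume)
  have hm : MeasurableSet (fundDomain Γ) := by
    rw [fundDomain_eq]; exact ZSpan.fundamentalDomain_measurableSet _
  have h1 : ∫ x in fundDomain Γ, f (x + y) =
      ∫ x in (fun x => x - y) ⁻¹' fundDomain Γ, f x := by
    have h := (measurePreserving_sub_right (volume : Measure (E d)) y).setIntegral_preimage_emb
      (measurableEmbedding_subRight y) (fun x => f (x + y)) (fundDomain Γ)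
    rw [← h]
    simp
  rw [h1]
  have h2 : (fun x => x - y) ⁻¹' fundDomain Γ = y +ᵥ fundDomain Γ := by
    ext x
    rw [Set.mem_vadd_set_iff_neg_vadd_mem, vadd_eq_add, neg_add_eq_sub]
    rfl
  rw [h2]
  refine IsAddFundamentalDomain.setIntegral_eq (G := Γ)
    ((isAddFundamentalDomain_fundDomain Γ).vadd_of_comm y)
    (isAddFundamentalDomain_fundDomain Γ) fun g x => ?_
  rw [← hf g g.2 x, add_comm]; rfl

/-- Orthogonality of the exponentials. -/
lemma setIntegral_expI {θ : E d} (hθ : θ ∈ dualLattice Γ) (h0 : θ ≠ 0) :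
    ∫ x in fundDomain Γ, expI θ x = 0 := by
  set y : E d := (Real.pi / ‖θ‖ ^ 2) • θ with hy
  have h1 := setIntegral_fundDomain_add Γ (fun g hg x => expI_periodic Γ hθ hg x) y
  have e : ∀ x, expI θ (x + y) = -expI θ x := fun x => by
    have hn : ‖θ‖ ^ 2 ≠ 0 := by simpa using h0
    rw [expI, expI, inner_add_right, hy, inner_smul_right, real_inner_self_eq_norm_sq,
      div_mul_cancel₀ _ hn]
    push_cast
    rw [mul_add, Complex.exp_add, mul_comm Complex.I (Real.pi : ℂ), Complex.exp_pi_mul_I]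
    ring
  simp only [e, integral_neg] at h1
  linear_combination (-(1 : ℂ) / 2) * h1

/-- The normalization `d(Γ)^{-1/2}` of the Fourier coefficients. -/
def latC : ℝ := 1 / √(ZLattice.covolume Γ)

lemma latC_sq_mul : (latC Γ : ℂ) * latC Γ * (ZLattice.covolume Γ : ℝ) = 1 := by
  have h : 0 < ZLattice.covolume Γ := ZLattice.covolume_pos Γ volume
  rw [← Complex.ofReal_mul, ← Complex.ofReal_mul, latC, div_mul_div_comm, Real.mul_self_sqrt h.le]
  norm_num [h.ne']

lemma integrable_fundDomain {f : E d → ℂ} (hf : Continuous f) {C : ℝ} (hC : ∀ x, ‖f x‖ ≤ C) :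
    IntegrableOn f (fundDomain Γ) := by
  refine Measure.integrableOn_of_bounded (M := C) (measure_fundDomain_lt_top Γ).ne
    hf.aestronglyMeasurable (Eventually.of_forall hC)

lemma symbCoeff_eq (b : Symb d) (θ ξ : E d) :
    symbCoeff Γ b θ ξ = latC Γ * ∫ x in fundDomain Γ, expI θ (-x) * b x ξ := rfl

lemma setIntegral_mul_expI_sub (θ χ : dualSub Γ) (z : ℂ) :
    ∫ x in fundDomain Γ, z * expI ((θ - χ : dualSub Γ) : E d) x =
      if θ = χ then z * (ZLattice.covolume Γ : ℝ) else 0 := by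
  rw [integral_const_mul]
  split_ifs with h
  · subst h
    simp only [sub_self, Submodule.coe_zero, expI_zero_left]
    rw [setIntegral_const, measureReal_fundDomain]
    simp
  · rw [setIntegral_expI Γ (θ - χ).2 fun h' => h (sub_eq_zero.1 (Subtype.ext h')), mul_zero]

/-- An absolutely convergent series of exponentials is integrated term by term; only `θ = χ` survives. -/
lemma hasSum_setIntegral_expI {z : dualSub Γ → ℂ} (hz : Summable fun θ => ‖z θ‖)
    (χ : dualSub Γ) : ∫ x in fundDomain Γ, ∑' θ : dualSub Γ,
      z θ * expI ((θ - χ : dualSub Γ) : E d) x = z χ * (ZLattice.covolume Γ : ℝ) := by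
  have hint : ∀ θ : dualSub Γ, IntegrableOn
      (fun x => z θ * expI ((θ - χ : dualSub Γ) : E d) x) (fundDomain Γ) := fun θ =>
    integrable_fundDomain Γ (continuous_const.mul (continuous_expI_right _)) (C := ‖z θ‖)
      fun x => by rw [norm_mul, norm_expI, mul_one]
  have hn : ∀ θ : dualSub Γ, ∫ x in fundDomain Γ, ‖z θ * expI ((θ - χ : dualSub Γ) : E d) x‖ =
      ZLattice.covolume Γ * ‖z θ‖ := fun θ => by
    simp only [norm_mul, norm_expI, mul_one, setIntegral_const, measureReal_fundDomain,
        smul_eq_mul]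
  have hsum : Summable fun θ : dualSub Γ =>
      ∫ x in fundDomain Γ, ‖z θ * expI ((θ - χ : dualSub Γ) : E d) x‖ := by
    rw [funext hn]
    exact Summable.mul_left _ hz
  have hs := hasSum_integral_of_summable_integral_norm (μ := volume.restrict (fundDomain Γ)) hint
    hsum
  rw [← hs.tsum_eq, tsum_eq_single χ fun θ hθ => by
    rw [setIntegral_mul_expI_sub, if_neg hθ], setIntegral_mul_expI_sub, if_pos rfl]

/-- The Fourier coefficients of the symbol of a family are those of the family. -/
lemma symbCoeff_symbOf {a : dualSub Γ → E d → ℂ} {ξ : E d} (ha : Summable fun θ => ‖a θ ξ‖)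
    (χ : dualSub Γ) : symbCoeff Γ (symbOf (latC Γ) a) χ ξ = a χ ξ := by
  have e : ∀ x, expI (χ : E d) (-x) * symbOf (latC Γ) a x ξ =
      latC Γ * ∑' θ : dualSub Γ, a θ ξ * expI ((θ - χ : dualSub Γ) : E d) x := by
    intro x
    rw [symbOf, mul_left_comm, ← tsum_mul_left]
    congr 1
    refine tsum_congr fun θ => ?_
    rw [Submodule.coe_sub, sub_eq_add_neg, expI_add, expI_neg_right]
    ring
  rw [symbCoeff_eq, funext e, integral_const_mul,
    hasSum_setIntegral_expI Γ (z := fun θ => a θ ξ) ha]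
  have h1 := latC_sq_mul Γ
  linear_combination (a χ ξ) * h1

end Lattice

end

end PeriodicPDO

namespace PeriodicPDO

noncomputable section

section Inversion

open UnitAddTorus

variable {d : ℕ} (Γ : Submodule ℤ (E d)) [DiscreteTopology Γ] [IsZLattice ℝ Γ]

local notation "LI" => @Module.Free.ChooseBasisIndex ℤ Γ _ _ _ (ZLattice.module_free ℝ Γ)

/-- Coordinates with respect to the basis of the lattice. -/
def latCoord : E d ≃L[ℝ] (LI → ℝ) := (latBasis Γ).equivFun.toContinuousLinearEquiv

lemma latCoord_apply (x : E d) (i : LI) : latCoord Γ x i = (latBasis Γ).repr x i := rfl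

lemma latCoord_symm_mem {t : LI → ℝ} (ht : ∀ i, ∃ n : ℤ, t i = n) : (latCoord Γ).symm t ∈ Γ := by
  choose n hn using ht
  have e : (latCoord Γ).symm t = ∑ i, t i • latBasis Γ i :=
    (latBasis Γ).equivFun_symm_apply t
  rw [e]
  refine Submodule.sum_mem _ fun i _ => ?_
  rw [hn i, Int.cast_smul_eq_zsmul]
  exact Submodule.smul_mem _ _ (latBasis_mem Γ i)

/-- The dual vector with integral coordinates `n`. -/
lemma exists_dual_vector (n : LI → ℤ) :
    ∃ θ ∈ dualLattice Γ, ∀ x, inner ℝ θ x = 2 * Real.pi * ∑ i, n i * latCoord Γ x i := by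
  set φ : E d →L[ℝ] ℝ := (2 * Real.pi) • ∑ i, (n i : ℝ) •
    ((ContinuousLinearMap.proj i : (LI → ℝ) →L[ℝ] ℝ) ∘L (latCoord Γ : E d →L[ℝ] (LI → ℝ)))
    with hφ
  have h1 : ∀ x, inner ℝ ((InnerProductSpace.toDual ℝ (E d)).symm φ) x =
      2 * Real.pi * ∑ i, n i * latCoord Γ x i := fun x => by
    rw [InnerProductSpace.toDual_symm_apply, hφ]
    simp
  refine ⟨_, fun g hg => ?_, h1⟩
  choose k hk using fun i => latBasis_repr_int Γ hg i
  refine ⟨∑ i, n i * k i, ?_⟩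
  rw [h1]
  simp only [latCoord_apply, hk]
  push_cast
  rfl

/-- A continuous periodic function whose Fourier coefficients vanish is zero. -/
lemma eq_zero_of_setIntegral_eq_zero {f : E d → ℂ} (hc : Continuous f)
    (hp : ∀ g ∈ Γ, ∀ x, f (x + g) = f x)
    (h0 : ∀ θ ∈ dualLattice Γ, ∫ x in fundDomain Γ, expI θ (-x) * f x = 0) (x : E d) :
    f x = 0 := by
  set T := (latCoord Γ).symm with hT
  set P : (LI → ℝ) → UnitAddTorus LI := Pi.map fun _ t => (t : UnitAddCircle) with hP
  have hPq : IsOpenQuotientMap P := IsOpenQuotientMap.piMap fun _ =>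
    QuotientAddGroup.isOpenQuotientMap_mk
  have hPeq : ∀ s t, P s = P t → f (T s) = f (T t) := by
    intro s t hst
    have h1 : T (s - t) ∈ Γ := latCoord_symm_mem Γ fun i => by
      have h2 : ((s i : ℝ) : UnitAddCircle) = (t i : ℝ) := congrFun hst i
      have h3 : ((s i - t i : ℝ) : UnitAddCircle) = 0 := by
        rw [AddCircle.coe_sub, h2, sub_self]
      obtain ⟨n, hn⟩ := (AddCircle.coe_eq_zero_iff 1).1 h3
      exact ⟨n, by rw [Pi.sub_apply, ← hn]; simp⟩
    have h2 : T s = T t + T (s - t) := by rw [map_sub]; abel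
    rw [h2, hp _ h1]
  have hcT : Continuous fun t => f (T t) := hc.comp T.continuous
  have hPq' : IsQuotientMap (⟨P, hPq.continuous⟩ : C(LI → ℝ, UnitAddTorus LI)) :=
    hPq.isQuotientMap
  set F : C(UnitAddTorus LI, ℂ) := hPq'.lift ⟨fun t => f (T t), hcT⟩ hPeq with hF
  have hFP : ∀ t, F (P t) = f (T t) := fun t =>
    DFunLike.congr_fun (hPq'.lift_comp ⟨fun t => f (T t), hcT⟩ hPeq) t
  -- `F` is `f` on the standard torus; its Fourier coefficients are those of `f`, up to a factor
  have hcoef : mFourierCoeff F = 0 := by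
    funext n
    obtain ⟨θ, hθ, hθx⟩ := exists_dual_vector Γ n
    set s : Set (LI → ℝ) := {t | ∀ i, t i ∈ Set.Ioc (0 : ℝ) (0 + 1)} with hs
    have e1 : ∀ t : LI → ℝ, mFourier (-n) (P t) • F (P t) = expI θ (-(T t)) * f (T t) := by
      intro t
      rw [hFP, smul_eq_mul]
      congr 1
      rw [expI, inner_neg_right, hθx]
      simp only [mFourier, ContinuousMap.coe_mk, hP, Pi.map_apply, fourier_coe_apply]
      rw [← Complex.exp_sum, hT]
      congr 1
      push_cast
      simp only [ContinuousLinearEquiv.apply_symm_apply, Pi.neg_apply, Finset.mul_sum,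
        ← Finset.sum_neg_distrib]
      refine Finset.sum_congr rfl fun i _ => ?_
      push_cast
      ring
    have e2 : s =ᵐ[volume] T ⁻¹' fundDomain Γ := by
      have h1 : s = Set.pi Set.univ fun _ => Set.Ioc (0 : ℝ) 1 := by
        ext t; simp [hs]
      have h2 : T ⁻¹' fundDomain Γ = Set.pi Set.univ fun _ => Set.Ico (0 : ℝ) 1 := by
        ext t
        have : ∀ i, (latBasis Γ).repr (T t) i = t i := fun i => by
          rw [← latCoord_apply, hT, ContinuousLinearEquiv.apply_symm_apply]
        simp [fundDomain_eq, ZSpan.mem_fundamentalDomain, this]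
      rw [h1, h2]
      exact Measure.univ_pi_Ioc_ae_eq_Icc.trans Measure.univ_pi_Ico_ae_eq_Icc.symm
    have e3 : mFourierCoeff F n = ∫ t in s, expI θ (-(T t)) * f (T t) := by
      rw [mFourierCoeff_eq_integral F n 0]
      exact integral_congr_ae (Eventually.of_forall fun t => e1 t)
    rw [e3, setIntegral_congr_set e2]
    set ν : Measure (E d) := Measure.map T volume with hν
    have hme : MeasurableEmbedding T := T.toHomeomorph.measurableEmbedding
    have e4 := (⟨hme.measurable, rfl⟩ : MeasurePreserving T volume ν).setIntegral_preimage_emb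
      hme (fun x => expI θ (-x) * f x) (fundDomain Γ)
    rw [e4]
    -- a linear change of variables only rescales Lebesgue measure
    have e5 : ν = ν.addHaarScalarFactor volume • volume :=
      Measure.isAddLeftInvariant_eq_smul ν volume
    change ∫ x in fundDomain Γ, expI θ (-x) * f x ∂ν = _
    rw [e5, Measure.restrict_smul, integral_smul_nnreal_measure, h0 θ hθ, smul_zero]
    rfl
  have hsum := hasSum_mFourier_series_apply_of_summable (f := F) (by rw [hcoef]; exact summable_zero)
    (P (latCoord Γ x))
  rw [hcoef, hFP, hT, ContinuousLinearEquiv.symm_apply_apply] at hsum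
  simpa using hsum.unique (by simp)

omit [DiscreteTopology Γ] [IsZLattice ℝ Γ] in
/-- The symbol of a family is continuous in `x`. -/
lemma continuous_symbOf_left (c : ℝ) {a : dualSub Γ → E d → ℂ} {ξ : E d}
    (ha : Summable fun θ => ‖a θ ξ‖) : Continuous fun x => symbOf c a x ξ := by
  refine continuous_const.mul (continuous_tsum (u := fun θ => ‖a θ ξ‖)
    (fun θ => continuous_const.mul (continuous_expI_right _)) ha fun θ x => ?_)
  rw [norm_mul, norm_expI, mul_one]

omit [DiscreteTopology Γ] [IsZLattice ℝ Γ] in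
lemma symbOf_periodic (c : ℝ) (a : dualSub Γ → E d → ℂ) {g : E d} (hg : g ∈ Γ) (x ξ : E d) :
    symbOf c a (x + g) ξ = symbOf c a x ξ := by
  unfold symbOf
  congr 1
  exact tsum_congr fun θ => by rw [expI_periodic Γ θ.2 hg]

/-- Fourier inversion: a symbol with absolutely convergent Fourier series is its sum. -/
lemma eq_symbOf {b : Symb d} (hp : ∀ g ∈ Γ, ∀ x ξ, b (x + g) ξ = b x ξ)
    (hc : ∀ ξ, Continuous fun x => b x ξ)
    (hs : ∀ ξ, Summable fun θ : dualSub Γ => ‖symbCoeff Γ b θ ξ‖) :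
    b = symbOf (latC Γ) fun θ : dualSub Γ => symbCoeff Γ b θ := by
  funext x ξ
  set b' := symbOf (latC Γ) fun θ : dualSub Γ => symbCoeff Γ b θ with hb'
  have hc' : Continuous fun x => b' x ξ := continuous_symbOf_left Γ _ (hs ξ)
  have hint : ∀ θ {h : E d → ℂ}, Continuous h → (∀ g ∈ Γ, ∀ x, h (x + g) = h x) →
      IntegrableOn (fun x => expI θ (-x) * h x) (fundDomain Γ) := by
    intro θ h hh hper
    have hcont : Continuous fun x => expI θ (-x) * h x :=
      ((continuous_expI_right θ).comp continuous_neg).mul hh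
    have hb : Bornology.IsBounded (fundDomain Γ) := by
      rw [fundDomain_eq]; exact ZSpan.fundamentalDomain_isBounded (latBasis Γ)
    exact (hcont.continuousOn.integrableOn_compact hb.isCompact_closure).mono_set subset_closure
  have hz : (fun x => b x ξ - b' x ξ) x = 0 := by
    refine eq_zero_of_setIntegral_eq_zero Γ (f := fun x => b x ξ - b' x ξ) ((hc ξ).sub hc')
      (fun g hg x => by rw [hp g hg, hb', symbOf_periodic Γ _ _ hg]) (fun θ hθ => ?_) x
    have h1 := symbCoeff_symbOf Γ (a := fun θ : dualSub Γ => symbCoeff Γ b θ) (hs ξ) ⟨θ, hθ⟩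
    rw [← hb', symbCoeff_eq, symbCoeff_eq] at h1
    have h2 : (latC Γ : ℂ) ≠ 0 := fun h => by
      have := latC_sq_mul Γ
      rw [h] at this; simp at this
    have h3 := mul_left_cancel₀ h2 h1
    simp only [mul_sub]
    rw [integral_sub (hint θ (hc ξ) fun g hg x => hp g hg x ξ)
      (hint θ hc' fun g hg x => symbOf_periodic Γ _ _ hg x ξ), sub_eq_zero]
    exact h3.symm
  exact sub_eq_zero.1 hz

end Inversion

end

end PeriodicPDO

namespace PeriodicPDO

noncomputable section

/-! ### Symbols and their families of Fourier coefficients -/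

section Multilinear

/-- A multilinear map on `ℝ^d` is bounded by its values on tuples of standard basis vectors. -/
lemma norm_multilinear_le {d k : ℕ} (f : ContinuousMultilinearMap ℝ (fun _ : Fin k => E d) ℂ)
    {C : ℝ} (hC : ∀ j : Fin k → Fin d, ‖f fun i => EuclideanSpace.single (j i) (1 : ℝ)‖ ≤ C) :
    ‖f‖ ≤ d ^ k * |C| := by
  refine f.opNorm_le_bound (by positivity) fun v => ?_
  have hv : ∀ i, v i = ∑ j : Fin d, v i j • EuclideanSpace.single j (1 : ℝ) := fun i => by
    ext l
    simp [Finset.sum_apply, Pi.single_apply]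
  have h1 : f v = ∑ j : Fin k → Fin d,
      f fun i => v i (j i) • EuclideanSpace.single (j i) (1 : ℝ) := by
    conv_lhs => rw [funext hv]
    exact f.toMultilinearMap.map_sum _
  rw [h1]
  refine (norm_sum_le _ _).trans ?_
  calc _ ≤ ∑ _j : Fin k → Fin d, (∏ i, ‖v i‖) * |C| := by
        refine Finset.sum_le_sum fun j _ => ?_
        rw [f.map_smul_univ, norm_smul, norm_prod]
        gcongr with i _
        · exact PiLp.norm_apply_le _ _
        · exact (hC j).trans (le_abs_self C)
    _ = _ := by
        rw [Finset.sum_const, Finset.card_univ, Fintype.card_fun, Fintype.card_fin,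
          Fintype.card_fin, nsmul_eq_mul]
        push_cast
        ring

end Multilinear

section Translate

variable {d : ℕ} (Γ : Submodule ℤ (E d)) [DiscreteTopology Γ] [IsZLattice ℝ Γ] {β α γ : ℝ}

/-- The Fourier coefficients of a symbol as a family over the dual lattice. -/
def coeffFam (b : Symb d) : dualSub Γ → E d → ℂ := fun θ => symbCoeff Γ b θ

variable {Γ}

lemma FamBound.norm_apply_le {Λ : Submodule ℤ (E d)} {a : Λ → E d → ℂ} {q : ℕ} {C : ℝ}
    (h : FamBound β γ q a C) (θ : Λ) (ξ : E d) :
    ‖a θ ξ‖ ≤ C * weight β ξ ^ γ * (bracket (θ : E d) ^ q)⁻¹ := by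
  have h1 := h.norm_le (Nat.zero_le q) θ ξ
  simp only [norm_iteratedFDeriv_zero, Nat.cast_zero, sub_zero] at h1
  refine h1.trans (le_of_eq ?_)
  rw [div_eq_mul_inv]; ring

lemma FamBound.summable {Λ : Submodule ℤ (E d)} [DiscreteTopology Λ] {a : Λ → E d → ℂ} {C : ℝ}
    (h : FamBound β γ (sumExp Λ) a C) (ξ : E d) : Summable fun θ => ‖a θ ξ‖ :=
  summable_of_le_bracket Λ (fun _ => norm_nonneg _) fun θ => h.norm_apply_le θ ξ

lemma symbNorm_mono (w : E d → ℝ) (hw : ∀ ξ, 0 < w ξ) {l l' : ℝ≥0} {s s' : ℕ} (hl : l ≤ l')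
    (hs : s ≤ s') (b : Symb d) : symbNorm Γ w α l s b ≤ symbNorm Γ w α l' s' b := by
  unfold symbNorm
  refine iSup_le fun k => iSup_le fun hk => iSup_le fun j => iSup_le fun ξ => iSup_le fun θ => ?_
  refine le_trans ?_ (le_iSup_of_le k (le_iSup_of_le (hk.trans hs) (le_iSup_of_le j
    (le_iSup_of_le ξ (le_iSup_of_le θ le_rfl)))))
  have := Real.rpow_nonneg (hw ξ).le (-α + k)
  gcongr
  exact one_le_bracket _

/-- The seminorms of a symbol bound its family of Fourier coefficients. -/
lemma famBound_coeffFam {b : Symb d} (q : ℕ)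
    (h : symbNorm Γ (weight β) α q q b < ⊤) : FamBound β α q (coeffFam Γ b)
      ((d + 1 : ℝ) ^ q * (symbNorm Γ (weight β) α q q b).toReal) := by
  intro k hk θ ξ
  set N := (symbNorm Γ (weight β) α q q b).toReal with hN
  have hw := weight_pos β ξ
  have hbr := bracket_pos (θ : E d)
  have hN0 : 0 ≤ N := ENNReal.toReal_nonneg
  have h1 : ∀ j : Fin k → Fin d, ‖iteratedFDeriv ℝ k (coeffFam Γ b θ) ξ
      fun i => EuclideanSpace.single (j i) (1 : ℝ)‖ ≤
      N * weight β ξ ^ (α - k) * (bracket (θ : E d) ^ q)⁻¹ := by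
    intro j
    have h2 : ENNReal.ofReal (bracket (θ : E d) ^ ((q : ℝ≥0) : ℝ) * weight β ξ ^ (-α + (k : ℝ)) *
        ‖iteratedFDeriv ℝ k (coeffFam Γ b θ) ξ
          fun i => EuclideanSpace.single (j i) (1 : ℝ)‖) ≤ symbNorm Γ (weight β) α q q b := by
      unfold symbNorm
      exact le_iSup_of_le k (le_iSup_of_le hk (le_iSup_of_le j (le_iSup_of_le ξ
        (le_iSup_of_le (⟨θ, θ.2⟩ : dualLattice Γ) le_rfl))))
    rw [ENNReal.ofReal_le_iff_le_toReal h.ne, ← hN, NNReal.coe_natCast, Real.rpow_natCast,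
      show -α + (k : ℝ) = -(α - k) by ring, Real.rpow_neg hw.le] at h2
    have hw2 := Real.rpow_pos_of_pos hw (α - k)
    rw [← div_eq_mul_inv, le_div_iff₀ (by positivity)]
    calc _ = (bracket (θ : E d) ^ q * (weight β ξ ^ (α - k))⁻¹ *
          ‖iteratedFDeriv ℝ k (coeffFam Γ b θ) ξ
            fun i => EuclideanSpace.single (j i) (1 : ℝ)‖) * weight β ξ ^ (α - k) := by
          field_simp
      _ ≤ _ := mul_le_mul_of_nonneg_right h2 hw2.le
  have h3 := norm_multilinear_le _ h1
  have hw2 := Real.rpow_pos_of_pos hw (α - k)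
  rw [abs_of_nonneg (by positivity)] at h3
  calc _ ≤ (d ^ k * (N * weight β ξ ^ (α - k) * (bracket (θ : E d) ^ q)⁻¹)) *
        bracket (θ : E d) ^ q := by gcongr
    _ = d ^ k * (N * weight β ξ ^ (α - k)) := by field_simp
    _ ≤ (d + 1 : ℝ) ^ q * (N * weight β ξ ^ (α - k)) := by
        gcongr
        calc (d : ℝ) ^ k ≤ (d + 1 : ℝ) ^ k := by gcongr; linarith
          _ ≤ (d + 1 : ℝ) ^ q := by gcongr; linarith [Nat.cast_nonneg (α := ℝ) d]
    _ = _ := by ring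

/-- A family with summable values at each frequency. -/
def SumFam {Λ : Submodule ℤ (E d)} (a : Λ → E d → ℂ) : Prop := ∀ ξ, Summable fun θ => ‖a θ ξ‖

lemma coeffFam_symbOf {a : dualSub Γ → E d → ℂ} (ha : SumFam a) :
    coeffFam Γ (symbOf (latC Γ) a) = a := by
  funext θ ξ
  exact symbCoeff_symbOf Γ (ha ξ) θ

/-- The bounds of a family bound the seminorms of its symbol. -/
lemma symbNorm_symbOf_le {a : dualSub Γ → E d → ℂ} (ha : SumFam a) {q : ℕ} {C : ℝ}
    (h : FamBound β γ q a C) {l : ℝ≥0} {s : ℕ} (hl : l ≤ q) (hs : s ≤ q) :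
    symbNorm Γ (weight β) γ l s (symbOf (latC Γ) a) ≤ ENNReal.ofReal C := by
  unfold symbNorm
  refine iSup_le fun k => iSup_le fun hk => iSup_le fun j => iSup_le fun ξ => iSup_le fun θ => ?_
  refine ENNReal.ofReal_le_ofReal ?_
  set θ' : dualSub Γ := ⟨θ, θ.2⟩ with hθ'
  have e : (fun η => symbCoeff Γ (symbOf (latC Γ) a) (θ : E d) η) = a θ' := by
    funext η
    exact symbCoeff_symbOf Γ (ha η) θ'
  rw [e]
  have hw := weight_pos β ξ
  have hbr := one_le_bracket (θ : E d)
  have hw2 := Real.rpow_pos_of_pos hw (γ - k)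
  have h1 := h k (hk.trans hs) θ' ξ
  have h2 : ‖iteratedFDeriv ℝ k (a θ') ξ fun i => EuclideanSpace.single (j i) (1 : ℝ)‖ ≤
      ‖iteratedFDeriv ℝ k (a θ') ξ‖ := by
    refine (ContinuousMultilinearMap.le_opNorm _ _).trans (le_of_eq ?_)
    simp
  have h3 : bracket (θ : E d) ^ (l : ℝ) ≤ bracket (θ : E d) ^ q := by
    rw [← Real.rpow_natCast]
    exact Real.rpow_le_rpow_of_exponent_le hbr (by exact_mod_cast hl)
  rw [show -γ + (k : ℝ) = -(γ - k) by ring, Real.rpow_neg hw.le]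
  calc _ ≤ bracket (θ : E d) ^ q * (weight β ξ ^ (γ - k))⁻¹ * ‖iteratedFDeriv ℝ k (a θ') ξ‖ := by
        gcongr
    _ = (‖iteratedFDeriv ℝ k (a θ') ξ‖ * bracket (θ' : E d) ^ q) * (weight β ξ ^ (γ - k))⁻¹ := by
        ring
    _ ≤ (C * weight β ξ ^ (γ - k)) * (weight β ξ ^ (γ - k))⁻¹ := by gcongr
    _ = C := by field_simp

/-- Families of order `γ`. -/
structure InClass {Λ : Submodule ℤ (E d)} (β γ : ℝ) (a : Λ → E d → ℂ) : Prop where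
  smooth : SmoothFam a
  bound : ∀ q, ∃ C, 0 ≤ C ∧ FamBound β γ q a C

lemma InClass.sumFam {Λ : Submodule ℤ (E d)} [DiscreteTopology Λ] {a : Λ → E d → ℂ}
    (ha : InClass β γ a) : SumFam a := fun ξ => by
  obtain ⟨C, -, hC⟩ := ha.bound (sumExp Λ)
  exact hC.summable ξ

lemma InClass.memSymb {a : dualSub Γ → E d → ℂ} (ha : InClass β γ a) :
    MemSymb Γ (weight β) γ (symbOf (latC Γ) a) where
  periodic _ hg x ξ := symbOf_periodic Γ _ a hg x ξ
  continuous ξ := continuous_symbOf_left Γ _ (ha.sumFam ξ)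
  smooth θ hθ := by
    have h := congrFun (coeffFam_symbOf ha.sumFam) ⟨θ, hθ⟩
    have h2 := ha.smooth ⟨θ, hθ⟩
    rw [← h] at h2
    exact h2
  finite l s := by
    obtain ⟨C, -, hC⟩ := ha.bound (max ⌈l⌉₊ s)
    refine (symbNorm_symbOf_le ha.sumFam hC ?_ (le_max_right _ _)).trans_lt ENNReal.ofReal_lt_top
    exact (Nat.le_ceil l).trans (by exact_mod_cast le_max_left _ _)

lemma SymmFam.isSymmSymb {a : dualSub Γ → E d → ℂ} (hs : SymmFam a) (ha : SumFam a) :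
    IsSymmSymb Γ (symbOf (latC Γ) a) := fun θ hθ ξ => by
  have h := coeffFam_symbOf ha
  have h1 : symbCoeff Γ (symbOf (latC Γ) a) θ ξ = a ⟨θ, hθ⟩ ξ :=
    congrFun (congrFun h ⟨θ, hθ⟩) ξ
  have h2 : symbCoeff Γ (symbOf (latC Γ) a) (-θ) (ξ + θ) = a (-⟨θ, hθ⟩) (ξ + θ) :=
    congrFun (congrFun h (-⟨θ, hθ⟩)) (ξ + θ)
  rw [h1, h2]
  exact hs ⟨θ, hθ⟩ ξ

section MemSymb

variable {b : Symb d} (hb : MemSymb Γ (weight β) α b)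
include hb

lemma MemSymb.inClass : InClass β α (coeffFam Γ b) :=
  ⟨fun θ => hb.smooth θ θ.2, fun q => ⟨_, by positivity, famBound_coeffFam q (hb.finite q q)⟩⟩

lemma MemSymb.eq_symbOf : b = symbOf (latC Γ) (coeffFam Γ b) :=
  PeriodicPDO.eq_symbOf Γ hb.periodic hb.continuous hb.inClass.sumFam

end MemSymb

/-! ### The parts of a symbol as families -/

open Classical in
/-- Restriction of a family to `T` with cut-offs `g`. -/
def cutFam {Λ : Submodule ℤ (E d)} (T : Set (E d)) (g : E d → E d → ℝ) (a : Λ → E d → ℂ) :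
    Λ → E d → ℂ := fun θ ξ => if (θ : E d) ∈ T then a θ ξ * (g θ ξ : ℂ) else 0

/-- Cutting off a symbol amounts to cutting off its family of coefficients. -/
lemma cutSymb_symbOf {a : dualSub Γ → E d → ℂ} (ha : SumFam a) {T : Set (E d)}
    (hT : T ⊆ dualLattice Γ) (g : E d → E d → ℝ) :
    cutSymb Γ T g (symbOf (latC Γ) a) = symbOf (latC Γ) (cutFam T g a) := by
  classical
  funext x ξ
  unfold cutSymb symbOf
  change (latC Γ : ℂ) * _ = _
  congr 1
  set h : E d → ℂ := fun θ => symbCoeff Γ (symbOf (latC Γ) a) θ ξ * (g θ ξ : ℂ) * expI θ x with hh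
  have e1 : ∑' θ : T, h θ = ∑' θ, T.indicator h θ := tsum_subtype T h
  have e2 : ∑' θ : dualSub Γ, T.indicator h θ =
      ∑' θ, (dualLattice Γ).indicator (T.indicator h) θ :=
    tsum_subtype (dualLattice Γ) (T.indicator h)
  rw [Set.indicator_indicator, Set.inter_eq_self_of_subset_right hT, ← e1] at e2
  change ∑' θ : T, h θ = _
  rw [← e2]
  refine tsum_congr fun θ => ?_
  have e3 : symbCoeff Γ (symbOf (latC Γ) a) θ ξ = a θ ξ := symbCoeff_symbOf Γ (ha ξ) θ
  simp only [Set.indicator, cutFam, hh, e3]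
  split_ifs <;> simp

lemma partZero_symbOf {a : dualSub Γ → E d → ℂ} (ha : SumFam a) :
    partZero Γ (symbOf (latC Γ) a) = symbOf (latC Γ) (cutFam {0} (fun _ _ => 1) a) := by
  classical
  funext x ξ
  have e3 : symbCoeff Γ (symbOf (latC Γ) a) 0 ξ = a 0 ξ := symbCoeff_symbOf Γ (ha ξ) 0
  unfold partZero
  rw [e3, symbOf, tsum_eq_single 0 fun θ hθ => ?_]
  · simp [cutFam, expI_zero_left, latC]
  · have : (θ : E d) ≠ 0 := fun h => hθ (Subtype.ext h)
    simp [cutFam, this]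

lemma norm_cutFam_le {Λ : Submodule ℤ (E d)} {T : Set (E d)} {g : E d → E d → ℝ}
    (hg : ∀ θ ξ, |g θ ξ| ≤ 1) (a : Λ → E d → ℂ) (θ : Λ) (ξ : E d) :
    ‖cutFam T g a θ ξ‖ ≤ ‖a θ ξ‖ := by
  unfold cutFam
  split_ifs
  · rw [norm_mul, Complex.norm_real, Real.norm_eq_abs]
    exact mul_le_of_le_one_right (norm_nonneg _) (hg θ ξ)
  · simp

lemma SymmFam.cutFam {Λ : Submodule ℤ (E d)} {T : Set (E d)} {g : E d → E d → ℝ} {a : Λ → E d → ℂ}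
    (ha : SymmFam a) (hT : ∀ θ, -θ ∈ T ↔ θ ∈ T) (hg : ∀ θ ξ, g (-θ) (ξ + θ) = g θ ξ) :
    SymmFam (cutFam T g a) := fun θ ξ => by
  unfold PeriodicPDO.cutFam
  by_cases h : (θ : E d) ∈ T
  · rw [if_pos h, if_pos (show ((-θ : Λ) : E d) ∈ T from (hT θ).2 h), Submodule.coe_neg, hg,
      map_mul, Complex.conj_ofReal, ← ha θ ξ]
  · rw [if_neg h, if_neg (show ((-θ : Λ) : E d) ∉ T from mt (hT θ).1 h), map_zero]

end Translate

end

end PeriodicPDO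

namespace PeriodicPDO

noncomputable section

/-! ### Families of operators relative to the kinetic energy -/

section EnergyWeight

variable {d : ℕ}

/-- The weight `1 + |ξ|^{2m}`; its inverse defines the resolvent `(1 + H₀)⁻¹`. -/
def enWeight (m : ℝ) (ξ : E d) : ℝ := 1 + kin m ξ

lemma kin_nonneg (m : ℝ) (ξ : E d) : 0 ≤ kin m ξ := Real.rpow_nonneg (norm_nonneg _) _

lemma continuous_kin {m : ℝ} (hm : 0 < m) : Continuous (kin m : E d → ℝ) :=
  continuous_norm.rpow_const fun _ => Or.inr (by positivity)

lemma isWeight_enWeight {m : ℝ} (hm : 0 < m) : IsWeight (enWeight m : E d → ℝ) where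
  cont := continuous_const.add (continuous_kin hm)
  one_le ξ := by unfold enWeight; linarith [kin_nonneg m ξ]
  growth := by
    refine ⟨2, ⌈2 * m⌉₊, fun ξ => ?_⟩
    have h : kin m ξ ≤ 1 + ‖ξ‖ ^ ⌈2 * m⌉₊ := by
      unfold kin
      rcases le_total ‖ξ‖ 1 with h1 | h1
      · have := Real.rpow_le_one (norm_nonneg ξ) h1 (by positivity : 0 ≤ 2 * m)
        have : 0 ≤ ‖ξ‖ ^ ⌈2 * m⌉₊ := by positivity
        linarith
      · have := Real.rpow_le_rpow_of_exponent_le h1 (Nat.le_ceil (2 * m))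
        rw [Real.rpow_natCast] at this
        linarith
    have : 0 ≤ ‖ξ‖ ^ ⌈2 * m⌉₊ := by positivity
    unfold enWeight
    linarith

lemma bracket_rpow_le {m : ℝ} (hm : 0 < m) (ξ : E d) :
    bracket ξ ^ (2 * m) ≤ 2 ^ (2 * m) * enWeight m ξ := by
  have hk := kin_nonneg m ξ
  have h2 : (0 : ℝ) < 2 ^ (2 * m) := by positivity
  have hb := bracket_le_one_add_norm ξ
  have hb0 := bracket_pos ξ
  unfold enWeight
  rcases le_total ‖ξ‖ 1 with h1 | h1
  · have : bracket ξ ^ (2 * m) ≤ 2 ^ (2 * m) :=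
      Real.rpow_le_rpow hb0.le (by linarith) (by positivity)
    nlinarith
  · have : bracket ξ ^ (2 * m) ≤ (2 * ‖ξ‖) ^ (2 * m) :=
      Real.rpow_le_rpow hb0.le (by linarith) (by positivity)
    rw [Real.mul_rpow (by norm_num) (norm_nonneg _)] at this
    change _ ≤ 2 ^ (2 * m) * kin m ξ at this
    linarith

/-- A symbol of order `α` with `αβ < 2m` is of lower order than `H₀`. -/
lemma exists_weight_rpow_le {m α β : ℝ} (hm : 0 < m) (h : α * β < 2 * m) :
    ∃ s C : ℝ, 0 ≤ s ∧ s < 1 ∧ 0 ≤ C ∧ ∀ ξ : E d, weight β ξ ^ α ≤ C * enWeight m ξ ^ s := by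
  set s := max 0 (α * β / (2 * m)) with hs
  have hs0 : 0 ≤ s := le_max_left _ _
  refine ⟨s, (2 ^ (2 * m)) ^ s, hs0, max_lt one_pos ((div_lt_one (by positivity)).2 h),
    by positivity, fun ξ => ?_⟩
  have hq := kin_nonneg m ξ
  have h1 : α * β ≤ 2 * m * s := by
    have := le_max_right 0 (α * β / (2 * m))
    rw [← hs, div_le_iff₀ (by positivity)] at this
    linarith
  calc weight β ξ ^ α = bracket ξ ^ (α * β) := by
        rw [weight, ← Real.rpow_mul (bracket_pos ξ).le, mul_comm]
    _ ≤ bracket ξ ^ (2 * m * s) := Real.rpow_le_rpow_of_exponent_le (one_le_bracket ξ) h1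
    _ = (bracket ξ ^ (2 * m)) ^ s := Real.rpow_mul (bracket_pos ξ).le _ _
    _ ≤ (2 ^ (2 * m) * enWeight m ξ) ^ s :=
        Real.rpow_le_rpow (Real.rpow_nonneg (bracket_pos ξ).le _) (bracket_rpow_le hm ξ) hs0
    _ = _ := Real.mul_rpow (by positivity) (by unfold enWeight; positivity)

/-- Translations change the weight by a bounded factor. -/
lemma exists_enWeight_add_le {m : ℝ} (hm : 0 < m) (θ : E d) :
    ∃ C : ℝ, ∀ ξ : E d, enWeight m (ξ + θ) ≤ C * enWeight m ξ := by
  refine ⟨1 + (2 * bracket θ) ^ (2 * m) * 2 ^ (2 * m), fun ξ => ?_⟩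
  have h1 : kin m (ξ + θ) ≤ (2 * bracket θ) ^ (2 * m) * bracket ξ ^ (2 * m) := by
    rw [← Real.mul_rpow (by have := bracket_pos θ; positivity) (bracket_pos ξ).le]
    refine Real.rpow_le_rpow (norm_nonneg _) ?_ (by positivity)
    exact (norm_le_bracket _).trans ((bracket_add_le ξ θ).trans (le_of_eq (by ring)))
  have h2 := bracket_rpow_le hm ξ
  have h3 : (0 : ℝ) ≤ (2 * bracket θ) ^ (2 * m) :=
    Real.rpow_nonneg (by have := bracket_pos θ; positivity) _
  have h4 := (isWeight_enWeight hm).one_le ξ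
  have h5 := mul_le_mul_of_nonneg_left h2 h3
  have h6 : enWeight m (ξ + θ) = 1 + kin m (ξ + θ) := rfl
  nlinarith

end EnergyWeight

section Families

variable {d : ℕ} {Λ : Submodule ℤ (E d)} {m α β γ : ℝ} {a a' : Λ → E d → ℂ}

/-- The family of the Fourier multiplier with symbol `f`. -/
def diagFam (c : ℝ) (f : E d → ℂ) : Λ → E d → ℂ := fun θ ξ =>
  open Classical in if θ = 0 then (c : ℂ)⁻¹ * f ξ else 0

lemma famDiv_diagFam (c : ℝ) (f : E d → ℂ) (q : E d → ℝ) :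
    famDiv (diagFam (Λ := Λ) c f) q = diagFam c fun ξ => f ξ * (q ξ : ℂ)⁻¹ := by
  funext θ ξ
  unfold famDiv diagFam
  split_ifs <;> ring

lemma diagFam_ne {c : ℝ} {f : E d → ℂ} {θ : Λ} (h : θ ≠ 0) : diagFam c f θ = 0 := by
  funext ξ; simp [diagFam, h]

lemma symbOf_diagFam {c : ℝ} (hc : c ≠ 0) (f : E d → ℂ) :
    symbOf c (diagFam (Λ := Λ) c f) = fun _ ξ => f ξ := by
  funext x ξ
  have hc' : (c : ℂ) ≠ 0 := by exact_mod_cast hc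
  rw [symbOf, tsum_eq_single 0 fun θ hθ => by simp [diagFam, hθ]]
  simp only [diagFam, if_true, Submodule.coe_zero, expI_zero_left, mul_one]
  field_simp

lemma bddFam_diagFam (c : ℝ) {f : E d → ℂ} (hf : BddCont f) : BddFam (diagFam (Λ := Λ) c f) := by
  refine BddFam.of_finset {0} (fun θ hθ => diagFam_ne (by simpa using hθ)) fun θ => ?_
  by_cases h : θ = 0
  · have e : diagFam (Λ := Λ) c f θ = fun ξ => (c : ℂ)⁻¹ * f ξ := by funext ξ; simp [diagFam, h]
    rw [e]
    exact BddCont.mul ⟨continuous_const, _, fun _ => le_rfl⟩ hf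
  · rw [diagFam_ne h]
    exact ⟨continuous_const, 0, fun _ => by simp⟩

lemma opB_diagFam {c : ℝ} (hc : c ≠ 0) {f : E d → ℂ} (hf : BddCont f) :
    opB c (diagFam (Λ := Λ) c f) = fmult f := by
  have hc' : (c : ℂ) ≠ 0 := by exact_mod_cast hc
  unfold opB fmult
  rw [opFreq_of_finset c {0} fun θ hθ => diagFam_ne (by simpa using hθ), Finset.sum_singleton,
    Submodule.coe_zero, ← elemOp_smul]
  · congr 2
    funext ξ
    simp only [diagFam, if_true]
    field_simp
  · exact (bddFam_diagFam c hf).bddCont 0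

lemma symmFam_diagFam (c : ℝ) (f : E d → ℝ) : SymmFam (diagFam (Λ := Λ) c fun ξ => (f ξ : ℂ)) :=
  fun θ ξ => by
    by_cases h : θ = 0
    · subst h
      simp [diagFam]
    · rw [diagFam_ne h, diagFam_ne (neg_ne_zero.2 h)]; simp

lemma sumFam_diagFam (c : ℝ) (f : E d → ℂ) : SumFam (diagFam (Λ := Λ) c f) := fun ξ =>
  summable_of_ne_finset_zero (s := {0}) fun θ hθ => by
    rw [diagFam_ne (by simpa using hθ)]; simp

lemma symbOf_add [Countable Λ] (c : ℝ) (ha : SumFam a) (hb : SumFam a') :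
    symbOf c (a + a') = symbOf c a + symbOf c a' := by
  have key : ∀ {a : Λ → E d → ℂ}, SumFam a → ∀ x ξ, Summable fun θ => a θ ξ * expI (θ : E d) x :=
    fun ha x ξ => Summable.of_norm (by simpa [norm_mul, norm_expI] using ha ξ)
  funext x ξ
  simp only [symbOf, Pi.add_apply, add_mul]
  rw [(key ha x ξ).tsum_add (key hb x ξ), mul_add]

/-- The value of `H₀ (1 + H₀)⁻¹`. -/
lemma opB_kin {c : ℝ} (hc : c ≠ 0) (hm : 0 < m) :
    opB c (famDiv (diagFam (Λ := Λ) c fun ξ => (kin m ξ : ℂ)) (enWeight m)) =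
      1 - invW (enWeight m) := by
  have hq := isWeight_enWeight (d := d) hm
  have h1 : BddCont fun _ : E d => (1 : ℂ) := ⟨continuous_const, 1, fun _ => by simp⟩
  have e : famDiv (diagFam (Λ := Λ) c fun ξ => (kin m ξ : ℂ)) (enWeight m) =
      diagFam c (fun _ => 1) - diagFam c fun ξ => (enWeight m ξ : ℂ)⁻¹ := by
    rw [famDiv_diagFam]
    funext θ ξ
    have h0 : ((enWeight m ξ : ℝ) : ℂ) ≠ 0 := hq.ne_zero ξ
    have h2 : (kin m ξ : ℂ) = enWeight m ξ - 1 := by unfold enWeight; push_cast; ring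
    simp only [diagFam, Pi.sub_apply]
    split_ifs
    · rw [h2]; field_simp
    · simp
  rw [e, opB_sub c (bddFam_diagFam c h1) (bddFam_diagFam c hq.bddCont_inv),
    opB_diagFam hc h1, opB_diagFam hc hq.bddCont_inv, fmult_one, invW]

lemma bddFam_famDiv_diagFam (c : ℝ) (hm : 0 < m) :
    BddFam (famDiv (diagFam (Λ := Λ) c fun ξ => (kin m ξ : ℂ)) (enWeight m)) := by
  have hq := isWeight_enWeight (d := d) hm
  rw [famDiv_diagFam]
  refine bddFam_diagFam c ⟨?_, 1, fun ξ => ?_⟩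
  · exact (Complex.continuous_ofReal.comp (continuous_kin hm)).mul hq.bddCont_inv.cont
  · rw [norm_mul, norm_inv, Complex.norm_real, Complex.norm_real,
      Real.norm_of_nonneg (kin_nonneg m ξ), Real.norm_of_nonneg (hq.pos ξ).le,
      ← div_eq_mul_inv, div_le_one (hq.pos ξ)]
    unfold enWeight; linarith

lemma InClass.continuous (ha : InClass β γ a) (θ : Λ) : Continuous (a θ) := (ha.smooth θ).continuous

lemma FamBound.norm_le_of_order_zero {C : ℝ} (h : FamBound β 0 (sumExp Λ) a C) (θ : Λ) (ξ : E d) :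
    ‖a θ ξ‖ ≤ C * (bracket (θ : E d) ^ sumExp Λ)⁻¹ := by
  simpa using h.norm_apply_le θ ξ

variable [DiscreteTopology Λ]

/-- A family dominated by one of order `α`, with `αβ < 2m`, is relatively bounded with respect to
`H₀`. -/
lemma exists_le_enWeight_rpow (hm : 0 < m) (h : α * β < 2 * m) (ha : InClass β α a) :
    ∃ (s : ℝ) (B : Λ → ℝ), 0 ≤ s ∧ s < 1 ∧ Summable B ∧ (∀ θ, 0 ≤ B θ) ∧
      ∀ θ ξ, ‖a θ ξ‖ ≤ B θ * enWeight m ξ ^ s := by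
  obtain ⟨s, C, hs0, hs1, hC, hw⟩ := exists_weight_rpow_le (d := d) hm h
  obtain ⟨A, hA0, hA⟩ := ha.bound (sumExp Λ)
  refine ⟨s, fun θ => A * C * (bracket (θ : E d) ^ sumExp Λ)⁻¹, hs0, hs1,
    (summable_bracket_inv Λ).mul_left _, fun θ => ?_, fun θ ξ => ?_⟩
  · have := bracket_pos (θ : E d); positivity
  · have hb := bracket_pos (θ : E d)
    calc _ ≤ A * weight β ξ ^ α * (bracket (θ : E d) ^ sumExp Λ)⁻¹ := hA.norm_apply_le θ ξ
      _ ≤ A * (C * enWeight m ξ ^ s) * (bracket (θ : E d) ^ sumExp Λ)⁻¹ := by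
        gcongr; exact hw ξ
      _ = _ := by ring

lemma bddFam_famDiv (hm : 0 < m) (h : α * β < 2 * m) (ha : InClass β α a)
    (hc : ∀ θ, Continuous (a' θ)) (hle : ∀ θ ξ, ‖a' θ ξ‖ ≤ ‖a θ ξ‖) :
    BddFam (famDiv a' (enWeight m)) := by
  obtain ⟨s, B, hs0, hs1, hB, hB0, hle'⟩ := exists_le_enWeight_rpow hm h ha
  have hq := isWeight_enWeight (d := d) hm
  refine ⟨fun θ => (hc θ).mul hq.bddCont_inv.cont, B, hB, fun θ ξ => ?_⟩
  unfold famDiv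
  rw [norm_mul, norm_inv, Complex.norm_real, Real.norm_of_nonneg (hq.pos ξ).le,
    ← div_eq_mul_inv, div_le_iff₀ (hq.pos ξ)]
  refine (hle θ ξ).trans ((hle' θ ξ).trans ?_)
  have := hB0 θ
  gcongr
  exact (Real.rpow_le_rpow_of_exponent_le (hq.one_le ξ) hs1.le).trans (Real.rpow_one _).le

/-- Families of order zero define bounded operators. -/
lemma InClass.bddFam (ha : InClass β 0 a) : BddFam a := by
  obtain ⟨C, -, hC⟩ := ha.bound (sumExp Λ)
  exact ⟨ha.continuous, _, (summable_bracket_inv Λ).mul_left C, hC.norm_le_of_order_zero⟩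

lemma norm_opB_le_of_famBound (c : ℝ) (ha : InClass β 0 a) {C : ℝ}
    (h : FamBound β 0 (sumExp Λ) a C) : ‖opB c a‖ ≤ |c| * latSum Λ * C := by
  refine (norm_opB_le c ha.bddFam ((summable_bracket_inv Λ).mul_left C)
    h.norm_le_of_order_zero).trans (le_of_eq ?_)
  rw [tsum_mul_left, latSum]; ring

/-- Symbols of order `α`, `αβ < 2m`, have relative bound zero with respect to `H₀`. -/
lemma exists_relative_bound (c : ℝ) (hm : 0 < m) (h : α * β < 2 * m) (ha : InClass β α a) :
    ∃ C : ℝ, 0 ≤ C ∧ ∀ v, ‖opB c (famDiv a (enWeight m)) v‖ ≤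
      2⁻¹ * ‖v‖ + C * ‖invW (enWeight m) v‖ := by
  obtain ⟨s, B, hs0, hs1, hB, hB0, hle⟩ := exists_le_enWeight_rpow hm h ha
  have hq := isWeight_enWeight (d := d) hm
  set q : E d → ℝ := enWeight m with hqdef
  set L := |c| * ∑' θ, B θ with hL
  have hL0 : 0 ≤ L := mul_nonneg (abs_nonneg _) (tsum_nonneg hB0)
  -- `R` is so large that `L R^{s-1} ≤ 1/2`
  obtain ⟨R, hR1, hR⟩ : ∃ R : ℝ, 1 ≤ R ∧ L * R ^ (s - 1) ≤ 2⁻¹ := by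
    have h1 : Tendsto (fun R : ℝ => L * R ^ (-(1 - s))) atTop (𝓝 (L * 0)) :=
      (tendsto_rpow_neg_atTop (by linarith)).const_mul L
    rw [mul_zero] at h1
    obtain ⟨R, hR1, hR⟩ :=
      ((eventually_ge_atTop (1 : ℝ)).and (h1.eventually_le_const (by norm_num : (0 : ℝ) < 2⁻¹))).exists
    exact ⟨R, hR1, by rwa [neg_sub] at hR⟩
  have hR0 : 0 < R := by linarith
  have hcq : Continuous fun ξ => R / q ξ := continuous_const.div hq.cont fun ξ => (hq.pos ξ).ne'
  -- high and low energies
  set A₁ : Λ → E d → ℂ := fun θ ξ => famDiv a q θ ξ * ((max 0 (1 - R / q ξ) : ℝ) : ℂ) with hA₁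
  set A₂ : Λ → E d → ℂ := fun θ ξ => a θ ξ * ((min 1 (R / q ξ) : ℝ) : ℂ) with hA₂
  have hA₁B : ∀ θ ξ, ‖A₁ θ ξ‖ ≤ B θ * R ^ (s - 1) := fun θ ξ => by
    have hb := hB0 θ
    have hq0 := hq.pos ξ
    rw [hA₁, norm_mul, Complex.norm_real, Real.norm_of_nonneg (le_max_left _ _)]
    rcases le_total (q ξ) R with h1 | h1
    · have : 1 - R / q ξ ≤ 0 := by
        rw [sub_nonpos, le_div_iff₀ hq0, one_mul]; exact h1
      rw [max_eq_left this, mul_zero]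
      positivity
    · have h2 : max 0 (1 - R / q ξ) ≤ 1 := max_le zero_le_one (by
        have : 0 ≤ R / q ξ := by positivity
        linarith)
      refine (mul_le_of_le_one_right (norm_nonneg _) h2).trans ?_
      have h3 : ‖famDiv a q θ ξ‖ ≤ B θ * q ξ ^ (s - 1) := by
        unfold famDiv
        rw [norm_mul, norm_inv, Complex.norm_real, Real.norm_of_nonneg hq0.le,
          Real.rpow_sub_one hq0.ne', ← mul_div_assoc, ← div_eq_mul_inv]
        gcongr
        exact hle θ ξ
      refine h3.trans ?_
      gcongr B θ * ?_
      exact Real.rpow_le_rpow_of_nonpos hR0 h1 (by linarith)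
  have hA₂B : ∀ θ ξ, ‖A₂ θ ξ‖ ≤ B θ * R := fun θ ξ => by
    have hb := hB0 θ
    have hq0 := hq.pos ξ
    have h1 : 0 ≤ min 1 (R / q ξ) := le_min zero_le_one (by positivity)
    rw [hA₂, norm_mul, Complex.norm_real, Real.norm_of_nonneg h1]
    calc ‖a θ ξ‖ * min 1 (R / q ξ) ≤ (B θ * q ξ) * (R / q ξ) := by
          refine mul_le_mul ((hle θ ξ).trans ?_) (min_le_right _ _) h1 (by positivity)
          gcongr
          exact (Real.rpow_le_rpow_of_exponent_le (hq.one_le ξ) hs1.le).trans (Real.rpow_one _).le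
      _ = _ := by field_simp
  have hb₁ : BddFam A₁ := ⟨fun θ => ((ha.continuous θ).mul hq.bddCont_inv.cont).mul
    (Complex.continuous_ofReal.comp (continuous_const.max (continuous_const.sub hcq))), _,
    hB.mul_right _, hA₁B⟩
  have hb₂ : BddFam A₂ := ⟨fun θ => (ha.continuous θ).mul
    (Complex.continuous_ofReal.comp (continuous_const.min hcq)), _, hB.mul_right _, hA₂B⟩
  have hb₂' : BddFam (famDiv A₂ q) := by
    refine ⟨fun θ => (hb₂.cont θ).mul hq.bddCont_inv.cont, _, hB.mul_right R, fun θ ξ => ?_⟩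
    unfold famDiv
    rw [norm_mul, norm_inv, Complex.norm_real, Real.norm_of_nonneg (hq.pos ξ).le]
    exact (mul_le_of_le_one_right (norm_nonneg _) (inv_le_one_of_one_le₀ (hq.one_le ξ))).trans
      (hA₂B θ ξ)
  have hsum : famDiv a q = A₁ + famDiv A₂ q := by
    funext θ ξ
    simp only [hA₁, hA₂, famDiv, Pi.add_apply]
    have : max 0 (1 - R / q ξ) = 1 - min 1 (R / q ξ) := by
      rw [← max_sub_sub_left 1 1 (R / q ξ), sub_self]
    rw [this]; push_cast; ring
  have hop : opB c (famDiv A₂ q) = opB c A₂ * invW q := by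
    rw [invW, opB_mul_fmult c hb₂ hq.bddCont_inv]; rfl
  have hn := norm_opB_le c hb₁ (hB.mul_right _) hA₁B
  rw [tsum_mul_right, ← mul_assoc, ← hL] at hn
  refine ⟨‖opB c A₂‖, norm_nonneg _, fun v => ?_⟩
  rw [hsum, opB_add c hb₁ hb₂', hop, _root_.add_apply, mul_apply_eq_comp]
  refine (norm_add_le _ _).trans (add_le_add ?_ (ContinuousLinearMap.le_opNorm _ _))
  refine (ContinuousLinearMap.le_opNorm _ _).trans ?_
  gcongr
  exact hn.trans hR

/-- The graph norm of `H₀ + Op(b)` controls the graph norm of `H₀`. -/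
lemma exists_graph_bound {c : ℝ} (hc : c ≠ 0) (hm : 0 < m) (h : α * β < 2 * m)
    (ha : InClass β α a) : ∃ C : ℝ, ∀ v, ‖v‖ ≤ C * (‖invW (enWeight m) v‖ +
      ‖opB c (famDiv ((diagFam c fun ξ => (kin m ξ : ℂ)) + a) (enWeight m)) v‖) := by
  obtain ⟨C, hC0, hC⟩ := exists_relative_bound c hm h ha
  refine ⟨2 * (1 + C), fun v => ?_⟩
  have e : famDiv ((diagFam c fun ξ => (kin m ξ : ℂ)) + a) (enWeight m) =
      famDiv (diagFam c fun ξ => (kin m ξ : ℂ)) (enWeight m) + famDiv a (enWeight m) := by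
    funext θ ξ; simp only [famDiv, Pi.add_apply]; ring
  have ha' := bddFam_famDiv hm h ha ha.continuous fun _ _ => le_rfl
  rw [e, opB_add c (bddFam_famDiv_diagFam c hm) ha', opB_kin hc hm]
  set G := invW (enWeight m : E d → ℝ)
  set B := opB c (famDiv a (enWeight m))
  have e2 : v = ((1 - G + B) v + G v) - B v := by
    simp only [_root_.add_apply, _root_.sub_apply, one_apply_eq_self]; abel
  have h1 : ‖v‖ ≤ (‖(1 - G + B) v‖ + ‖G v‖) + ‖B v‖ := by
    calc ‖v‖ = ‖((1 - G + B) v + G v) - B v‖ := by rw [← e2]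
      _ ≤ _ := (norm_sub_le _ _).trans (by gcongr; exact norm_add_le _ _)
  have h2 := hC v
  have h3 := norm_nonneg (G v)
  have h4 := norm_nonneg ((1 - G + B) v)
  nlinarith

end Families

end

end PeriodicPDO

namespace PeriodicPDO

noncomputable section

/-! ### Conjugation with one-parameter unitary groups -/

section Flow

open NormedSpace

variable {A : Type*} [CStarAlgebra A]

lemma hasDerivAt_exp_mul_mul_exp (X Y T : A) (t : ℝ) :
    HasDerivAt (fun t : ℝ => exp (t • -X) * T * exp (t • Y))
      (exp (t • -X) * (T * Y - X * T) * exp (t • Y)) t := by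
  have h := ((hasDerivAt_exp_smul_const (𝕂 := ℝ) (-X) t).mul_const T).mul
    (hasDerivAt_exp_smul_const' (𝕂 := ℝ) Y t)
  refine h.congr_deriv ?_
  simp only [mul_sub, sub_mul, mul_neg, neg_mul, mul_assoc]
  abel

/-- The conjugation `e^{-tX} T e^{tX}`. -/
def flow (X T : A) (t : ℝ) : A := exp (t • -X) * T * exp (t • X)

/-- The integral of `flow` from zero. -/
def flowInt (X T : A) (t : ℝ) : A := ∫ s in (0 : ℝ)..t, flow X T s

/-- The commutator `[T, X]`. -/
def bracketWith (X T : A) : A := T * X - X * T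

lemma hasDerivAt_flow (X T : A) (t : ℝ) :
    HasDerivAt (flow X T) (flow X (bracketWith X T) t) t :=
  hasDerivAt_exp_mul_mul_exp X X T t

lemma continuous_flow (X T : A) : Continuous (flow X T) :=
  continuous_iff_continuousAt.2 fun t => (hasDerivAt_flow X T t).continuousAt

lemma hasDerivAt_flowInt (X T : A) (t : ℝ) : HasDerivAt (flowInt X T) (flow X T t) t :=
  intervalIntegral.integral_hasDerivAt_right ((continuous_flow X T).intervalIntegrable _ _)
    ((continuous_flow X T).stronglyMeasurableAtFilter _ _) (continuous_flow X T).continuousAt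

lemma flowInt_zero (X T : A) : flowInt X T 0 = 0 := intervalIntegral.integral_same

lemma flow_zero (X T : A) : flow X T 0 = T := by simp [flow]

lemma eq_of_hasDerivAt_eq {f g f' : ℝ → A} (hf : ∀ t, HasDerivAt f (f' t) t)
    (hg : ∀ t, HasDerivAt g (f' t) t) (h0 : f 0 = g 0) : f = g := by
  funext t
  have h : ∀ t, HasDerivAt (f - g) 0 t := fun t => by simpa using (hf t).sub (hg t)
  have h2 := is_const_of_deriv_eq_zero (fun t => (h t).differentiableAt) (fun t => (h t).deriv) t 0
  simp only [Pi.sub_apply, h0, sub_self] at h2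
  exact sub_eq_zero.1 h2

lemma flow_eq_add_flowInt (X T : A) (t : ℝ) :
    flow X T t = T + flowInt X (bracketWith X T) t :=
  congrFun (eq_of_hasDerivAt_eq (hasDerivAt_flow X T)
    (g := fun t => T + flowInt X (bracketWith X T) t)
    (fun t => (hasDerivAt_flowInt X _ t).const_add T) (by simp [flow_zero, flowInt_zero])) t

/-- The exponentials of `X` and `Y`, intertwined by `G`, conjugate `T` into `T` plus an operator of
the form `Φ G`. -/
lemma exp_mul_mul_exp_eq {X Y T G V : A} (hG : X * G = G * Y) (hV : T * Y - X * T = V * G) :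
    exp (-X) * T * exp Y = T + flowInt X V 1 * G := by
  have hexp : ∀ t : ℝ, exp (t • X) * G = G * exp (t • Y) := fun t => by
    have h : SemiconjBy G (t • Y) (t • X) := by
      simp only [SemiconjBy, mul_smul_comm, smul_mul_assoc, hG]
    let +nondep : NormedAlgebra ℚ A := .restrictScalars ℚ ℂ A
    exact h.exp_right.eq.symm
  have h := congrFun (eq_of_hasDerivAt_eq (hasDerivAt_exp_mul_mul_exp X Y T)
    (g := fun t => T + flowInt X V t * G) (fun t => ?_) (by simp [flowInt_zero])) 1
  · simpa using h
  · refine (((hasDerivAt_flowInt X V t).mul_const G).const_add T).congr_deriv ?_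
    rw [hV, flow, mul_assoc _ (exp (t • X)), hexp]
    simp only [mul_assoc]

variable {X : A} (hX : X ∈ skewAdjoint A)
include hX

lemma norm_flow (T : A) (t : ℝ) : ‖flow X T t‖ = ‖T‖ := by
  have h : ∀ s : ℝ, exp (s • X) ∈ unitary A := fun s => by
    let +nondep : NormedAlgebra ℚ A := .restrictScalars ℚ ℂ A
    exact exp_mem_unitary_of_mem_skewAdjoint (skewAdjoint.smul_mem s hX)
  have h1 : exp (t • -X) ∈ unitary A := by simpa using h (-t)
  rw [flow, CStarRing.norm_mul_mem_unitary _ (h t), CStarRing.norm_mem_unitary_mul _ h1]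

/-- Taylor's formula for the conjugation, integrated once. -/
lemma norm_flowInt_sub_le (n : ℕ) (T : A) {t : ℝ} (ht : t ∈ Set.Icc (0 : ℝ) 1) :
    ‖flowInt X T t - ∑ j ∈ Finset.range n,
      (t ^ (j + 1) * ((j + 1).factorial : ℝ)⁻¹) • (bracketWith X)^[j] T‖ ≤
        ‖(bracketWith X)^[n] T‖ := by
  induction n generalizing T t with
  | zero =>
    have h := norm_image_sub_le_of_norm_deriv_le_segment' (f := flowInt X T) (a := 0) (b := 1)
      (fun s _ => (hasDerivAt_flowInt X T s).hasDerivWithinAt)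
      (fun s _ => (norm_flow hX T s).le) t ht
    rw [flowInt_zero, sub_zero, sub_zero] at h
    simp only [Finset.range_zero, Finset.sum_empty, sub_zero, Function.iterate_zero, id]
    exact h.trans (mul_le_of_le_one_right (norm_nonneg _) ht.2)
  | succ n ih =>
    have hd : ∀ s : ℝ, HasDerivAt (fun t => flowInt X T t - ∑ j ∈ Finset.range (n + 1),
        (t ^ (j + 1) * ((j + 1).factorial : ℝ)⁻¹) • (bracketWith X)^[j] T)
        (flowInt X (bracketWith X T) s - ∑ j ∈ Finset.range n,
          (s ^ (j + 1) * ((j + 1).factorial : ℝ)⁻¹) • (bracketWith X)^[j] (bracketWith X T)) s := by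
      intro s
      have hs : ∀ j ∈ Finset.range (n + 1), HasDerivAt
          (fun t : ℝ => (t ^ (j + 1) * ((j + 1).factorial : ℝ)⁻¹) • (bracketWith X)^[j] T)
          ((s ^ j * ((j.factorial : ℝ)⁻¹)) • (bracketWith X)^[j] T) s := fun j _ => by
        have h := (((hasDerivAt_pow (j + 1) s).mul_const
          (((j + 1).factorial : ℝ)⁻¹)).smul_const ((bracketWith X)^[j] T))
        refine h.congr_deriv ?_
        congr 1
        rw [Nat.factorial_succ, Nat.add_sub_cancel]
        have := Nat.factorial_ne_zero j
        push_cast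
        field_simp
      refine ((hasDerivAt_flowInt X T s).sub (HasDerivAt.fun_sum hs)).congr_deriv ?_
      rw [Finset.sum_range_succ', flow_eq_add_flowInt]
      simp only [Function.iterate_succ, Function.comp_apply, pow_zero, Nat.factorial_zero,
        Nat.cast_one, inv_one, mul_one, one_smul, Function.iterate_zero, id]
      abel
    have h := norm_image_sub_le_of_norm_deriv_le_segment' (a := 0) (b := 1)
      (fun s _ => (hd s).hasDerivWithinAt)
      (fun s hs => ih (bracketWith X T) ⟨hs.1, hs.2.le⟩) t ht
    simp only [flowInt_zero, sub_zero, zero_pow (Nat.succ_ne_zero _), zero_mul, zero_smul,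
      Finset.sum_const_zero] at h
    rw [Function.iterate_succ, Function.comp_apply]
    exact h.trans (mul_le_of_le_one_right (norm_nonneg _) ht.2)

/-- The integral and its adjoint have the same derivative and the same value at zero. -/
lemma isSelfAdjoint_flowInt {T : A} (hT : IsSelfAdjoint T) (t : ℝ) :
    IsSelfAdjoint (flowInt X T t) := by
  have hstar : ∀ s, star (flow X T s) = flow X T s := fun s => by
    simp only [flow, star_mul, star_exp, star_smul, star_neg, skewAdjoint.mem_iff.1 hX, hT.star_eq,
      neg_neg, star_trivial, mul_assoc]
  exact congrFun (eq_of_hasDerivAt_eq (f := fun t => star (flowInt X T t)) (fun t => by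
    have h := (hasDerivAt_flowInt X T t).star
    rwa [hstar] at h) (hasDerivAt_flowInt X T) (by simp [flowInt_zero])) t

end Flow

end

end PeriodicPDO

namespace PeriodicPDO

noncomputable section

/-! ### Conjugation of the operator `H` -/

section Gauge

variable {d : ℕ} {Λ : Submodule ℤ (E d)} {c : ℝ} {S : Finset Λ} {q : E d → ℝ}
  {a ψ : Λ → E d → ℂ}

/-- The family `q(ξ + θ) ψ(θ, ξ) / q(ξ)` of `Op(q) Ψ Op(q)⁻¹`. -/
def conjFam (q : E d → ℝ) (ψ : Λ → E d → ℂ) : Λ → E d → ℂ := fun θ ξ =>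
  (q (ξ + θ) : ℂ) * ψ θ ξ * (q ξ : ℂ)⁻¹

lemma bddCont_conjFam (hq : IsWeight q) (hqC : ∀ θ : E d, ∃ C, ∀ ξ, q (ξ + θ) ≤ C * q ξ)
    (hψ : ∀ θ, BddCont (ψ θ)) (θ : Λ) : BddCont (conjFam q ψ θ) := by
  obtain ⟨C, hC⟩ := hqC θ
  obtain ⟨D, hD⟩ := (hψ θ).bdd
  refine ⟨((Complex.continuous_ofReal.comp (hq.cont.comp (by fun_prop))).mul (hψ θ).cont).mul
    hq.bddCont_inv.cont, C * D, fun ξ => ?_⟩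
  have h1 := hq.pos ξ
  have h2 := hq.pos (ξ + θ)
  have hD0 : 0 ≤ D := (norm_nonneg _).trans (hD ξ)
  unfold conjFam
  rw [norm_mul, norm_mul, norm_inv, Complex.norm_real, Complex.norm_real,
    Real.norm_of_nonneg h1.le, Real.norm_of_nonneg h2.le, ← div_eq_mul_inv, div_le_iff₀ h1]
  calc q (ξ + θ) * ‖ψ θ ξ‖ ≤ (C * q ξ) * D := by
        gcongr
        · exact h2.le.trans (hC ξ)
        · exact hC ξ
        · exact hD ξ
    _ = _ := by ring

lemma conjFam_eq_zero (hS : ∀ θ ∉ S, ψ θ = 0) : ∀ θ ∉ S, conjFam q ψ θ = 0 := fun θ hθ => by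
  funext ξ; simp [conjFam, hS θ hθ]

lemma opB_mul_invW (hq : IsWeight q) (hqC : ∀ θ : E d, ∃ C, ∀ ξ, q (ξ + θ) ≤ C * q ξ)
    (hψ : ∀ θ, BddCont (ψ θ)) (hS : ∀ θ ∉ S, ψ θ = 0) :
    opB c ψ * invW q = invW q * opB c (conjFam q ψ) := by
  have h1 := BddFam.of_finset S hS hψ
  have h2 := BddFam.of_finset S (conjFam_eq_zero (q := q) hS) (bddCont_conjFam hq hqC hψ)
  rw [invW, opB_mul_fmult c h1 hq.bddCont_inv, fmult_mul_opB c h2 hq.bddCont_inv]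
  congr 1
  funext θ ξ
  have := hq.ne_zero (ξ + θ)
  simp only [conjFam]
  field_simp

lemma opB_famDiv (hq : IsWeight q) (ha : BddFam a) : opB c (famDiv a q) = opB c a * invW q := by
  rw [invW, opB_mul_fmult c ha hq.bddCont_inv]; rfl

/-- The commutator of an unbounded operator with `Ψ`, divided by the weight. -/
lemma opB_famDiv_comm (hq : IsWeight q) (hqC : ∀ θ : E d, ∃ C, ∀ ξ, q (ξ + θ) ≤ C * q ξ)
    (ha : BddFam (famDiv a q)) (hψ : ∀ θ, BddCont (ψ θ)) (hS : ∀ θ ∉ S, ψ θ = 0) :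
    opB c (famDiv (comm c S a ψ) q) = Complex.I •
      (opB c (famDiv a q) * opB c (conjFam q ψ) - opB c ψ * opB c (famDiv a q)) := by
  have hψ' := bddCont_conjFam hq hqC hψ
  have hS' := conjFam_eq_zero (q := q) hS
  rw [opB_mul c S ha hψ' hS', opB_mul_left c S ha hψ hS,
    ← opB_sub c (BddFam.famMul c S ha hψ') (BddFam.famMulLeft c S ha hψ),
    ← opB_const_mul c ((BddFam.famMul c S ha hψ').sub (BddFam.famMulLeft c S ha hψ))]
  congr 1
  funext χ ξ
  have h1 : famMul c S (famDiv a q) (conjFam q ψ) χ ξ = famMul c S a ψ χ ξ * (q ξ : ℂ)⁻¹ := by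
    simp only [famMul, mul_assoc, Finset.sum_mul]
    congr 1
    refine Finset.sum_congr rfl fun φ _ => ?_
    have := hq.ne_zero (ξ + φ)
    have := hq.ne_zero ξ
    simp only [famDiv, conjFam]
    field_simp
  have h2 : famMulLeft c S ψ (famDiv a q) χ ξ = famMulLeft c S ψ a χ ξ * (q ξ : ℂ)⁻¹ := by
    simp only [famMulLeft, mul_assoc, Finset.sum_mul]
    rfl
  rw [Pi.sub_apply, Pi.sub_apply, h1, h2, comm_eq_famMul]
  simp only [famDiv]
  ring

lemma BddFam.iterComm (hψ : ∀ θ, BddCont (ψ θ)) (ha : BddFam a) (j : ℕ) :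
    BddFam (iterComm c S ψ a j) := by
  induction j with
  | zero => exact ha
  | succ j ih => rw [iterComm_succ]; exact BddFam.comm c S ih hψ

lemma iterate_bracketWith (hψ : ∀ θ, BddCont (ψ θ)) (hS : ∀ θ ∉ S, ψ θ = 0) (ha : BddFam a)
    (j : ℕ) : (bracketWith (Complex.I • opB c ψ))^[j] (opB c a) = opB c (iterComm c S ψ a j) := by
  induction j with
  | zero => rfl
  | succ j ih =>
    rw [Function.iterate_succ_apply', ih, iterComm_succ,
      opB_comm c S (BddFam.iterComm hψ ha j) hψ hS, bracketWith, mul_smul_comm, smul_mul_assoc,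
      smul_sub]

/-- The domain and the action of a conjugated operator. -/
lemma ActsBy.sandwich {X Y T : L2 d →L[ℂ] L2 d} {A : L2 d →ₗ.[ℂ] L2 d}
    (hXY : X * invW q = invW q * Y) (hA : ActsBy q A T) :
    ActsBy q (sandwich (NormedSpace.exp (-X)) A (NormedSpace.exp X))
      (NormedSpace.exp (-X) * T * NormedSpace.exp Y) := fun v => by
  have hexp : NormedSpace.exp X * invW q = invW q * NormedSpace.exp Y := by
    let +nondep : NormedAlgebra ℚ (L2 d →L[ℂ] L2 d) := .restrictScalars ℚ ℂ _
    have h : SemiconjBy (invW q) Y X := hXY.symm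
    exact h.exp_right.eq.symm
  have h1 := hA (NormedSpace.exp Y v)
  rw [← mul_apply_eq_comp, ← hexp, mul_apply_eq_comp] at h1
  obtain ⟨x, hx1, hx2⟩ := (LinearPMap.mem_graph_iff _).1 h1
  simp only at hx1 hx2
  have hmem : NormedSpace.exp X (invW q v) ∈ A.domain := by rw [← hx1]; exact x.2
  refine (LinearPMap.mem_graph_iff _).2 ⟨⟨invW q v, hmem⟩, rfl, ?_⟩
  rw [mul_assoc, mul_apply_eq_comp, mul_apply_eq_comp, ← hx2]
  change NormedSpace.exp (-X) (A ⟨NormedSpace.exp X (invW q v), hmem⟩) = _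
  congr 2
  exact Subtype.ext hx1.symm

/-- The domain of a conjugated operator is contained in the range of `invW q` if that of the operator is,
because `e^{-X}` maps this range into itself. -/
lemma exists_of_mem_domain_sandwich {X Y : L2 d →L[ℂ] L2 d} {A : L2 d →ₗ.[ℂ] L2 d}
    {V : L2 d →L[ℂ] L2 d} (hXY : X * invW q = invW q * Y)
    (hA : ∀ u ∈ A.domain, ∃ v, invW q v = u) :
    ∀ u ∈ (sandwich V A (NormedSpace.exp X)).domain, ∃ v, invW q v = u := by
  intro u hu
  obtain ⟨v, hv⟩ := hA _ hu
  let +nondep : NormedAlgebra ℚ (L2 d →L[ℂ] L2 d) := .restrictScalars ℚ ℂ _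
  have h : SemiconjBy (invW q) (-Y) (-X) := by
    simp only [SemiconjBy, mul_neg, neg_mul, hXY]
  have h1 := h.exp_right.eq
  have h2 : NormedSpace.exp (-X) * NormedSpace.exp X = 1 := by
    rw [← NormedSpace.exp_add_of_commute (Commute.refl X).neg_left, neg_add_cancel,
      NormedSpace.exp_zero]
  refine ⟨NormedSpace.exp (-Y) v, ?_⟩
  rw [← mul_apply_eq_comp, h1, mul_apply_eq_comp, hv]
  change NormedSpace.exp (-X) (NormedSpace.exp X u) = u
  rw [← mul_apply_eq_comp, h2, one_apply_eq_self]

variable {ι : ℝ → ℝ} {m β ρ : ℝ} {b y : Λ → E d → ℂ}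

/-- The homological equation. -/
lemma comm_kin_homSol (hc : c ≠ 0) (hι : IsCutoff ι) (hm : 0 < m) (hρ : 1 ≤ ρ)
    (hS : ∀ θ ∈ S, θ ≠ 0 ∧ ‖(θ : E d)‖ ≤ ρ) :
    comm c S (diagFam c fun ξ => (kin m ξ : ℂ)) (homSol ι m β ρ S y) =
      -nonresPart ι β ρ S y := by
  have hc' : (c : ℂ) ≠ 0 := by exact_mod_cast hc
  obtain ⟨δ, hδ, hgap⟩ := hι.exists_gap
  funext χ ξ
  have hterm : ∀ φ ∈ S, φ ≠ χ → (diagFam c (fun ξ => (kin m ξ : ℂ)) (χ - φ) (ξ + φ) *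
      homSol ι m β ρ S y φ ξ - homSol ι m β ρ S y φ (ξ + (χ - φ : Λ)) *
        diagFam c (fun ξ => (kin m ξ : ℂ)) (χ - φ) ξ) = 0 := fun φ _ h => by
    rw [diagFam_ne (sub_ne_zero.2 h.symm)]; simp
  unfold comm
  by_cases hχ : χ ∈ S
  · rw [Finset.sum_eq_single χ hterm fun h => absurd hχ h]
    simp only [sub_self, Submodule.coe_zero, add_zero, diagFam, if_true, homSol, if_pos hχ,
      Pi.neg_apply, nonresPart]
    have h1 : ((homMult ι m β ρ (χ : E d) ξ : ℝ) : ℂ) * (kin m (ξ + (χ : E d)) - kin m ξ) =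
        nonresCut ι β ρ (χ : E d) ξ := by
      have : homMult ι m β ρ (χ : E d) ξ * kinDiff m (χ : E d) ξ = nonresCut ι β ρ (χ : E d) ξ := by
        rcases nonresCut_eventuallyEq_zero_or (β := β) hι hgap (by linarith : 0 < ρ) (χ : E d) ξ
          with h | h
        · rw [homMult, h.eq_of_nhds]; simp
        · exact div_mul_cancel₀ _ (kinDiff_ne_zero hm hδ hρ (hS χ hχ).2
            (by simpa using (hS χ hχ).1) h)
      rw [← this, kinDiff]; push_cast; ring
    rw [← h1]
    have hI := Complex.I_mul_I
    field_simp
    linear_combination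
      ((homMult ι m β ρ (χ : E d) ξ : ℝ) : ℂ) * y χ ξ * (kin m (ξ + (χ : E d)) - kin m ξ) * hI
  · rw [Finset.sum_eq_zero fun φ hφ => hterm φ hφ fun h => hχ (h ▸ hφ)]
    simp [nonresPart, hχ]

end Gauge

end

end PeriodicPDO

namespace PeriodicPDO

noncomputable section

/-! ### The parts of an operator and the conjugated operator -/

section Parts

variable {d : ℕ}

/-- Cut-offs which preserve symmetry and size of the families supported in `T`. -/
structure IsSymmCut (T : Set (E d)) (g : E d → E d → ℝ) : Prop where
  neg_mem : ∀ θ, -θ ∈ T ↔ θ ∈ T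
  symm : ∀ θ ξ, g (-θ) (ξ + θ) = g θ ξ
  abs_le : ∀ θ ξ, |g θ ξ| ≤ 1
  cont : ∀ θ, Continuous (g θ)

variable {Λ : Submodule ℤ (E d)} {m α β c : ℝ} {T : Set (E d)} {g : E d → E d → ℝ}
  {a : Λ → E d → ℂ}

lemma IsSymmCut.continuous_cutFam (hg : IsSymmCut T g) (ha : InClass β α a) (θ : Λ) :
    Continuous (cutFam T g a θ) := by
  unfold cutFam
  split_ifs
  · exact (ha.continuous θ).mul (Complex.continuous_ofReal.comp (hg.cont θ))
  · exact continuous_const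

lemma IsSymmCut.bddFam [DiscreteTopology Λ] (hg : IsSymmCut T g) (hm : 0 < m)
    (hαβ : α * β < 2 * m) (ha : InClass β α a) : BddFam (famDiv (cutFam T g a) (enWeight m)) :=
  bddFam_famDiv hm hαβ ha (hg.continuous_cutFam ha) (norm_cutFam_le hg.abs_le a)

lemma IsSymmCut.symmFam (hg : IsSymmCut T g) (hs : SymmFam a) : SymmFam (cutFam T g a) :=
  hs.cutFam hg.neg_mem hg.symm

lemma famDiv_add (a b : Λ → E d → ℂ) (q : E d → ℝ) :
    famDiv (a + b) q = famDiv a q + famDiv b q := by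
  funext θ ξ; simp only [famDiv, Pi.add_apply]; ring

variable {ι : ℝ → ℝ} {ρ r : ℝ}

lemma isSymmCut_zero : IsSymmCut ({0} : Set (E d)) fun _ _ => 1 :=
  ⟨by simp, fun _ _ => rfl, by simp, fun _ => continuous_const⟩

lemma half_symm (θ ξ : E d) : ξ + θ + (1 / 2 : ℝ) • -θ = ξ + (1 / 2 : ℝ) • θ := by module

variable (Γ : Submodule ℤ (E d))

lemma neg_mem_Theta (θ : E d) : -θ ∈ Theta Γ r ↔ θ ∈ Theta Γ r := by
  have h : -θ ∈ dualLattice Γ ↔ θ ∈ dualLattice Γ := (dualSub Γ).neg_mem_iff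
  simp [Theta, h]

lemma isSymmCut_up : IsSymmCut (dualLattice Γ \ (Theta Γ r ∪ {0})) fun _ _ => 1 := by
  refine ⟨fun θ => ?_, fun _ _ => rfl, by simp, fun _ => continuous_const⟩
  have h : -θ ∈ dualLattice Γ ↔ θ ∈ dualLattice Γ := (dualSub Γ).neg_mem_iff
  simp only [Set.mem_sdiff, Set.mem_union, Set.mem_singleton_iff, neg_mem_Theta, h, neg_eq_zero]

lemma isSymmCut_sharp (hι : IsCutoff ι) : IsSymmCut (Theta Γ r) (cutGt ι ρ) := by
  refine ⟨neg_mem_Theta Γ, fun θ ξ => ?_, fun θ ξ => ?_, fun θ => ?_⟩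
  · simp only [cutGt, half_symm]
  · have h0 := hι.nonneg (‖ξ + (1 / 2 : ℝ) • θ‖ / ρ - 1)
    have h1 := hι.le_one (‖ξ + (1 / 2 : ℝ) • θ‖ / ρ - 1)
    unfold cutGt
    rw [abs_le]; constructor <;> linarith
  · have := hι.smooth.continuous
    unfold cutGt; fun_prop

lemma isSymmCut_down (hι : IsCutoff ι) : IsSymmCut (Theta Γ r) (cutLt ι ρ) := by
  refine ⟨neg_mem_Theta Γ, fun θ ξ => ?_, fun θ ξ => ?_, fun θ => ?_⟩
  · simp only [cutLt, half_symm]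
  · have h0 := hι.nonneg (1 - ‖ξ + (1 / 2 : ℝ) • θ‖ / ρ)
    have h1 := hι.le_one (1 - ‖ξ + (1 / 2 : ℝ) • θ‖ / ρ)
    unfold cutLt
    rw [abs_le]; constructor <;> linarith
  · have := hι.smooth.continuous
    unfold cutLt; fun_prop

lemma isSymmCut_flat (hι : IsCutoff ι) : IsSymmCut (Theta Γ r)
    fun θ ξ => cutZeta ι (ρ ^ β) θ ξ * cutE ι ρ θ ξ := by
  refine ⟨neg_mem_Theta Γ, fun θ ξ => ?_, fun θ ξ => ?_, fun θ => ?_⟩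
  · simp only [cutZeta, cutE, half_symm, inner_neg_left, abs_neg, norm_neg]
  · unfold cutZeta cutE
    rw [abs_mul, abs_of_nonneg (hι.nonneg _), abs_of_nonneg (hι.nonneg _)]
    exact mul_le_one₀ (hι.le_one _) (hι.nonneg _) (hι.le_one _)
  · have := hι.smooth.continuous
    unfold cutZeta cutE; fun_prop

variable [DiscreteTopology Γ] [IsZLattice ℝ Γ]

/-- The parts of `resPart y` add up to what `nonresPart` leaves of `y`. -/
lemma sum_parts_resPart (hι : IsCutoff ι) (y : dualSub Γ → E d → ℂ) :
    cutFam {0} (fun _ _ => 1) (resPart ι β ρ (thetaFinset (dualSub Γ) r) y) +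
      cutFam (Theta Γ r) (fun θ ξ => cutZeta ι (ρ ^ β) θ ξ * cutE ι ρ θ ξ)
        (resPart ι β ρ (thetaFinset (dualSub Γ) r) y) +
      (cutFam (Theta Γ r) (cutLt ι ρ) (resPart ι β ρ (thetaFinset (dualSub Γ) r) y) +
        cutFam (Theta Γ r) (cutGt ι ρ) (resPart ι β ρ (thetaFinset (dualSub Γ) r) y) +
        cutFam (dualLattice Γ \ (Theta Γ r ∪ {0})) (fun _ _ => 1)
          (resPart ι β ρ (thetaFinset (dualSub Γ) r) y)) =
      y - nonresPart ι β ρ (thetaFinset (dualSub Γ) r) y := by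
  funext θ ξ
  have hT : (θ : E d) ∈ Theta Γ r ↔ θ ∈ thetaFinset (dualSub Γ) r := by
    have h : (θ : E d) ∈ dualLattice Γ := θ.2
    rw [mem_thetaFinset]
    simp [Theta, h, and_comm]
  have h0 : (θ : E d) ∈ ({0} : Set (E d)) ↔ θ = 0 := by simp
  have hU : (θ : E d) ∈ dualLattice Γ \ (Theta Γ r ∪ {0}) ↔
      ¬(θ ∈ thetaFinset (dualSub Γ) r ∨ θ = 0) := by
    have h : (θ : E d) ∈ dualLattice Γ := θ.2
    rw [Set.mem_sdiff, Set.mem_union, hT, h0]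
    simp [h]
  simp only [Pi.add_apply, Pi.sub_apply, cutFam, hT, h0, hU, resPart, nonresPart]
  by_cases hS : θ ∈ thetaFinset (dualSub Γ) r
  · have hne : θ ≠ 0 := (mem_thetaFinset.1 hS).2
    simp only [hS, hne, if_true, if_false, true_or, not_true_eq_false]
    have h1 := cut_sum_eq (β := β) (ρ := ρ) hι (θ : E d) ξ
    have h2 := one_sub_mul_coStep (shellCut ι β ρ (θ : E d) ξ)
    rw [← h1] at h2
    have h3 : ((cutZeta ι (ρ ^ β) (θ : E d) ξ * cutE ι ρ (θ : E d) ξ + cutLt ι ρ (θ : E d) ξ +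
        cutGt ι ρ (θ : E d) ξ : ℝ) : ℂ) * (resCut ι β ρ (θ : E d) ξ : ℝ) =
        1 - (nonresCut ι β ρ (θ : E d) ξ : ℝ) := by
      rw [← Complex.ofReal_mul]
      unfold resCut nonresCut
      rw [h2]; push_cast; ring
    push_cast at h3 ⊢
    linear_combination y θ ξ * h3
  · by_cases hz : θ = 0
    · subst hz
      simp [hS]
    · simp [hS, hz]

end Parts

section Conjugated

variable {d : ℕ} {Λ : Submodule ℤ (E d)} [DiscreteTopology Λ] [Countable Λ]
  {m α β c : ℝ} {S : Finset Λ} {b ψ w p₀ p₁ p₂ p₃ p₄ : Λ → E d → ℂ}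

/-- The conjugated operator, decomposed into operators with families `p_j`, which add up to `b` and a
bounded remainder. -/
lemma sandwich_eq (hc : c ≠ 0) (hm : 0 < m) (hαβ : α * β < 2 * m)
    (hb : InClass β α b) (hbs : SymmFam b) (hψ : ∀ θ, BddCont (ψ θ)) (hS : ∀ θ ∉ S, ψ θ = 0)
    (hA : BddFam (comm c S ((diagFam c fun ξ => (kin m ξ : ℂ)) + b) ψ)) (hw : BddFam w)
    (hp : p₀ + p₁ + (p₂ + p₃ + p₄) = b + w)
    (hp₀ : BddFam (famDiv p₀ (enWeight m))) (hs₀ : SymmFam p₀)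
    (hp₁ : BddFam (famDiv p₁ (enWeight m))) (hs₁ : SymmFam p₁)
    (hp₂ : BddFam (famDiv p₂ (enWeight m))) (hs₂ : SymmFam p₂)
    (hp₃ : BddFam (famDiv p₃ (enWeight m))) (hs₃ : SymmFam p₃)
    (hp₄ : BddFam (famDiv p₄ (enWeight m))) (hs₄ : SymmFam p₄) :
    sandwich (NormedSpace.exp (-(Complex.I • opB c ψ))) (op (h₀ m + symbOf c b))
        (NormedSpace.exp (Complex.I • opB c ψ)) =
      (op (h₀ m) + op (symbOf c p₀)) + op (symbOf c p₁) +
        (op (symbOf c p₂) + op (symbOf c p₃) + op (symbOf c p₄)) +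
        bdd (flowInt (Complex.I • opB c ψ)
          (opB c (comm c S ((diagFam c fun ξ => (kin m ξ : ℂ)) + b) ψ)) 1 - opB c w) := by
  have hq := isWeight_enWeight (d := d) hm
  have hqC := exists_enWeight_add_le (d := d) hm
  set q : E d → ℝ := enWeight m with hqdef
  set k : Λ → E d → ℂ := diagFam c fun ξ => (kin m ξ : ℂ) with hk
  have hkb : BddFam (famDiv k q) := bddFam_famDiv_diagFam c hm
  have hks : SymmFam k := symmFam_diagFam c (kin m)
  have hbb : BddFam (famDiv b q) := bddFam_famDiv hm hαβ hb hb.continuous fun _ _ => le_rfl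
  have hkbb : BddFam (famDiv (k + b) q) := by rw [famDiv_add]; exact hkb.add hbb
  have hk₀ : symbOf c k = h₀ m := symbOf_diagFam hc _
  have hH : h₀ m + symbOf c b = symbOf c (k + b) := by
    rw [symbOf_add c (sumFam_diagFam c _) hb.sumFam, hk₀]
  have hXY : (Complex.I • opB c ψ) * invW q = invW q * (Complex.I • opB c (conjFam q ψ)) := by
    rw [smul_mul_assoc, mul_smul_comm, opB_mul_invW hq hqC hψ hS]
  have hV : opB c (famDiv (k + b) q) * (Complex.I • opB c (conjFam q ψ)) -
      (Complex.I • opB c ψ) * opB c (famDiv (k + b) q) = opB c (comm c S (k + b) ψ) * invW q := by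
    rw [← opB_famDiv hq hA, opB_famDiv_comm hq hqC hkbb hψ hS, smul_mul_assoc, mul_smul_comm,
      smul_sub]
  -- the action of both sides on the range of `invW q`
  have hL := ActsBy.sandwich hXY (actsBy_op c hq hkbb (hks.add hbs))
  rw [exp_mul_mul_exp_eq hXY hV, ← hH] at hL
  have hR := ((((hk₀ ▸ actsBy_op c hq hkb hks).add (actsBy_op c hq hp₀ hs₀)).add
    (actsBy_op c hq hp₁ hs₁)).add (((actsBy_op c hq hp₂ hs₂).add (actsBy_op c hq hp₃ hs₃)).add
    (actsBy_op c hq hp₄ hs₄))).add (ActsBy.bdd q (flowInt (Complex.I • opB c ψ)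
      (opB c (comm c S (k + b) ψ)) 1 - opB c w))
  -- both domains are contained in the range of `invW q`
  obtain ⟨C, hC⟩ := exists_graph_bound hc hm hαβ hb
  obtain ⟨C', hC'⟩ := exists_graph_bound (a := (0 : Λ → E d → ℂ)) (β := β) hc hm hαβ
    ⟨SmoothFam.zero, fun _ => ⟨0, le_rfl, FamBound.zero⟩⟩
  rw [add_zero] at hC'
  refine ActsBy.eq hL ?_ ?_ ?_
  · convert hR using 1
    have e := congrArg (fun a => opB c (famDiv a q)) hp
    have hpw : BddFam (famDiv w q) := by
      have := hq.bddCont_inv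
      obtain ⟨B, hB, hB'⟩ := hw.bdd
      refine ⟨fun θ => (hw.cont θ).mul this.cont, B, hB, fun θ ξ => ?_⟩
      unfold famDiv
      rw [norm_mul, norm_inv, Complex.norm_real, Real.norm_of_nonneg (hq.pos ξ).le]
      exact (mul_le_of_le_one_right (norm_nonneg _) (inv_le_one_of_one_le₀ (hq.one_le ξ))).trans
        (hB' θ ξ)
    simp only [famDiv_add] at e
    rw [opB_add c (hp₀.add hp₁) ((hp₂.add hp₃).add hp₄), opB_add c hp₀ hp₁,
      opB_add c (hp₂.add hp₃) hp₄, opB_add c hp₂ hp₃, opB_add c hbb hpw, opB_famDiv hq hw] at e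
    rw [famDiv_add, opB_add c hkb hbb, sub_mul]
    have e' := eq_sub_of_add_eq e.symm
    rw [e']
    abel
  · refine exists_of_mem_domain_sandwich hXY ?_
    rw [hH]
    exact exists_of_mem_domain_op c hq hkbb (hks.add hbs) hC
  · intro u hu
    refine exists_of_mem_domain_op c hq hkb hks hC' u ?_
    rw [hk₀]
    exact hu.1.1.1.1

end Conjugated

end

end PeriodicPDO

namespace PeriodicPDO

noncomputable section

/-! ### Existence and size of the remainder -/

section Transform

variable {d : ℕ} {Λ : Submodule ℤ (E d)} {ι : ℝ → ℝ} {m β ρ c : ℝ} {S : Finset Λ}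

/-- The terms of degree at most `N + 1` in `Ψ` of the conjugated operator, compared with `b` and the
part of the new symbol which is kept. -/
lemma gaugeStep_eq (N : ℕ) (b y y' : Λ → E d → ℂ) (h : y' = gaugeStep ι m β ρ c S N b y) :
    y' - nonresPart ι β ρ S y' - b =
      ∑ j ∈ Finset.range (N + 1), (((j + 1).factorial : ℝ)⁻¹) •
        iterComm c S (homSol ι m β ρ S y) (firstComm ι m β ρ c S b y) j -
      nonresPart ι β ρ S (y' - y) := by
  have h0 : iterComm c S (homSol ι m β ρ S y) (firstComm ι m β ρ c S b y) 0 =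
      comm c S b (homSol ι m β ρ S y) - nonresPart ι β ρ S y := rfl
  rw [Finset.sum_range_succ', nonresPart_sub, h0]
  simp only [zero_add, Nat.factorial_one, Nat.cast_one, inv_one, one_smul]
  have h1 : y' = b + comm c S b (homSol ι m β ρ S y) +
      ∑ j ∈ Finset.range N, (((j + 2).factorial : ℝ)⁻¹) •
        iterComm c S (homSol ι m β ρ S y) (firstComm ι m β ρ c S b y) (j + 1) := h
  have h2 : ∀ z : Λ → E d → ℂ, y' - z - b = comm c S b (homSol ι m β ρ S y) +
      ∑ j ∈ Finset.range N, (((j + 2).factorial : ℝ)⁻¹) •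
        iterComm c S (homSol ι m β ρ S y) (firstComm ι m β ρ c S b y) (j + 1) - z := fun z => by
    rw [h1]; abel
  rw [h2]
  abel

lemma homSol_eq_zero (y : Λ → E d → ℂ) : ∀ θ ∉ S, homSol ι m β ρ S y θ = 0 := fun θ hθ => by
  funext ξ; simp [homSol, hθ]

/-- The remainder of Taylor's formula for a conjugated operator. -/
lemma norm_flowInt_opB_sub_le (n : ℕ) {a ψ : Λ → E d → ℂ} (ha : BddFam a)
    (hψ : ∀ θ, BddCont (ψ θ)) (hS : ∀ θ ∉ S, ψ θ = 0) (hs : IsSelfAdjoint (opB c ψ)) :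
    ‖flowInt (Complex.I • opB c ψ) (opB c a) 1 - opB c (∑ j ∈ Finset.range n,
      (((j + 1).factorial : ℝ)⁻¹) • iterComm c S ψ a j)‖ ≤ ‖opB c (iterComm c S ψ a n)‖ := by
  have h := norm_flowInt_sub_le (hs.smul_mem_skewAdjoint Complex.conj_I) n (opB c a)
    (t := 1) (by simp)
  simp only [one_pow, one_mul, iterate_bracketWith hψ hS ha] at h
  rw [opB_sum c fun j _ => (BddFam.iterComm hψ ha j).smul _]
  simp only [opB_smul c (BddFam.iterComm hψ ha _), Complex.coe_smul]
  exact h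

variable [DiscreteTopology Λ] {α : ℝ} {K : ℕ → ℝ} {γ e : ℝ} {n : ℕ}
  {A : GaugeData Λ β α K → Λ → E d → ℂ}

lemma HasOrder.inClass (h : HasOrder γ e n A) (i : GaugeData Λ β α K) : InClass β γ (A i) where
  smooth := h.smooth i
  bound q := by
    obtain ⟨C, q', hC0, hC⟩ := h.bound q
    have := Real.rpow_pos_of_pos i.ρβ_pos e
    have := i.nonneg q'
    exact ⟨_, by positivity, hC i⟩

lemma HasOrder.exists_norm_opB_le (c : ℝ) (h : HasOrder 0 e n A) :
    ∃ (C : ℝ) (q : ℕ), 0 ≤ C ∧ ∀ i : GaugeData Λ β α K,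
      ‖opB c (A i)‖ ≤ C * (i.ρ ^ β) ^ e * i.nb q ^ (n + 1) := by
  obtain ⟨C, q, hC0, hC⟩ := h.bound (sumExp Λ)
  refine ⟨|c| * latSum Λ * C, q, ?_, fun i => ?_⟩
  · have := latSum_nonneg Λ; positivity
  · exact (norm_opB_le_of_famBound c (h.inClass i) (hC i)).trans (le_of_eq (by ring))

/-- The operator-theoretic remainder of the gauge transform. -/
def gaugeRem (ι : ℝ → ℝ) (m c : ℝ) (N : ℕ) (i : GaugeData Λ β α K) : L2 d →L[ℂ] L2 d :=
  flowInt (Complex.I • opB c (homSol ι m β i.ρ i.S (gaugeIter ι m β i.ρ c i.S N i.b (N + 1))))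
    (opB c (firstComm ι m β i.ρ c i.S i.b (gaugeIter ι m β i.ρ c i.S N i.b (N + 1)))) 1 -
  opB c (gaugeIter ι m β i.ρ c i.S N i.b (N + 2) -
    nonresPart ι β i.ρ i.S (gaugeIter ι m β i.ρ c i.S N i.b (N + 2)) - i.b)

variable (hι : IsCutoff ι) (hm : 0 < m) (hβ : 0 < β) (hβ1 : β ≤ 1) (hσ : sigma m α β < 1)
include hι hm hβ hβ1 hσ

lemma hasOrder_homSol_gaugeIter (c γ : ℝ) (N n : ℕ) :
    HasOrder γ (sigma m α β - γ) 0 fun i : GaugeData Λ β α K =>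
      homSol ι m β i.ρ i.S (gaugeIter ι m β i.ρ c i.S N i.b n) := by
  have h := HasOrder.of_homSol hι hm hβ hβ1 (HasOrder.of_gaugeIter (Λ := Λ) (K := K) (c := c)
    hι hm hβ hβ1 hσ N n) γ
  rwa [zero_add] at h

lemma bddCont_homSol_gaugeIter (c : ℝ) (N n : ℕ) (i : GaugeData Λ β α K) (θ : Λ) :
    BddCont (homSol ι m β i.ρ i.S (gaugeIter ι m β i.ρ c i.S N i.b n) θ) :=
  ((hasOrder_homSol_gaugeIter hι hm hβ hβ1 hσ c 0 N n).inClass i).bddFam.bddCont θ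

lemma isSelfAdjoint_homSol_gaugeIter (c : ℝ) (N n : ℕ) (i : GaugeData Λ β α K) :
    IsSelfAdjoint (opB c (homSol ι m β i.ρ i.S (gaugeIter ι m β i.ρ c i.S N i.b n))) :=
  opB_isSelfAdjoint c ((hasOrder_homSol_gaugeIter hι hm hβ hβ1 hσ c 0 N n).inClass i).bddFam
    ((i.symm.gaugeIter neg_mem_thetaFinset N n).homSol neg_mem_thetaFinset)

lemma bddFam_firstComm_gaugeIter (c : ℝ) (N n : ℕ) (i : GaugeData Λ β α K) :
    BddFam (firstComm ι m β i.ρ c i.S i.b (gaugeIter ι m β i.ρ c i.S N i.b n)) :=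
  ((HasOrder.of_firstComm (c := c) hι hm hβ hβ1 hσ
    (HasOrder.of_gaugeIter (Λ := Λ) (K := K) (c := c) hι hm hβ hβ1 hσ N n) 0).inClass i).bddFam

/-- The error of the iteration, as a family of order zero. -/
lemma hasOrder_nonresPart_gaugeIter_sub (c : ℝ) (N n : ℕ) :
    HasOrder 0 (n * (sigma m α β - 1) + α) n fun i : GaugeData Λ β α K =>
      nonresPart ι β i.ρ i.S (gaugeIter ι m β i.ρ c i.S N i.b (n + 1) -
        gaugeIter ι m β i.ρ c i.S N i.b n) := by
  have h := HasOrder.of_nonresPart hι hβ hβ1 (HasOrder.of_gaugeIter_sub (Λ := Λ) (K := K) (c := c)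
    hι hm hβ hβ1 hσ N n) (-α)
  rwa [add_neg_cancel, sub_neg_eq_add] at h

lemma hasOrder_iterComm_firstComm (c : ℝ) (N n j : ℕ) :
    HasOrder 0 ((j + 1 : ℕ) * (sigma m α β - 1) + α) (j + 1) fun i : GaugeData Λ β α K =>
      iterComm c i.S (homSol ι m β i.ρ i.S (gaugeIter ι m β i.ρ c i.S N i.b n))
        (firstComm ι m β i.ρ c i.S i.b (gaugeIter ι m β i.ρ c i.S N i.b n)) (j + 1) := by
  have hY := HasOrder.of_gaugeIter (Λ := Λ) (α := α) (K := K) (c := c) hι hm hβ hβ1 hσ N n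
  have h1 := HasOrder.of_firstComm (c := c) hι hm hβ hβ1 hσ hY α
  rw [sub_self] at h1
  have h2 := (HasOrder.of_iterComm_homSol (c := c) hι hm hβ hβ1 hσ h1 hY j).of_comm_homSol (c := c)
    hι hm hβ hβ1 hY 0
  simp only [iterComm_succ]
  exact h2.mono hβ (le_of_eq (by push_cast; ring)) (by omega)

lemma bddFam_rest (c : ℝ) (N : ℕ) (i : GaugeData Λ β α K) :
    BddFam (gaugeIter ι m β i.ρ c i.S N i.b (N + 2) -
      nonresPart ι β i.ρ i.S (gaugeIter ι m β i.ρ c i.S N i.b (N + 2)) - i.b) := by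
  rw [gaugeStep_eq N i.b _ _ (gaugeIter_succ N i.b (N + 1))]
  refine (BddFam.sum fun j _ => BddFam.smul ?_ _).sub
    ((hasOrder_nonresPart_gaugeIter_sub hι hm hβ hβ1 hσ c N (N + 1)).inClass i).bddFam
  exact BddFam.iterComm (bddCont_homSol_gaugeIter hι hm hβ hβ1 hσ c N (N + 1) i)
    (bddFam_firstComm_gaugeIter hι hm hβ hβ1 hσ c N (N + 1) i) j

lemma isSelfAdjoint_gaugeRem (c : ℝ) (N : ℕ) (i : GaugeData Λ β α K) :
    IsSelfAdjoint (gaugeRem ι m c N i) := by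
  have hs := fun n => i.symm.gaugeIter (ι := ι) (m := m) (β := β) (ρ := i.ρ) (c := c) (S := i.S)
    neg_mem_thetaFinset N n
  refine (isSelfAdjoint_flowInt ((isSelfAdjoint_homSol_gaugeIter hι hm hβ hβ1 hσ c N _
    i).smul_mem_skewAdjoint Complex.conj_I) ?_ 1).sub ?_
  · exact opB_isSelfAdjoint c (bddFam_firstComm_gaugeIter hι hm hβ hβ1 hσ c N _ i)
      (i.symm.firstComm (hs _) neg_mem_thetaFinset)
  · exact opB_isSelfAdjoint c (bddFam_rest hι hm hβ hβ1 hσ c N i)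
      (((hs _).sub ((hs _).nonresPart neg_mem_thetaFinset)).sub i.symm)

/-- The remainder is of degree `N + 2` in `b`: it consists of Taylor's remainder and the error of
the iteration. -/
lemma exists_norm_gaugeRem_le (c : ℝ) (N : ℕ) :
    ∃ (C : ℝ) (q : ℕ), 0 ≤ C ∧ ∀ i : GaugeData Λ β α K, ‖gaugeRem ι m c N i‖ ≤
      C * (i.ρ ^ β) ^ ((N + 1 : ℕ) * (sigma m α β - 1) + α) * i.nb q ^ (N + 2) := by
  obtain ⟨C₁, q₁, h1, hC₁⟩ := (hasOrder_iterComm_firstComm (Λ := Λ) (K := K) hι hm hβ hβ1 hσ c N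
    (N + 1) N).exists_norm_opB_le c
  obtain ⟨C₂, q₂, h2, hC₂⟩ := (hasOrder_nonresPart_gaugeIter_sub (Λ := Λ) (K := K) hι hm hβ hβ1 hσ c N
    (N + 1)).exists_norm_opB_le c
  refine ⟨C₁ + C₂, max q₁ q₂, by positivity, fun i => ?_⟩
  have hψ := bddCont_homSol_gaugeIter hι hm hβ hβ1 hσ c N (N + 1) i
  have hA := bddFam_firstComm_gaugeIter hι hm hβ hβ1 hσ c N (N + 1) i
  have hT := norm_flowInt_opB_sub_le (c := c) (S := i.S) (N + 1) hA hψ (homSol_eq_zero _)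
    (isSelfAdjoint_homSol_gaugeIter hι hm hβ hβ1 hσ c N (N + 1) i)
  unfold gaugeRem
  rw [gaugeStep_eq N i.b _ _ (gaugeIter_succ N i.b (N + 1)),
    opB_sub c (BddFam.sum fun j _ => (BddFam.iterComm hψ hA j).smul _)
      ((hasOrder_nonresPart_gaugeIter_sub hι hm hβ hβ1 hσ c N (N + 1)).inClass i).bddFam, ← sub_add]
  refine (norm_add_le _ _).trans ((add_le_add (hT.trans (hC₁ i)) (hC₂ i)).trans ?_)
  have hr := Real.rpow_pos_of_pos i.ρβ_pos ((N + 1 : ℕ) * (sigma m α β - 1) + α)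
  have m1 := i.mono (le_max_left q₁ q₂)
  have m2 := i.mono (le_max_right q₁ q₂)
  have n1 := i.nonneg q₁
  have n2 := i.nonneg q₂
  rw [add_mul, add_mul]
  gcongr

end Transform

end

end PeriodicPDO

namespace PeriodicPDO

noncomputable section

/-! ### Estimates in terms of the seminorms of symbols -/

section Estimates

variable {d : ℕ} (Γ : Submodule ℤ (E d)) [DiscreteTopology Γ] [IsZLattice ℝ Γ] {m α β γ : ℝ}

lemma latC_ne_zero : latC Γ ≠ 0 := fun h => by
  have := latC_sq_mul Γ
  simp [h] at this

/-- The data of the gauge transform for a symbol `b`. -/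
def symbolData {K : ℝ≥0 → ℕ → ℝ≥0} {ρ r : ℝ} (hρ : 1 ≤ ρ) (hr : r ≤ ρ) {b : Symb d}
    (hb : MemSymb Γ (weight β) α b) (hs : IsSymmSymb Γ b)
    (hK : ∀ (l : ℝ≥0) (s : ℕ), symbNorm Γ (weight β) α l s b ≤ K l s) :
    GaugeData (dualSub Γ) β α fun q => (d + 1 : ℝ) ^ q * K q q where
  ρ := ρ
  r := r
  b := coeffFam Γ b
  nb q := (d + 1 : ℝ) ^ q * (symbNorm Γ (weight β) α q q b).toReal
  one_le_ρ := hρ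
  r_le := hr
  smooth := hb.inClass.smooth
  symm θ ξ := hs θ θ.2 ξ
  bound q := famBound_coeffFam q (hb.finite q q)
  mono p q hpq := by
    have h1 : (1 : ℝ) ≤ d + 1 := by linarith [Nat.cast_nonneg (α := ℝ) d]
    have h2 : (symbNorm Γ (weight β) α p p b).toReal ≤ (symbNorm Γ (weight β) α q q b).toReal :=
      ENNReal.toReal_mono (hb.finite q q).ne
        (symbNorm_mono _ (weight_pos β) (by exact_mod_cast hpq) hpq b)
    have h3 : (d + 1 : ℝ) ^ p ≤ (d + 1 : ℝ) ^ q := pow_le_pow_right₀ h1 hpq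
    exact mul_le_mul h3 h2 ENNReal.toReal_nonneg (by positivity)
  nonneg q := mul_nonneg (by positivity) ENNReal.toReal_nonneg
  nb_le q := by
    have h : (symbNorm Γ (weight β) α q q b).toReal ≤ K q q :=
      ENNReal.toReal_le_coe_of_le_coe (hK q q)
    gcongr

lemma ofReal_mul_toReal_pow {N : ℝ≥0∞} (hN : N < ⊤) {D x : ℝ} (hD : 0 ≤ D) (hx : 0 ≤ x) (k : ℕ) :
    ENNReal.ofReal (D * (x * N.toReal) ^ k) = ENNReal.ofReal (x ^ k * D) * N ^ k := by
  rw [mul_pow, ← mul_assoc, mul_comm D, ENNReal.ofReal_mul (by positivity),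
    ENNReal.ofReal_pow ENNReal.toReal_nonneg, ENNReal.ofReal_toReal hN.ne]

variable {Γ} {K : ℕ → ℝ} {e : ℝ} {n : ℕ}

lemma HasOrder.exists_symbNorm_le {A : GaugeData (dualSub Γ) β α K → dualSub Γ → E d → ℂ}
    (h : HasOrder γ e n A) (l : ℝ≥0) (s : ℕ) : ∃ (C : ℝ) (q : ℕ), 0 ≤ C ∧
      ∀ i, symbNorm Γ (weight β) γ l s (symbOf (latC Γ) (A i)) ≤
        ENNReal.ofReal (C * (i.ρ ^ β) ^ e * i.nb q ^ (n + 1)) := by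
  obtain ⟨C, q, hC0, hC⟩ := h.bound (max ⌈l⌉₊ s)
  refine ⟨C, q, hC0, fun i => symbNorm_symbOf_le (h.inClass i).sumFam (hC i) ?_ (le_max_right _ _)⟩
  exact (Nat.le_ceil l).trans (by exact_mod_cast le_max_left _ _)

end Estimates

section Exponents

variable {m α β : ℝ}

lemma sigma_lt_one (hβ : 0 < β) (hαβ : β * (α - 2) < 2 * m - 2) : sigma m α β < 1 := by
  have : α - 2 < (2 * m - 2) / β := by
    rw [lt_div_iff₀ hβ]; linarith
  unfold sigma
  linarith

lemma eps_succ (m α β : ℝ) (j : ℕ) : eps m α β (j + 1) = j * (sigma m α β - 1) + α := by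
  unfold eps sigma
  push_cast
  ring

lemma tendsto_eps (hσ : sigma m α β < 1) : Tendsto (fun j : ℕ => eps m α β j) atTop atBot := by
  unfold eps
  refine tendsto_atBot_add_const_right _ _ (tendsto_atBot_add_const_right _ _ ?_)
  exact tendsto_natCast_atTop_atTop.atTop_mul_const_of_neg (by linarith)

end Exponents

section Main

variable {d : ℕ} {Γ : Submodule ℤ (E d)} [DiscreteTopology Γ] [IsZLattice ℝ Γ] {m α β : ℝ}
  {ι : ℝ → ℝ} {K : ℕ → ℝ}

/-- The conjugated operator, for given data. -/
lemma gauge_transform (hι : IsCutoff ι) (hm : 0 < m) (hβ : 0 < β) (hβ1 : β ≤ 1)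
    (hσ : sigma m α β < 1) (hαβ : α * β < 2 * m) (N : ℕ) (i : GaugeData (dualSub Γ) β α K) :
    sandwich
        (NormedSpace.exp (-(Complex.I • opB (latC Γ) (homSol ι m β i.ρ i.S
          (gaugeIter ι m β i.ρ (latC Γ) i.S N i.b (N + 1))))))
        (op (h₀ m + symbOf (latC Γ) i.b))
        (NormedSpace.exp (Complex.I • opB (latC Γ) (homSol ι m β i.ρ i.S
          (gaugeIter ι m β i.ρ (latC Γ) i.S N i.b (N + 1))))) =
      (op (h₀ m) + op (partZero Γ (symbOf (latC Γ) (resPart ι β i.ρ i.S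
          (gaugeIter ι m β i.ρ (latC Γ) i.S N i.b (N + 2)))))) +
        op (partFlat Γ ι β i.ρ i.r (symbOf (latC Γ) (resPart ι β i.ρ i.S
          (gaugeIter ι m β i.ρ (latC Γ) i.S N i.b (N + 2))))) +
        (op (partDown Γ ι i.ρ i.r (symbOf (latC Γ) (resPart ι β i.ρ i.S
          (gaugeIter ι m β i.ρ (latC Γ) i.S N i.b (N + 2))))) +
        op (partSharp Γ ι i.ρ i.r (symbOf (latC Γ) (resPart ι β i.ρ i.S
          (gaugeIter ι m β i.ρ (latC Γ) i.S N i.b (N + 2))))) +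
        op (partUp Γ i.r (symbOf (latC Γ) (resPart ι β i.ρ i.S
          (gaugeIter ι m β i.ρ (latC Γ) i.S N i.b (N + 2)))))) +
        bdd (gaugeRem ι m (latC Γ) N i) := by
  set y := gaugeIter ι m β i.ρ (latC Γ) i.S N i.b (N + 1) with hy
  set y' := gaugeIter ι m β i.ρ (latC Γ) i.S N i.b (N + 2) with hy'
  have hc := latC_ne_zero Γ
  have hxO := HasOrder.of_resPart hι hβ hβ1 (HasOrder.of_gaugeIter (Λ := dualSub Γ) (K := K)
    (c := latC Γ) hι hm hβ hβ1 hσ N (N + 2))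
  have hx : InClass β α (resPart ι β i.ρ i.S y') := hxO.inClass i
  have hxs : SymmFam (resPart ι β i.ρ i.S y') :=
    (i.symm.gaugeIter neg_mem_thetaFinset N (N + 2)).resPart neg_mem_thetaFinset
  have hb : InClass β α i.b := HasOrder.base.inClass i
  have hψ := bddCont_homSol_gaugeIter hι hm hβ hβ1 hσ (latC Γ) N (N + 1) i
  -- by the homological equation the commutator `i[H, Ψ]` is `firstComm`, which is bounded
  have hcomm : comm (latC Γ) i.S ((diagFam (latC Γ) fun ξ => (kin m ξ : ℂ)) + i.b)
      (homSol ι m β i.ρ i.S y) = firstComm ι m β i.ρ (latC Γ) i.S i.b y := by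
    rw [comm_add_left, comm_kin_homSol hc hι hm i.one_le_ρ fun θ hθ => ?_, firstComm]
    · abel
    · exact ⟨(mem_thetaFinset.1 hθ).2, (mem_thetaFinset.1 hθ).1.trans i.r_le⟩
  have hΘ : Theta Γ i.r ⊆ dualLattice Γ := fun θ hθ => hθ.1
  have h0 := isSymmCut_zero (d := d)
  have h1 := isSymmCut_flat (β := β) (ρ := i.ρ) (r := i.r) Γ hι
  have h2 := isSymmCut_down (ρ := i.ρ) (r := i.r) Γ hι
  have h3 := isSymmCut_sharp (ρ := i.ρ) (r := i.r) Γ hι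
  have h4 := isSymmCut_up (r := i.r) Γ
  have h := sandwich_eq hc hm hαβ hb i.symm hψ (homSol_eq_zero y) (w := y' -
    nonresPart ι β i.ρ i.S y' - i.b)
    (by rw [hcomm]; exact bddFam_firstComm_gaugeIter hι hm hβ hβ1 hσ (latC Γ) N (N + 1) i)
    (bddFam_rest hι hm hβ hβ1 hσ (latC Γ) N i)
    ((sum_parts_resPart Γ (ρ := i.ρ) (r := i.r) (β := β) hι y').trans
      (add_sub_cancel i.b _).symm)
    (h0.bddFam hm hαβ hx) (h0.symmFam hxs) (h1.bddFam hm hαβ hx) (h1.symmFam hxs)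
    (h2.bddFam hm hαβ hx) (h2.symmFam hxs) (h3.bddFam hm hαβ hx) (h3.symmFam hxs)
    (h4.bddFam hm hαβ hx) (h4.symmFam hxs)
  rw [hcomm] at h
  rw [h, partZero_symbOf hx.sumFam]
  unfold partFlat partDown partSharp partUp
  rw [cutSymb_symbOf hx.sumFam hΘ, cutSymb_symbOf hx.sumFam hΘ, cutSymb_symbOf hx.sumFam hΘ,
    cutSymb_symbOf hx.sumFam Set.sdiff_subset]
  rfl

end Main

end

end PeriodicPDO

theorem theorem4p3 {d : ℕ} (hd : 1 ≤ d)
    (Γ : Submodule ℤ (E d)) [DiscreteTopology Γ] [IsZLattice ℝ Γ]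
    (m α β κ : ℝ) (hm : 0 < m) (hβ : 0 < β) (hβ1 : β ≤ 1)
    (hαβ : β * (α - 2) < 2 * m - 2) (hκ : 0 < κ) (hκβ : κ < β)
    (ι : ℝ → ℝ) (hι : IsCutoff ι) :
    Tendsto (fun j : ℕ => eps m α β j) atTop atBot ∧
    ∀ M : ℕ, 1 ≤ M → ∀ K : ℝ≥0 → ℕ → ℝ≥0,
    -- the constants and the norm indices in the three estimates
    ∃ (C₁ : ℝ → ℝ≥0 → ℕ → ℝ) (p₁ : ℝ → ℝ≥0 → ℕ → ℝ≥0) (n₁ : ℝ → ℝ≥0 → ℕ → ℕ)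
      (C₂ : ℝ≥0 → ℕ → ℝ) (p₂ : ℝ≥0 → ℕ → ℝ≥0) (n₂ : ℝ≥0 → ℕ → ℕ)
      (C₃ : ℝ) (p₃ : ℝ≥0) (n₃ : ℕ),
    ∀ ρ r : ℝ, 1 ≤ ρ → 1 ≤ r → r ≤ ρ ^ κ →
    ∀ b : Symb d, MemSymb Γ (weight β) α b → IsSymmSymb Γ b →
    (∀ (l : ℝ≥0) (s : ℕ), symbNorm Γ (weight β) α l s b ≤ K l s) →
    ∃ (ψ x : Symb d) (Ψ R : L2 d →L[ℂ] L2 d),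
      IsSymmSymb Γ ψ ∧ IsSymmSymb Γ x ∧
      (∀ γ : ℝ, MemSymb Γ (weight β) γ ψ) ∧ MemSymb Γ (weight β) α x ∧
      IsSelfAdjoint Ψ ∧ op ψ = bdd Ψ ∧ IsSelfAdjoint R ∧
      (∀ (γ : ℝ) (l : ℝ≥0) (s : ℕ), symbNorm Γ (weight β) γ l s ψ ≤
        ENNReal.ofReal (C₁ γ l s * ρ ^ (β * (sigma m α β - γ))) *
          symbNorm Γ (weight β) α (p₁ γ l s) (n₁ γ l s) b) ∧
      (∀ (l : ℝ≥0) (s : ℕ), symbNorm Γ (weight β) α l s x ≤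
        ENNReal.ofReal (C₂ l s) * symbNorm Γ (weight β) α (p₂ l s) (n₂ l s) b) ∧
      ENNReal.ofReal ‖R‖ ≤
        ENNReal.ofReal (C₃ * ρ ^ (β * eps m α β (M + 1))) *
          symbNorm Γ (weight β) α p₃ n₃ b ^ (M + 1) ∧
      sandwich (NormedSpace.exp (-(Complex.I • Ψ))) (op (h₀ m + b))
          (NormedSpace.exp (Complex.I • Ψ)) =
        (op (h₀ m) + op (partZero Γ x)) + op (partFlat Γ ι β ρ r x) +
          (op (partDown Γ ι ρ r x) + op (partSharp Γ ι ρ r x) + op (partUp Γ r x)) + bdd R := by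
  have hσ := sigma_lt_one hβ hαβ
  have hαβ' : α * β < 2 * m := by nlinarith
  refine ⟨tendsto_eps hσ, fun M hM K => ?_⟩
  obtain ⟨N, rfl⟩ : ∃ N, M = N + 1 := ⟨M - 1, by omega⟩
  set K' : ℕ → ℝ := fun q => (d + 1 : ℝ) ^ q * K q q with hK'
  -- the estimates, uniform in all data with these bounds
  have hψO := fun γ => hasOrder_homSol_gaugeIter (Λ := dualSub Γ) (α := α) (K := K') hι hm hβ hβ1 hσ
    (latC Γ) γ N (N + 1)
  have hxO := HasOrder.of_resPart hι hβ hβ1 (HasOrder.of_gaugeIter (Λ := dualSub Γ) (α := α) (K := K')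
    (c := latC Γ) hι hm hβ hβ1 hσ N (N + 2))
  choose C₁ q₁ hC₁0 hC₁ using fun γ l s => (hψO γ).exists_symbNorm_le l s
  choose C₂ q₂ hC₂0 hC₂ using hxO.exists_symbNorm_le
  obtain ⟨C₃, q₃, hC₃0, hC₃⟩ := exists_norm_gaugeRem_le (Λ := dualSub Γ) (K := K') hι hm hβ hβ1 hσ
    (latC Γ) N
  refine ⟨fun γ l s => (d + 1 : ℝ) ^ q₁ γ l s * C₁ γ l s, fun γ l s => q₁ γ l s, q₁,
    fun l s => (d + 1 : ℝ) ^ q₂ l s * C₂ l s, fun l s => q₂ l s, q₂,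
    ((d + 1 : ℝ) ^ q₃) ^ (N + 2) * C₃, q₃, q₃, fun ρ r hρ hr hrκ b hb hs hK => ?_⟩
  have hρ0 : 0 < ρ := by linarith
  have hrρ : r ≤ ρ := hrκ.trans
    ((Real.rpow_le_rpow_of_exponent_le hρ (hκβ.le.trans hβ1)).trans (Real.rpow_one ρ).le)
  set i : GaugeData (dualSub Γ) β α K' := symbolData Γ hρ hrρ hb hs hK with hi
  set ψ := homSol ι m β i.ρ i.S (gaugeIter ι m β i.ρ (latC Γ) i.S N i.b (N + 1)) with hψ
  set x := resPart ι β i.ρ i.S (gaugeIter ι m β i.ρ (latC Γ) i.S N i.b (N + 2)) with hx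
  have hψc : ∀ γ, InClass β γ ψ := fun γ => (hψO γ).inClass i
  have hxc : InClass β α x := hxO.inClass i
  have hsy := fun n => i.symm.gaugeIter (ι := ι) (m := m) (β := β) (ρ := i.ρ) (c := latC Γ)
    (S := i.S) neg_mem_thetaFinset N n
  have hψs : SymmFam ψ := (hsy _).homSol neg_mem_thetaFinset
  have hxs : SymmFam x := (hsy _).resPart neg_mem_thetaFinset
  have hρe : ∀ e : ℝ, (ρ ^ β) ^ e = ρ ^ (β * e) := fun e => (Real.rpow_mul hρ0.le β e).symm
  have hfin : ∀ q : ℕ, symbNorm Γ (weight β) α q q b < ⊤ := fun q => hb.finite q q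
  refine ⟨symbOf (latC Γ) ψ, symbOf (latC Γ) x, opB (latC Γ) ψ, gaugeRem ι m (latC Γ) N i,
    hψs.isSymmSymb (hψc 0).sumFam, hxs.isSymmSymb hxc.sumFam, fun γ => (hψc γ).memSymb,
    hxc.memSymb, opB_isSelfAdjoint _ (hψc 0).bddFam hψs, op_eq_bdd _ (hψc 0).bddFam hψs,
    isSelfAdjoint_gaugeRem hι hm hβ hβ1 hσ (latC Γ) N i, fun γ l s => ?_, fun l s => ?_, ?_, ?_⟩
  · refine (hC₁ γ l s i).trans (le_of_eq ?_)
    change ENNReal.ofReal (C₁ γ l s * (ρ ^ β) ^ _ * ((d + 1 : ℝ) ^ _ * ENNReal.toReal _) ^ _) = _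
    have hC := hC₁0 γ l s
    rw [hρe, ofReal_mul_toReal_pow (hfin _) (by positivity) (by positivity), zero_add, pow_one,
      pow_one, ← mul_assoc]
  · refine (hC₂ l s i).trans (le_of_eq ?_)
    change ENNReal.ofReal (C₂ l s * (ρ ^ β) ^ _ * ((d + 1 : ℝ) ^ _ * ENNReal.toReal _) ^ _) = _
    have hC := hC₂0 l s
    rw [Real.rpow_zero, mul_one, ofReal_mul_toReal_pow (hfin _) hC (by positivity), zero_add,
      pow_one, pow_one]
  · refine (ENNReal.ofReal_le_ofReal (hC₃ i)).trans (le_of_eq ?_)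
    change ENNReal.ofReal (C₃ * (ρ ^ β) ^ _ * ((d + 1 : ℝ) ^ _ * ENNReal.toReal _) ^ _) = _
    rw [hρe, ← eps_succ, ofReal_mul_toReal_pow (hfin _) (by positivity) (by positivity),
      ← mul_assoc]
  · have h := gauge_transform hι hm hβ hβ1 hσ hαβ' N i
    have hbs : symbOf (latC Γ) i.b = b := hb.eq_symbOf.symm
    rw [hbs] at h
    exact h
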